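/- Notation. Let $\mathfrak g=\mathfrak{sp}(\infty)$, realized as the finitary endomorphisms, skew with respect to the standard symplectic form, of the space with basis $e_i$, $i\in\mathbb Z\setminus\{0\}$. Let $\mathfrak h$ be its diagonal Cartan subalgebra and $\varepsilon_i$ the $i$-th diagonal entry (so $\varepsilon_{-i}=-\varepsilon_i$). The roots are $\varepsilon_p-\varepsilon_q$, for $p\ne q$ in $\mathbb Z\setminus\{0\}$. For a set $Z\subseteq\mathbb Z_{>0}$ let $\mathfrak{sp}(Z)$ be the corresponding symplectic algebra with indices $\pm i$, $i\in Z$; for a set $J$ let $\mathfrak{sl}(J)$ be the algebra of finitary traceless $J\times J$ matrices. For $\mu\in\mathbb C^{Z}$ let $\mathrm{Int}^+(\mu)=\{i:\mu_i\in\mathbb Z_{\ge0}\}$. For $\lambda,\mu\in\mathbb C^Z$ let $Q$ be the set of integral, finitely supported sequences with even sum, put $V_{\mathfrak{sp}}(\mu)=\mathrm{span}\{x^\lambda:\lambda-\mu\in Q,\ \mathrm{Int}^+(\mu)\subseteq\mathrm{Int}^+(\lambda)\}$, on which $\mathfrak{sp}(Z)$ acts by $\mathfrak g_{\varepsilon_i-\varepsilon_j}\to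 x_i\partial_j$, $\mathfrak g_{\varepsilon_i+\varepsilon_j}\to x_ix_j$, $\mathfrak g_{-\varepsilon_i-\varepsilon_j}\to\partial_i\partial_j$ (up to nonzero scalars), let $V_{\mathfrak{sp}}(\mu)^+$ be the sum of all $V_{\mathfrak{sp}}(\mu')\subsetneq V_{\mathfrak{sp}}(\mu)$, and let $X_{\mathfrak{sp}}(\mu)=V_{\mathfrak{sp}}(\mu)/V_{\mathfrak{sp}}(\mu)^+$. Write $\lambda\sim_{\mathfrak{sp}}\mu$ if $\lambda-\mu\in Q$ and $\mathrm{Int}^+(\lambda)=\mathrm{Int}^+(\mu)$. The $\mathfrak{sl}(J)$-module $X_{\mathfrak{sl}}(\eta)$, $\eta\in\mathbb C^J$, is defined in the same way, with $E_{ij}\mapsto x_i\partial_j$ and with "sum zero" instead of "even sum". Let $\prec$ be a strict partial order on $\mathbb Z$ with $i\prec j\Rightarrow -j\prec -i$, and for $i\in\mathbb Z$ let $[i]$ consist of $i$ and of all elements not comparable with $i$; assume that $[i]\neq[j]$ implies $[i]\cap[j]=\emptyset$. Then the classes are linearly ordered. The root $\varepsilon_p-\varepsilon_q$ is called positive if $p\prec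 q$, and not comparable with $0$ if $p,q$ are not comparable. Let $\mathfrak l(\prec)$ be the sum of $\mathfrak h$ and the root spaces of the roots not comparable with $0$, $\mathfrak u(\prec)$ the sum of the root spaces of the positive roots, and $\mathfrak p(\prec)=\mathfrak l(\prec)\oplus\mathfrak u(\prec)$. A simple weight $\mathfrak g$-module $M$ is $\mathfrak p(\prec)$-aligned if it is isomorphic to the simple quotient of $U(\mathfrak g)\otimes_{U(\mathfrak p(\prec))}S$ for some simple weight $\mathfrak l(\prec)$-module $S$ with $\mathfrak u(\prec)S=0$. Let $M^{\mathfrak u(\prec)}=\{m\in M:\mathfrak u(\prec)m=0\}$. The semisimple part $\mathfrak l(\prec)^{ss}$ is $\mathfrak{sp}([0])\oplus\bigoplus_{[i]\ne[0]}\mathfrak{sl}([i])$, where $\mathfrak{sp}([0])=\mathfrak{sp}([0]\cap\mathbb Z_{>0})$ and where $\mathfrak{sl}([i])=\mathfrak{sl}([-i])$ is counted once. For $\mu\in\mathbb C^{\mathbb Z_{>0}}$ let $R_\mu(\prec)$ be the set of all $\omega\sim_{\mathfrak{sp}}\mu$ with $\omega_i=-1$ for all $i\in\mathbb Z_{>0}$,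 $i\prec0$, and $\omega_i=0$ for all $i\in\mathbb Z_{>0}$, $i\succ0$. Let $\omega(+)$ (resp. $\omega(-)$) be the sequence with these entries at the $i\notin[0]$ and with entries $0$ (resp. $-1$) at all $i\in[0]\cap\mathbb Z_{>0}$. For $\omega\in\mathbb C^{\mathbb Z_{>0}}$ let $\omega_{[0]}$ be its restriction to $[0]\cap\mathbb Z_{>0}$. Statement. Suppose that $X_{\mathfrak{sp}}(\mu)$ is $\mathfrak p(\prec)$-aligned. Then one of the following holds. 1. $\mu\sim_{\mathfrak{sp}}\omega$ for some $\omega\in R_\mu(\prec)$, and $X_{\mathfrak{sp}}(\mu)^{\mathfrak u(\prec)}\cong X_{\mathfrak{sp}}(\omega_{[0]})\boxtimes\mathbb C$ as $\mathfrak{sp}([0])\oplus\bigl(\bigoplus_{[i]\neq[0]}\mathfrak{sl}([i])\bigr)$-modules. 2. $\mu\sim_{\mathfrak{sp}}\omega(+)-\varepsilon_{i_0}$ for some $i_0\in\mathbb Z_{>0}$ such that $[i_0]$ is the maximal element of $\{[i]\prec[0]\}$, and $X_{\mathfrak{sp}}(\mu)^{\mathfrak u(\prec)}\cong\mathbb C\boxtimes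 X_{\mathfrak{sl}}(-\mathbf 1-\varepsilon_{i_0})\boxtimes\mathbb C$ as $\mathfrak{sp}([0])\oplus\mathfrak{sl}([i_0])\oplus\bigl(\bigoplus_{[i]\neq[0],[\pm i_0]}\mathfrak{sl}([i])\bigr)$-modules. 3. $\mu\sim_{\mathfrak{sp}}\omega(-)+\varepsilon_{i_0}$ for some $i_0\in\mathbb Z_{>0}$ such that $[i_0]$ is the minimal element of $\{[i]\succ[0]\}$, and $X_{\mathfrak{sp}}(\mu)^{\mathfrak u(\prec)}\cong\mathbb C\boxtimes X_{\mathfrak{sl}}(\varepsilon_{i_0})\boxtimes\mathbb C$ as $\mathfrak{sp}([0])\oplus\mathfrak{sl}([i_0])\oplus\bigl(\bigoplus_{[i]\neq[0],[\pm i_0]}\mathfrak{sl}([i])\bigr)$-modules. 4. $\mu\sim_{\mathfrak{sp}}\omega(+)$ and $\{[i]\prec[0]\}$ has a maximal element, or $\mu\sim_{\mathfrak{sp}}\omega(-)$ and $\{[i]\succ[0]\}$ has a minimal element; and $X_{\mathfrak{sp}}(\mu)^{\mathfrak u(\prec)}\cong\mathbb C$ is the trivial $\mathfrak l(\prec)^{ss}$-module.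 Moreover, the form of $\mu$ determines which isomorphism occurs: the isomorphism in 1 holds for every $\omega\in R_\mu(\prec)$; if $[0]\neq\{0\}$, then $R_\mu(\prec)\neq\emptyset$; and if $[0]=\{0\}$, then the isomorphism in 2 (resp. 3) holds for every $i_0$ as in 2 (resp. 3) with $\mu\sim_{\mathfrak{sp}}\omega(+)-\varepsilon_{i_0}$ (resp. $\mu\sim_{\mathfrak{sp}}\omega(-)+\varepsilon_{i_0}$), and the isomorphism in 4 holds whenever $\mu\sim_{\mathfrak{sp}}\omega(+)$ or $\mu\sim_{\mathfrak{sp}}\omega(-)$. -/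

import Mathlib

open scoped TensorProduct

attribute [local instance 100] LieRing.ofAssociativeRing

noncomputable section

namespace WeightModules

/-! ### Finitary Lie algebras of type A and C -/

/-- An endomorphism of the space with basis `I` is finitary if it kills all but finitely many
basis vectors, i.e. if its matrix has only finitely many nonzero entries. -/
def IsFinitary {I : Type} (A : Module.End ℂ (I →₀ ℂ)) : Prop :=
  {j | A (Finsupp.single j 1) ≠ 0}.Finite

theorem IsFinitary.exists_finset {I : Type} {A : Module.End ℂ (I →₀ ℂ)} (hA : IsFinitary A) :
    ∃ K : Finset I, ∀ j, j ∉ K → A (Finsupp.single j 1) = 0 :=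
  ⟨Set.Finite.toFinset hA, fun j hj => by
    by_contra h
    exact hj ((Set.Finite.mem_toFinset hA).2 h)⟩

theorem isFinitary_of_finset {I : Type} {A : Module.End ℂ (I →₀ ℂ)} (K : Finset I)
    (h : ∀ j, j ∉ K → A (Finsupp.single j 1) = 0) : IsFinitary A :=
  K.finite_toSet.subset fun j hj => by
    by_contra hK
    exact hj (h j (by simpa using hK))

theorem apply_eq_sum {I : Type} {W : Type} [AddCommGroup W] [Module ℂ W]
    (A : (I →₀ ℂ) →ₗ[ℂ] W) (K : Finset I)
    (h : ∀ j, j ∉ K → A (Finsupp.single j 1) = 0) (v : I →₀ ℂ) :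
    A v = ∑ j ∈ K, v j • A (Finsupp.single j 1) := by
  classical
  induction v using Finsupp.induction_linear with
  | zero => simp
  | add f g hf hg => simp [hf, hg, add_smul, Finset.sum_add_distrib]
  | single i c =>
    have hc : A (Finsupp.single i c) = c • A (Finsupp.single i 1) := by
      rw [← map_smul, Finsupp.smul_single, smul_eq_mul, mul_one]
    rw [hc, Finset.sum_eq_single i]
    · simp
    · intro j _ hj
      simp [Finsupp.single_eq_of_ne hj]
    · intro hi
      rw [h i hi, smul_zero]

theorem exists_finset₂ {I : Type} {A B : Module.End ℂ (I →₀ ℂ)} (hA : IsFinitary A)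
    (hB : IsFinitary B) : ∃ K : Finset I, (∀ j, j ∉ K → A (Finsupp.single j 1) = 0) ∧
      (∀ j, j ∉ K → B (Finsupp.single j 1) = 0) := by
  classical
  obtain ⟨K, hK⟩ := hA.exists_finset
  obtain ⟨L, hL⟩ := hB.exists_finset
  exact ⟨K ∪ L, fun j hj => hK j fun h => hj (Finset.mem_union_left _ h),
    fun j hj => hL j fun h => hj (Finset.mem_union_right _ h)⟩

theorem IsFinitary.zero {I : Type} : IsFinitary (0 : Module.End ℂ (I →₀ ℂ)) :=
  isFinitary_of_finset ∅ (by simp)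

theorem IsFinitary.add {I : Type} {A B : Module.End ℂ (I →₀ ℂ)} (hA : IsFinitary A)
    (hB : IsFinitary B) : IsFinitary (A + B) := by
  obtain ⟨K, h1, h2⟩ := exists_finset₂ hA hB
  exact isFinitary_of_finset K fun j hj => by simp [h1 j hj, h2 j hj]

theorem IsFinitary.smul {I : Type} {A : Module.End ℂ (I →₀ ℂ)} (c : ℂ) (hA : IsFinitary A) :
    IsFinitary (c • A) := by
  obtain ⟨K, h1⟩ := hA.exists_finset
  exact isFinitary_of_finset K fun j hj => by simp [h1 j hj]

theorem IsFinitary.lie {I : Type} {A B : Module.End ℂ (I →₀ ℂ)} (hA : IsFinitary A)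
    (hB : IsFinitary B) : IsFinitary ⁅A, B⁆ := by
  obtain ⟨K, h1, h2⟩ := exists_finset₂ hA hB
  exact isFinitary_of_finset K fun j hj => by
    simp [LieRing.of_associative_ring_bracket, h1 j hj, h2 j hj]

/-- The trace of an endomorphism (meaningful for finitary ones). -/
def tr {I : Type} (A : Module.End ℂ (I →₀ ℂ)) : ℂ := ∑ᶠ j, A (Finsupp.single j 1) j

theorem tr_eq_sum {I : Type} {A : Module.End ℂ (I →₀ ℂ)} (K : Finset I)
    (h : ∀ j, j ∉ K → A (Finsupp.single j 1) = 0) :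
    tr A = ∑ j ∈ K, A (Finsupp.single j 1) j := by
  apply finsum_eq_sum_of_support_subset
  intro j hj
  by_contra hK
  exact hj (by simp [h j (by simpa using hK)])

theorem tr_mul_comm {I : Type} {A B : Module.End ℂ (I →₀ ℂ)} (K : Finset I)
    (hA : ∀ j, j ∉ K → A (Finsupp.single j 1) = 0)
    (hB : ∀ j, j ∉ K → B (Finsupp.single j 1) = 0) : tr (A * B) = tr (B * A) := by
  rw [tr_eq_sum K (fun j hj => by simp [hB j hj]), tr_eq_sum K (fun j hj => by simp [hA j hj])]
  simp only [Module.End.mul_apply]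
  have e1 : ∀ j, A (B (Finsupp.single j 1)) j
      = ∑ k ∈ K, B (Finsupp.single j 1) k * A (Finsupp.single k 1) j := fun j => by
    rw [apply_eq_sum A K hA]; simp [Finsupp.finsetSum_apply]
  have e2 : ∀ j, B (A (Finsupp.single j 1)) j
      = ∑ k ∈ K, A (Finsupp.single j 1) k * B (Finsupp.single k 1) j := fun j => by
    rw [apply_eq_sum B K hB]; simp [Finsupp.finsetSum_apply]
  simp only [e1, e2]
  rw [Finset.sum_comm]
  exact Finset.sum_congr rfl fun j _ => Finset.sum_congr rfl fun k _ => mul_comm _ _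

/-- `sl J`: finitary endomorphisms of trace zero of the space with basis `J`
(this is `sl(∞)` if `J` is countably infinite, and `sl(n)` if `J` has `n` elements). -/
def sl (J : Type) : LieSubalgebra ℂ (Module.End ℂ (J →₀ ℂ)) where
  carrier := {A | IsFinitary A ∧ tr A = 0}
  zero_mem' := ⟨IsFinitary.zero, by simp [tr]⟩
  add_mem' := by
    rintro A B ⟨hA, tA⟩ ⟨hB, tB⟩
    refine ⟨hA.add hB, ?_⟩
    obtain ⟨K, h1, h2⟩ := exists_finset₂ hA hB
    rw [tr_eq_sum K h1] at tA
    rw [tr_eq_sum K h2] at tB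
    rw [tr_eq_sum K (fun j hj => by simp [h1 j hj, h2 j hj])]
    simp [Finset.sum_add_distrib, tA, tB]
  smul_mem' := by
    rintro c A ⟨hA, tA⟩
    refine ⟨hA.smul c, ?_⟩
    obtain ⟨K, h1⟩ := hA.exists_finset
    rw [tr_eq_sum K h1] at tA
    rw [tr_eq_sum K (fun j hj => by simp [h1 j hj])]
    simp [← Finset.mul_sum, tA]
  lie_mem' := by
    rintro A B ⟨hA, -⟩ ⟨hB, -⟩
    refine ⟨hA.lie hB, ?_⟩
    obtain ⟨K, h1, h2⟩ := exists_finset₂ hA hB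
    have h := tr_mul_comm K h1 h2
    rw [tr_eq_sum K (fun j hj => by simp [h2 j hj]),
      tr_eq_sum K (fun j hj => by simp [h1 j hj])] at h
    rw [tr_eq_sum K (fun j hj => by
      simp [LieRing.of_associative_ring_bracket, h1 j hj, h2 j hj])]
    simpa [LieRing.of_associative_ring_bracket, sub_eq_zero] using h

/-- The natural module of `sp ι`: its basis consists of `e_i` (`Sum.inl i`) and
`e_{-i}` (`Sum.inr i`), for `i` in `ι`. -/
abbrev SpV (ι : Type) := (ι ⊕ ι) →₀ ℂ

/-- The basis vectors of the natural module. -/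
abbrev bv {ι : Type} (s : ι ⊕ ι) : SpV ι := Finsupp.single s 1

/-- `1` on positive indices, `-1` on negative ones. -/
def sgn {ι : Type} : ι ⊕ ι → ℂ := Sum.elim (fun _ => 1) (fun _ => -1)

/-- The symplectic form `Ω(u, v) = ∑ i, (u_i v_{-i} - u_{-i} v_i)`. -/
def omega (ι : Type) : SpV ι →ₗ[ℂ] SpV ι →ₗ[ℂ] ℂ :=
  Finsupp.linearCombination ℂ (fun s => sgn s • Finsupp.lapply (Sum.swap s))

@[simp] theorem sgn_swap {ι : Type} (s : ι ⊕ ι) : sgn s.swap = -sgn s := by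
  cases s <;> simp [sgn]

@[simp] theorem sgn_mul_self {ι : Type} (s : ι ⊕ ι) : sgn s * sgn s = 1 := by
  cases s <;> simp [sgn]

theorem omega_bv_left {ι : Type} (s : ι ⊕ ι) (v : SpV ι) :
    omega ι (bv s) v = sgn s * v s.swap := by
  simp [omega]

theorem omega_swap {ι : Type} (u v : SpV ι) : omega ι u v = -omega ι v u := by
  classical
  induction u using Finsupp.induction_linear with
  | zero => simp
  | add f g hf hg => simp only [map_add, LinearMap.add_apply, hf, hg]; ring
  | single i c =>
    induction v using Finsupp.induction_linear with
    | zero => simp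
    | add f g hf hg => simp only [map_add, LinearMap.add_apply, hf, hg]; ring
    | single j d =>
      simp only [omega, Finsupp.linearCombination_single, LinearMap.smul_apply,
        Finsupp.lapply_apply, Finsupp.single_apply, smul_eq_mul]
      rcases i with i | i <;> rcases j with j | j <;> simp [sgn, eq_comm]
      · split_ifs <;> ring
      · split_ifs <;> ring

/-- `sp ι`: finitary endomorphisms of the natural module which are skew with respect to `Ω`
(this is `sp(∞)` if `ι` is countably infinite, and `sp(2n)` if `ι` has `n` elements). -/
def sp (ι : Type) : LieSubalgebra ℂ (Module.End ℂ (SpV ι)) where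
  carrier := {A | IsFinitary A ∧ ∀ u v, omega ι (A u) v + omega ι u (A v) = 0}
  zero_mem' := ⟨IsFinitary.zero, by simp⟩
  add_mem' := by
    rintro A B ⟨hA, tA⟩ ⟨hB, tB⟩
    refine ⟨hA.add hB, fun u v => ?_⟩
    simp only [LinearMap.add_apply, map_add]
    linear_combination tA u v + tB u v
  smul_mem' := by
    rintro c A ⟨hA, tA⟩
    refine ⟨hA.smul c, fun u v => ?_⟩
    simp only [LinearMap.smul_apply, map_smul, smul_eq_mul]
    linear_combination c * tA u v
  lie_mem' := by
    rintro A B ⟨hA, tA⟩ ⟨hB, tB⟩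
    refine ⟨hA.lie hB, fun u v => ?_⟩
    simp only [LieRing.of_associative_ring_bracket, LinearMap.sub_apply, map_sub,
      Module.End.mul_apply]
    linear_combination tA (B u) v - tB u (A v) - tB (A u) v + tA u (B v)

/-! ### Monomials with complex exponents and the action of the Weyl algebra -/

/-- The space spanned by all formal monomials `x ^ lam = ∏ i, x_i ^ (lam i)`,
with `lam : ι → ℂ`. -/
def Mono (ι : Type) := (ι → ℂ) →₀ ℂ

instance (ι : Type) : AddCommGroup (Mono ι) := inferInstanceAs (AddCommGroup ((ι → ℂ) →₀ ℂ))

instance (ι : Type) : Module ℂ (Mono ι) := inferInstanceAs (Module ℂ ((ι → ℂ) →₀ ℂ))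

/-- The basis of all monomials. -/
def monoBasis (ι : Type) : Module.Basis (ι → ℂ) ℂ (Mono ι) :=
  Module.Basis.ofRepr (LinearEquiv.refl ℂ ((ι → ℂ) →₀ ℂ))

/-- The monomial `x ^ lam`. -/
def mono {ι : Type} (lam : ι → ℂ) : Mono ι := monoBasis ι lam

open Classical in
/-- The sequence with `1` at the entry `i` and zeros elsewhere. -/
def eps {ι : Type} (i : ι) : ι → ℂ := Pi.single i 1

/-- Multiplication by `x_i`. -/
def mulX {ι : Type} (i : ι) : Module.End ℂ (Mono ι) :=
  (monoBasis ι).constr ℂ (fun lam => mono (lam + eps i))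

/-- The partial derivative with respect to `x_i`. -/
def derX {ι : Type} (i : ι) : Module.End ℂ (Mono ι) :=
  (monoBasis ι).constr ℂ (fun lam => lam i • mono (lam - eps i))

@[simp] theorem mulX_mono {ι : Type} (i : ι) (lam : ι → ℂ) :
    mulX i (mono lam) = mono (lam + eps i) :=
  (monoBasis ι).constr_basis ℂ _ _

@[simp] theorem derX_mono {ι : Type} (i : ι) (lam : ι → ℂ) :
    derX i (mono lam) = lam i • mono (lam - eps i) :=
  (monoBasis ι).constr_basis ℂ _ _

theorem end_ext {ι : Type} {S T : Module.End ℂ (Mono ι)}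
    (h : ∀ lam, S (mono lam) = T (mono lam)) : S = T :=
  (monoBasis ι).ext h

theorem mulX_comm {ι : Type} (i j : ι) : mulX i * mulX j = mulX j * mulX i :=
  end_ext fun lam => by
    simp only [Module.End.mul_apply, mulX_mono, add_right_comm]

theorem derX_comm {ι : Type} (i j : ι) : derX i * derX j = derX j * derX i :=
  end_ext fun lam => by
    by_cases h : i = j
    · subst h; rfl
    · simp only [Module.End.mul_apply, derX_mono, map_smul, smul_smul, sub_right_comm]
      congr 1
      simp [eps, h, Ne.symm h, mul_comm]

theorem derX_mulX_self {ι : Type} (i : ι) : derX i * mulX i = mulX i * derX i + 1 :=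
  end_ext fun lam => by
    simp only [Module.End.mul_apply, mulX_mono, derX_mono, map_smul, LinearMap.add_apply,
      Module.End.one_apply, add_sub_cancel_right, sub_add_cancel]
    simp [eps, add_smul]

theorem derX_mulX_ne {ι : Type} {i j : ι} (h : i ≠ j) : derX i * mulX j = mulX j * derX i :=
  end_ext fun lam => by
    simp only [Module.End.mul_apply, mulX_mono, derX_mono, map_smul]
    have e : (lam + eps j) i = lam i := by simp [eps, Pi.single_apply, h]
    rw [e, sub_add_eq_add_sub]

/-! ### The `sl`-modules `X_sl(μ)` -/

/-- Linear forms `∑ v_j x_j` in the variables. -/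
def linX {J : Type} : (J →₀ ℂ) →ₗ[ℂ] Module.End ℂ (Mono J) :=
  Finsupp.linearCombination ℂ mulX

/-- The differential operator attached to a finitary matrix; on elementary matrices
it is `E_{ij} ↦ x_i ∂_j`. -/
def slOp {J : Type} (A : Module.End ℂ (J →₀ ℂ)) : Module.End ℂ (Mono J) :=
  ∑ᶠ j, linX (A (Finsupp.single j 1)) * derX j

theorem slOp_eq_sum {J : Type} {A : Module.End ℂ (J →₀ ℂ)} (K : Finset J)
    (h : ∀ j, j ∉ K → A (Finsupp.single j 1) = 0) :
    slOp A = ∑ j ∈ K, linX (A (Finsupp.single j 1)) * derX j := by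
  apply finsum_eq_sum_of_support_subset
  intro j hj
  by_contra hK
  exact hj (by simp [h j (by simpa using hK)])

theorem linX_comm {J : Type} (u v : J →₀ ℂ) : linX u * linX v = linX v * linX u := by
  induction u using Finsupp.induction_linear with
  | zero => simp
  | add f g hf hg => simp only [map_add, add_mul, mul_add, hf, hg]
  | single i c =>
    induction v using Finsupp.induction_linear with
    | zero => simp
    | add f g hf hg => simp only [map_add, add_mul, mul_add, hf, hg]
    | single j d => simp [linX, mulX_comm i j, smul_smul, mul_comm]

theorem derX_linX {J : Type} (i : J) (v : J →₀ ℂ) :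
    derX i * linX v = linX v * derX i + v i • 1 := by
  classical
  induction v using Finsupp.induction_linear with
  | zero => simp
  | add f g hf hg =>
    simp only [map_add, add_mul, mul_add, hf, hg, Finsupp.add_apply, add_smul]
    abel
  | single j c =>
    by_cases h : i = j
    · subst h
      simp [linX, derX_mulX_self]
    · simp [linX, derX_mulX_ne h, Finsupp.single_eq_of_ne h]

theorem slOp_mul {J : Type} {A B : Module.End ℂ (J →₀ ℂ)} (K : Finset J)
    (hA : ∀ j, j ∉ K → A (Finsupp.single j 1) = 0)
    (hB : ∀ j, j ∉ K → B (Finsupp.single j 1) = 0) :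
    slOp A * slOp B = slOp (A * B) + ∑ j ∈ K, ∑ k ∈ K, linX (A (Finsupp.single j 1)) *
      linX (B (Finsupp.single k 1)) * (derX j * derX k) := by
  rw [slOp_eq_sum K hA, slOp_eq_sum K hB,
    slOp_eq_sum (A := A * B) K (fun j hj => by simp [hB j hj]), Finset.sum_mul_sum]
  have e : ∀ k, linX ((A * B) (Finsupp.single k 1)) * derX k =
      ∑ j ∈ K, B (Finsupp.single k 1) j • (linX (A (Finsupp.single j 1)) * derX k) := fun k => by
    rw [Module.End.mul_apply, apply_eq_sum A K hA, map_sum, Finset.sum_mul]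
    simp
  rw [Finset.sum_congr rfl fun k _ => e k,
    Finset.sum_comm (f := fun k j => B (Finsupp.single k 1) j •
      (linX (A (Finsupp.single j 1)) * derX k)), ← Finset.sum_add_distrib]
  refine Finset.sum_congr rfl fun j _ => ?_
  rw [← Finset.sum_add_distrib]
  refine Finset.sum_congr rfl fun k _ => ?_
  have h := derX_linX j (B (Finsupp.single k 1))
  calc linX (A (Finsupp.single j 1)) * derX j * (linX (B (Finsupp.single k 1)) * derX k)
      = linX (A (Finsupp.single j 1)) * (derX j * linX (B (Finsupp.single k 1))) * derX k := by
        simp only [mul_assoc]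
    _ = _ := by
        rw [h]
        simp only [mul_add, add_mul, mul_assoc, mul_smul_comm, smul_mul_assoc, mul_one]
        abel

/-- The action of `sl J` on monomials. -/
def slRep (J : Type) : sl J →ₗ⁅ℂ⁆ Module.End ℂ (Mono J) where
  toFun A := slOp A.1
  map_add' A B := by
    obtain ⟨K, h1, h2⟩ := exists_finset₂ A.2.1 B.2.1
    rw [slOp_eq_sum K h1, slOp_eq_sum K h2,
      slOp_eq_sum K (fun j hj => by simp [h1 j hj, h2 j hj])]
    simp [add_mul, Finset.sum_add_distrib]
  map_smul' c A := by
    obtain ⟨K, h1⟩ := A.2.1.exists_finset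
    rw [slOp_eq_sum K h1, slOp_eq_sum K (fun j hj => by simp [h1 j hj])]
    simp [Finset.smul_sum]
  map_lie' {A B} := by
    obtain ⟨K, h1, h2⟩ := exists_finset₂ A.2.1 B.2.1
    have hs : slOp (A.1 * B.1 - B.1 * A.1) = slOp (A.1 * B.1) - slOp (B.1 * A.1) := by
      rw [slOp_eq_sum (A := A.1 * B.1) K (fun j hj => by simp [h2 j hj]),
        slOp_eq_sum (A := B.1 * A.1) K (fun j hj => by simp [h1 j hj]),
        slOp_eq_sum K (fun j hj => by simp [h1 j hj, h2 j hj])]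
      simp [sub_mul, Finset.sum_sub_distrib]
    simp only [LieSubalgebra.coe_bracket, LieRing.of_associative_ring_bracket]
    rw [hs, slOp_mul K h1 h2, slOp_mul K h2 h1]
    have hc : ∑ j ∈ K, ∑ k ∈ K, linX (B.1 (Finsupp.single j 1)) *
        linX (A.1 (Finsupp.single k 1)) * (derX j * derX k) =
        ∑ j ∈ K, ∑ k ∈ K, linX (A.1 (Finsupp.single j 1)) *
        linX (B.1 (Finsupp.single k 1)) * (derX j * derX k) := by
      rw [Finset.sum_comm]
      refine Finset.sum_congr rfl fun j _ => Finset.sum_congr rfl fun k _ => ?_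
      rw [derX_comm k j, linX_comm]
    rw [hc]
    abel

instance slMonoRing (J : Type) : LieRingModule (sl J) (Mono J) :=
  LieRingModule.compLieHom (Mono J) (slRep J)

instance slMonoModule (J : Type) : LieModule ℂ (sl J) (Mono J) :=
  LieModule.compLieHom (Mono J) (slRep J)

theorem sl_lie {J : Type} (A : sl J) (m : Mono J) : ⁅A, m⁆ = slOp A.1 m := rfl

/-- The indices whose entry is a nonnegative integer. -/
def IntPlus {ι : Type} (mu : ι → ℂ) : Set ι := {i | ∃ n : ℕ, mu i = n}

/-- The root lattice of `sl J`: integral finitely supported sequences with zero sum. -/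
def rootLatticeSl (J : Type) : Set (J → ℂ) :=
  {lam | ∃ f : J →₀ ℤ, (∀ i, lam i = f i) ∧ (f.sum fun _ a => a) = 0}

/-- The root lattice of `sp ι`: integral finitely supported sequences with even sum. -/
def rootLatticeSp (ι : Type) : Set (ι → ℂ) :=
  {lam | ∃ f : ι →₀ ℤ, (∀ i, lam i = f i) ∧ Even (f.sum fun _ a => a)}

theorem intPlus_add {ι : Type} (lam : ι → ℂ) (i : ι) : IntPlus lam ⊆ IntPlus (lam + eps i) := by
  classical
  rintro j ⟨n, hn⟩
  by_cases h : j = i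
  · subst h; exact ⟨n + 1, by simp [eps, hn]⟩
  · exact ⟨n, by simp [eps, hn, Pi.single_apply, h]⟩

theorem intPlus_sub {ι : Type} (lam : ι → ℂ) (i : ι) (h0 : lam i ≠ 0) :
    IntPlus lam ⊆ IntPlus (lam - eps i) := by
  classical
  rintro j ⟨n, hn⟩
  by_cases h : j = i
  · subst h
    obtain ⟨m, rfl⟩ : ∃ m, n = m + 1 :=
      Nat.exists_eq_succ_of_ne_zero (by rintro rfl; exact h0 (by simpa using hn))
    exact ⟨m, by simp [eps, hn]⟩
  · exact ⟨n, by simp [eps, hn, Pi.single_apply, h]⟩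

/-- The span of all `x ^ lam` with `lam` in a set. -/
def monoSpan {ι : Type} (S : Set (ι → ℂ)) : Submodule ℂ (Mono ι) :=
  Submodule.span ℂ (mono '' S)

theorem monoSpan_map {ι : Type} {S T : Set (ι → ℂ)} (f : Module.End ℂ (Mono ι))
    (h : ∀ lam ∈ S, f (mono lam) ∈ monoSpan T) {m : Mono ι} (hm : m ∈ monoSpan S) :
    f m ∈ monoSpan T := by
  have : monoSpan S ≤ (monoSpan T).comap f := by
    rw [monoSpan, Submodule.span_le]
    rintro _ ⟨lam, hl, rfl⟩
    exact h lam hl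
  exact this hm

/-- The exponents of the monomials in `V_sl(μ)`. -/
def slExp {J : Type} (mu : J → ℂ) : Set (J → ℂ) :=
  {lam | lam - mu ∈ rootLatticeSl J ∧ IntPlus mu ⊆ IntPlus lam}

theorem slOp_mem {J : Type} (mu : J → ℂ) {A : Module.End ℂ (J →₀ ℂ)} (hA : IsFinitary A)
    {m : Mono J} (hm : m ∈ monoSpan (slExp mu)) : slOp A m ∈ monoSpan (slExp mu) := by
  classical
  obtain ⟨K, hK⟩ := hA.exists_finset
  rw [slOp_eq_sum K hK, LinearMap.sum_apply]
  refine Submodule.sum_mem _ fun j _ => ?_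
  induction A (Finsupp.single j 1) using Finsupp.induction_linear with
  | zero => simp
  | add f g hf hg => simpa [add_mul] using Submodule.add_mem _ hf hg
  | single i c =>
    have : linX (Finsupp.single i c) * derX j = c • (mulX i * derX j) := by simp [linX]
    rw [this, LinearMap.smul_apply]
    refine Submodule.smul_mem _ _ (monoSpan_map _ (fun lam hl => ?_) hm)
    simp only [Module.End.mul_apply, derX_mono, map_smul, mulX_mono]
    by_cases h0 : lam j = 0
    · simp [h0]
    refine Submodule.smul_mem _ _ (Submodule.subset_span ⟨_, ?_, rfl⟩)
    obtain ⟨⟨f, hf, hs⟩, hp⟩ := hl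
    refine ⟨⟨f - Finsupp.single j 1 + Finsupp.single i 1, fun k => ?_, ?_⟩,
      hp.trans ((intPlus_sub lam j h0).trans (intPlus_add _ i))⟩
    · have := hf k
      simp only [Pi.sub_apply, Pi.add_apply, Finsupp.add_apply, Finsupp.sub_apply,
        Finsupp.single_apply, eps, Pi.single_apply, Int.cast_add, Int.cast_sub] at this ⊢
      rw [← this]
      simp only [eq_comm (a := k)]
      split_ifs <;> simp <;> ring
    · rw [Finsupp.sum_add_index' (by simp) (by simp), Finsupp.sum_sub_index (by simp), hs]
      simp

/-- `V_sl(μ)`, as a submodule of the space of all monomials. -/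
def Vsl {J : Type} (mu : J → ℂ) : LieSubmodule ℂ (sl J) (Mono J) where
  __ := monoSpan (slExp mu)
  lie_mem {A _} hm := slOp_mem mu A.2.1 hm

/-- `V_sl(μ)⁺`: the sum of all proper submodules of `V_sl(μ)` of the form `V_sl(μ')`. -/
def VslPlus {J : Type} (mu : J → ℂ) : LieSubmodule ℂ (sl J) (Mono J) :=
  ⨆ (mu' : J → ℂ) (_ : Vsl mu' < Vsl mu), Vsl mu'

/-- `X_sl(μ) = V_sl(μ) / V_sl(μ)⁺`. -/
abbrev Xsl {J : Type} (mu : J → ℂ) := Vsl mu ⧸ (VslPlus mu).comap (Vsl mu).incl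

/-! ### The `sp`-modules `X_sp(μ)` -/

/-- The linear map from the natural module to the Weyl algebra with `e_i ↦ x_i` and
`e_{-i} ↦ ∂_i`. -/
def weyl {ι : Type} : SpV ι →ₗ[ℂ] Module.End ℂ (Mono ι) :=
  Finsupp.linearCombination ℂ (Sum.elim mulX derX)

/-- The basis dual to `bv`: we have `-Ω(dualBv s, v) = v_s`. -/
def dualBv {ι : Type} (s : ι ⊕ ι) : SpV ι := sgn s • bv s.swap

/-- The differential operator attached to an element of `sp ι`. For every `i`, `j` one gets
`E_{i,j} - E_{-j,-i} ↦ (x_i ∂_j + ∂_j x_i) / 2`, while the root vectors of `2 ε_i`, `ε_i + ε_j`,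
`-2 ε_i`, `-ε_i - ε_j` are mapped to nonzero multiples of `x_i ^ 2`, `x_i x_j`, `∂_i ^ 2`,
`∂_i ∂_j`. -/
def spOp {ι : Type} (A : Module.End ℂ (SpV ι)) : Module.End ℂ (Mono ι) :=
  (1 / 2 : ℂ) • ∑ᶠ s, weyl (A (bv s)) * weyl (dualBv s)

theorem spOp_eq_sum {ι : Type} {A : Module.End ℂ (SpV ι)} (K : Finset (ι ⊕ ι))
    (h : ∀ j, j ∉ K → A (bv j) = 0) :
    spOp A = (1 / 2 : ℂ) • ∑ s ∈ K, weyl (A (bv s)) * weyl (dualBv s) := by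
  unfold spOp
  congr 1
  apply finsum_eq_sum_of_support_subset
  intro j hj
  by_contra hK
  exact hj (by simp [h j (by simpa using hK)])

theorem weyl_comm {ι : Type} (u v : SpV ι) :
    weyl u * weyl v = weyl v * weyl u - omega ι u v • 1 := by
  classical
  induction u using Finsupp.induction_linear with
  | zero => simp
  | add f g hf hg =>
    simp only [map_add, add_mul, mul_add, hf, hg, LinearMap.add_apply, add_smul]; abel
  | single i c =>
    induction v using Finsupp.induction_linear with
    | zero => simp
    | add f g hf hg =>
      simp only [map_add, add_mul, mul_add, hf, hg, add_smul]; abel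
    | single j d =>
      have key : Sum.elim mulX derX i * Sum.elim mulX derX j =
          Sum.elim mulX derX j * Sum.elim mulX derX i -
            (sgn i * bv j i.swap) • (1 : Module.End ℂ (Mono ι)) := by
        rcases i with i | i <;> rcases j with j | j
        · simp [mulX_comm i j]
        · by_cases h : i = j
          · subst h; simp [derX_mulX_self, sgn]
          · simp [derX_mulX_ne (Ne.symm h), sgn, Finsupp.single_apply, Ne.symm h]
        · by_cases h : i = j
          · subst h; simp [derX_mulX_self, sgn]
          · simp [derX_mulX_ne h, sgn, Finsupp.single_apply, Ne.symm h]
        · simp [derX_comm i j]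
      have h1 : (weyl (Finsupp.single i c) : Module.End ℂ (Mono ι)) =
          c • Sum.elim mulX derX i := by simp [weyl]
      have h2 : (weyl (Finsupp.single j d) : Module.End ℂ (Mono ι)) =
          d • Sum.elim mulX derX j := by simp [weyl]
      have h3 : omega ι (Finsupp.single i c) (Finsupp.single j d) =
          c * d * (sgn i * bv j i.swap) := by
        simp only [omega, Finsupp.linearCombination_single, LinearMap.smul_apply,
          Finsupp.lapply_apply, Finsupp.single_apply, smul_eq_mul]
        split_ifs <;> ring
      rw [h1, h2, h3]
      simp only [smul_mul_assoc, mul_smul_comm, key, smul_sub, smul_smul]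
      rw [mul_left_comm d c, ← mul_assoc c d, mul_comm d c]

theorem skew_sum {ι : Type} {A : Module.End ℂ (SpV ι)} (K : Finset (ι ⊕ ι))
    (h : ∀ j, j ∉ K → A (bv j) = 0) (hs : ∀ u v, omega ι (A u) v + omega ι u (A v) = 0)
    (v : SpV ι) : ∑ s ∈ K, omega ι (A (bv s)) v • dualBv s = -A v := by
  classical
  have e : ∀ s, omega ι (A (bv s)) v • dualBv s = -((A v) s.swap • bv s.swap) := fun s => by
    have h1 := hs (bv s) v
    rw [omega_bv_left] at h1
    rw [eq_neg_of_add_eq_zero_left h1, dualBv, smul_smul, ← neg_smul]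
    congr 1
    linear_combination (-(A v) s.swap) * sgn_mul_self s
  have z : ∀ s, s ∉ K → (A v) s.swap = 0 := fun s hsK => by
    have h1 := hs (bv s) v
    rw [omega_bv_left, h s hsK] at h1
    have h2 : sgn s * (sgn s * (A v) s.swap) = 0 := by simpa using h1
    rwa [← mul_assoc, sgn_mul_self, one_mul] at h2
  rw [Finset.sum_congr rfl fun s _ => e s, Finset.sum_neg_distrib]
  congr 1
  ext t
  rw [Finsupp.finsetSum_apply]
  simp only [Finsupp.smul_apply, Finsupp.single_apply, smul_eq_mul, mul_ite, mul_one, mul_zero]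
  by_cases ht : t.swap ∈ K
  · rw [Finset.sum_eq_single t.swap]
    · simp
    · intro s _ hst
      rw [if_neg]
      rintro rfl
      exact hst (by simp)
    · intro h'; exact absurd ht h'
  · have := z _ ht
    rw [Sum.swap_swap] at this
    rw [this]
    refine Finset.sum_eq_zero fun s hsK => if_neg ?_
    rintro rfl
    exact ht (by simpa using hsK)

theorem dualBv_expand {ι : Type} (s : ι ⊕ ι) (v : SpV ι) : omega ι (dualBv s) v = -v s := by
  rw [dualBv, map_smul, LinearMap.smul_apply, omega_bv_left]
  simp only [sgn_swap, Sum.swap_swap, smul_eq_mul]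
  linear_combination (-v s) * sgn_mul_self s

/-- Commuting with `spOp A` is the action of `A` on the natural module. -/
theorem spOp_comm {ι : Type} {A : Module.End ℂ (SpV ι)} (hA : A ∈ sp ι) (v : SpV ι) :
    spOp A * weyl v = weyl v * spOp A + weyl (A v) := by
  obtain ⟨hf, hs⟩ := hA
  obtain ⟨K, h⟩ := hf.exists_finset
  have h1 : ∑ s ∈ K, v s • weyl (A (bv s)) = weyl (A v) := by
    rw [apply_eq_sum A K h v, map_sum]; simp
  have h2 : ∑ s ∈ K, omega ι (A (bv s)) v • weyl (dualBv s) = -weyl (A v) := by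
    rw [← map_neg, ← skew_sum K h hs v, map_sum]; simp
  have key : ∀ s, weyl (A (bv s)) * weyl (dualBv s) * weyl v =
      weyl v * (weyl (A (bv s)) * weyl (dualBv s)) + v s • weyl (A (bv s))
        - omega ι (A (bv s)) v • weyl (dualBv s) := fun s => by
    rw [mul_assoc, weyl_comm (dualBv s) v, dualBv_expand, mul_sub, ← mul_assoc,
      weyl_comm (A (bv s)) v]
    simp only [sub_mul, mul_assoc, neg_smul, mul_neg, mul_smul_comm, smul_mul_assoc, one_mul,
      mul_one]
    abel
  rw [spOp_eq_sum K h, smul_mul_assoc, Finset.sum_mul, Finset.sum_congr rfl fun s _ => key s,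
    Finset.sum_sub_distrib, Finset.sum_add_distrib, h1, h2, ← Finset.mul_sum, mul_smul_comm,
    sub_neg_eq_add, add_assoc, smul_add, ← two_smul ℂ (weyl (A v)), smul_smul]
  norm_num

theorem spOp_lie {ι : Type} {A B : Module.End ℂ (SpV ι)} (hA : A ∈ sp ι) (hB : B ∈ sp ι) :
    spOp (A * B - B * A) = spOp A * spOp B - spOp B * spOp A := by
  obtain ⟨K, h1, h2⟩ := exists_finset₂ hA.1 hB.1
  have hAd : ∀ t, A (dualBv t) = -∑ s ∈ K, (A (bv s)) t • dualBv s := fun t => by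
    rw [← neg_neg (A (dualBv t)), ← skew_sum K h1 hA.2 (dualBv t)]
    congr 1
    refine Finset.sum_congr rfl fun s _ => ?_
    rw [omega_swap, dualBv_expand, neg_neg]
  have hsw : ∑ s ∈ K, weyl (B (bv s)) * weyl (A (dualBv s)) =
      -∑ s ∈ K, weyl (B (A (bv s))) * weyl (dualBv s) := by
    have e : ∀ s, weyl (B (A (bv s))) * weyl (dualBv s) =
        ∑ t ∈ K, (A (bv s)) t • (weyl (B (bv t)) * weyl (dualBv s)) := fun s => by
      rw [apply_eq_sum B K h2 (A (bv s)), map_sum, Finset.sum_mul]; simp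
    rw [Finset.sum_congr rfl fun s _ => e s, Finset.sum_comm, ← Finset.sum_neg_distrib]
    refine Finset.sum_congr rfl fun t _ => ?_
    rw [hAd, map_neg, mul_neg, map_sum, Finset.mul_sum]
    simp
  have key : ∀ s, spOp A * (weyl (B (bv s)) * weyl (dualBv s)) =
      weyl (B (bv s)) * weyl (dualBv s) * spOp A + (weyl (A (B (bv s))) * weyl (dualBv s)
        + weyl (B (bv s)) * weyl (A (dualBv s))) := fun s => by
    rw [← mul_assoc, spOp_comm hA, add_mul, mul_assoc, spOp_comm hA, mul_add, mul_assoc]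
    abel
  rw [spOp_eq_sum (A := B) K h2, mul_smul_comm, smul_mul_assoc, ← smul_sub, Finset.mul_sum,
    Finset.sum_congr rfl fun s _ => key s, Finset.sum_add_distrib, Finset.sum_mul,
    add_sub_cancel_left, Finset.sum_add_distrib, hsw,
    spOp_eq_sum (A := A * B - B * A) K (fun j hj => by simp [h1 j hj, h2 j hj])]
  simp [add_mul, Finset.sum_add_distrib, sub_eq_add_neg]

/-- The action of `sp ι` on monomials. -/
def spRep (ι : Type) : sp ι →ₗ⁅ℂ⁆ Module.End ℂ (Mono ι) where
  toFun A := spOp A.1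
  map_add' A B := by
    obtain ⟨K, h1, h2⟩ := exists_finset₂ A.2.1 B.2.1
    rw [spOp_eq_sum K h1, spOp_eq_sum K h2,
      spOp_eq_sum K (fun j hj => by simp [h1 j hj, h2 j hj])]
    simp [add_mul, Finset.sum_add_distrib]
  map_smul' c A := by
    obtain ⟨K, h1⟩ := A.2.1.exists_finset
    rw [spOp_eq_sum K h1, spOp_eq_sum K (fun j hj => by simp [h1 j hj])]
    simp [Finset.smul_sum, smul_smul, mul_comm]
  map_lie' {A B} := by
    simp only [LieSubalgebra.coe_bracket, LieRing.of_associative_ring_bracket]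
    exact spOp_lie A.2 B.2

instance spMonoRing (ι : Type) : LieRingModule (sp ι) (Mono ι) :=
  LieRingModule.compLieHom (Mono ι) (spRep ι)

instance spMonoModule (ι : Type) : LieModule ℂ (sp ι) (Mono ι) :=
  LieModule.compLieHom (Mono ι) (spRep ι)

theorem sp_lie {ι : Type} (A : sp ι) (m : Mono ι) : ⁅A, m⁆ = spOp A.1 m := rfl

/-- The exponents of the monomials in `V_sp(μ)`. -/
def spExp {ι : Type} (mu : ι → ℂ) : Set (ι → ℂ) :=
  {lam | lam - mu ∈ rootLatticeSp ι ∧ IntPlus mu ⊆ IntPlus lam}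

/-- The analogue of `spExp` where the sum of the exponents has the parity of `b`. -/
def spExpPar {ι : Type} (mu : ι → ℂ) (b : ℤ) : Set (ι → ℂ) :=
  {lam | (∃ f : ι →₀ ℤ, (∀ i, (lam - mu) i = (f i : ℂ)) ∧ Even ((f.sum fun _ a => a) + b)) ∧
    IntPlus mu ⊆ IntPlus lam}

theorem weyl_bv_mem {ι : Type} (mu : ι → ℂ) (b : ℤ) (s : ι ⊕ ι) {m : Mono ι}
    (hm : m ∈ monoSpan (spExpPar mu b)) :
    weyl (bv s) m ∈ monoSpan (spExpPar mu (b + 1)) := by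
  classical
  refine monoSpan_map _ (fun lam hl => ?_) hm
  obtain ⟨⟨f, hf, he⟩, hp⟩ := hl
  rcases s with i | i
  · have : weyl (bv (Sum.inl i)) (mono lam) = mono (lam + eps i) := by simp [weyl]
    rw [this]
    refine Submodule.subset_span ⟨_, ⟨⟨f + Finsupp.single i 1, fun k => ?_, ?_⟩,
      hp.trans (intPlus_add _ i)⟩, rfl⟩
    · have := hf k
      simp only [Pi.sub_apply, Pi.add_apply, Finsupp.add_apply,
        Finsupp.single_apply, eps, Pi.single_apply, Int.cast_add] at this ⊢
      rw [← this]
      simp only [eq_comm (a := k)]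
      split_ifs <;> simp <;> ring
    · rw [Finsupp.sum_add_index' (by simp) (by simp), Finsupp.sum_single_index rfl]
      have e : (f.sum fun _ a => a) + 1 + (b + 1) = (f.sum fun _ a => a) + b + 2 := by ring
      rw [e]
      exact he.add (by decide)
  · have : weyl (bv (Sum.inr i)) (mono lam) = lam i • mono (lam - eps i) := by simp [weyl]
    rw [this]
    by_cases h0 : lam i = 0
    · simp [h0]
    refine Submodule.smul_mem _ _ (Submodule.subset_span ⟨_,
      ⟨⟨f - Finsupp.single i 1, fun k => ?_, ?_⟩, hp.trans (intPlus_sub _ i h0)⟩, rfl⟩)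
    · have := hf k
      simp only [Pi.sub_apply, Finsupp.sub_apply,
        Finsupp.single_apply, eps, Pi.single_apply, Int.cast_sub] at this ⊢
      rw [← this]
      simp only [eq_comm (a := k)]
      split_ifs <;> simp <;> ring
    · rw [Finsupp.sum_sub_index (by simp), Finsupp.sum_single_index rfl]
      have e : (f.sum fun _ a => a) - 1 + (b + 1) = (f.sum fun _ a => a) + b := by ring
      rw [e]
      exact he

theorem weyl_mem {ι : Type} (mu : ι → ℂ) (b : ℤ) (v : SpV ι) {m : Mono ι}
    (hm : m ∈ monoSpan (spExpPar mu b)) :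
    weyl v m ∈ monoSpan (spExpPar mu (b + 1)) := by
  induction v using Finsupp.induction_linear with
  | zero => simp
  | add f g hf hg => simpa using Submodule.add_mem _ hf hg
  | single s c =>
    have : (Finsupp.single s c : SpV ι) = c • bv s := by simp
    rw [this, map_smul, LinearMap.smul_apply]
    exact Submodule.smul_mem _ _ (weyl_bv_mem mu b s hm)

theorem spOp_mem {ι : Type} (mu : ι → ℂ) {A : Module.End ℂ (SpV ι)} (hA : IsFinitary A)
    {m : Mono ι} (hm : m ∈ monoSpan (spExp mu)) : spOp A m ∈ monoSpan (spExp mu) := by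
  obtain ⟨K, hK⟩ := hA.exists_finset
  rw [spOp_eq_sum K hK, LinearMap.smul_apply, LinearMap.sum_apply]
  refine Submodule.smul_mem _ _ (Submodule.sum_mem _ fun s _ => ?_)
  have h2 : (Even (0 + 1 + 1 : ℤ)) := by decide
  have e : ∀ b : ℤ, Even b → spExp mu = (spExpPar mu b) := fun b hb => by
    ext lam
    simp only [spExp, spExpPar, rootLatticeSp, Set.mem_ofPred_eq, Int.even_add, hb, iff_true]
  rw [e 0 (by decide)] at hm
  rw [e _ h2]
  exact weyl_mem mu _ _ (weyl_mem mu _ _ hm)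

/-- `V_sp(μ)`, as a submodule of the space of all monomials. -/
def Vsp {ι : Type} (mu : ι → ℂ) : LieSubmodule ℂ (sp ι) (Mono ι) where
  __ := monoSpan (spExp mu)
  lie_mem {A _} hm := spOp_mem mu A.2.1 hm

/-- `V_sp(μ)⁺`: the sum of all proper submodules of `V_sp(μ)` of the form `V_sp(μ')`. -/
def VspPlus {ι : Type} (mu : ι → ℂ) : LieSubmodule ℂ (sp ι) (Mono ι) :=
  ⨆ (mu' : ι → ℂ) (_ : Vsp mu' < Vsp mu), Vsp mu'

/-- `X_sp(μ) = V_sp(μ) / V_sp(μ)⁺`. -/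
abbrev Xsp {ι : Type} (mu : ι → ℂ) := Vsp mu ⧸ (VspPlus mu).comap (Vsp mu).incl

/-- The relation `λ ∼_sp μ`. -/
def SimSp {ι : Type} (lam mu : ι → ℂ) : Prop :=
  lam - mu ∈ rootLatticeSp ι ∧ IntPlus mu = IntPlus lam

/-! ### Partial orders on `ℤ` and parabolic subalgebras of `sp(∞)` -/

/-- The set `[i]` formed by `i` and all elements which are not comparable with `i`. -/
def cls (r : ℤ → ℤ → Prop) (i : ℤ) : Set ℤ := {i} ∪ {j | ¬ r i j ∧ ¬ r j i}

/-- Admissible `ℤ₂`-linear (strict) partial orders on `ℤ`. -/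
structure IsAdmissibleZ2 (r : ℤ → ℤ → Prop) : Prop where
  irrefl : ∀ i, ¬ r i i
  trans : ∀ i j k, r i j → r j k → r i k
  neg : ∀ i j, r i j → r (-j) (-i)
  admissible : ∀ i j, cls r i ≠ cls r j → Disjoint (cls r i) (cls r j)

/-- Indices of the basis vectors of the natural module of `sp(∞)`. -/
abbrev Idx := ℕ+ ⊕ ℕ+

/-- The nonzero integer corresponding to an index of a basis vector. -/
def toZ : Idx → ℤ := Sum.elim (fun i => (i : ℤ)) (fun i => -(i : ℤ))

/-- The Lie algebra `sp(∞)`. -/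
abbrev spInf := sp ℕ+

/-- The splitting Cartan subalgebra: diagonal matrices in `sp(∞)`. -/
def cartan : Submodule ℂ spInf where
  carrier := {A | ∀ s, ∃ c : ℂ, A.1 (bv s) = c • bv s}
  zero_mem' := fun s => ⟨0, by simp⟩
  add_mem' := by
    intro A B hA hB s
    obtain ⟨c, hc⟩ := hA s
    obtain ⟨d, hd⟩ := hB s
    exact ⟨c + d, by
      rw [add_smul, ← hc, ← hd]
      rfl⟩
  smul_mem' := by
    intro a A hA s
    obtain ⟨c, hc⟩ := hA s
    exact ⟨a * c, by
      rw [mul_smul, ← hc]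
      rfl⟩

/-- The functional `ε_s` on the Cartan subalgebra (the diagonal entry at `s`); in particular
`ε_{-i} = -ε_i`. -/
def epsH (s : Idx) (H : spInf) : ℂ := H.1 (bv s) s

/-- The root space of the root `ε_s - ε_t`. All roots of `sp(∞)` are of this form with
`s ≠ t`: for instance `2 ε_i = ε_i - ε_{-i}` and `ε_i + ε_j = ε_i - ε_{-j}`. -/
def rootSpace (s t : Idx) : Submodule ℂ spInf where
  carrier := {A | ∀ H ∈ cartan, ⁅H, A⁆ = (epsH s H - epsH t H) • A}
  zero_mem' := by intro H _; simp
  add_mem' := by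
    intro A B hA hB H hH
    rw [lie_add, hA H hH, hB H hH, smul_add]
  smul_mem' := by
    intro c A hA H hH
    rw [lie_smul, hA H hH, smul_comm]

/-- The parabolic subalgebra `p(≺)`, generated by the Cartan subalgebra and the root spaces of
all roots which are positive or not comparable with `0`. -/
def parabolic (r : ℤ → ℤ → Prop) : LieSubalgebra ℂ spInf :=
  LieSubalgebra.lieSpan ℂ spInf ((cartan : Set spInf) ∪
    {A | ∃ s t : Idx, s ≠ t ∧ (r (toZ s) (toZ t) ∨ ¬ r (toZ s) (toZ t) ∧ ¬ r (toZ t) (toZ s)) ∧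
      A ∈ rootSpace s t})

/-- The reductive component of `p(≺)`: the sum of the Cartan subalgebra and of the root spaces
of all roots which are not comparable with `0`. -/
def leviPart (r : ℤ → ℤ → Prop) : Submodule ℂ spInf :=
  cartan ⊔ ⨆ (s : Idx) (t : Idx)
    (_ : s ≠ t ∧ ¬ r (toZ s) (toZ t) ∧ ¬ r (toZ t) (toZ s)), rootSpace s t

/-- The locally nilpotent radical `u(≺)` of `p(≺)`: the sum of the root spaces of all positive
roots. -/
def nilPart (r : ℤ → ℤ → Prop) : Submodule ℂ spInf :=
  ⨆ (s : Idx) (t : Idx) (_ : r (toZ s) (toZ t)), rootSpace s t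

/-! ### Aligned modules -/

/-- `M` is the sum of its weight spaces with respect to `H`. -/
def IsWeightModule (L M : Type) [LieRing L] [LieAlgebra ℂ L] [AddCommGroup M] [Module ℂ M]
    [LieRingModule L M] [LieModule ℂ L M] (H : Submodule ℂ L) : Prop :=
  Submodule.span ℂ {m : M | ∃ chi : H →ₗ[ℂ] ℂ, ∀ h : H, ⁅(h : L), m⁆ = chi h • m} = ⊤

section Verma

variable {L : Type} [LieRing L] [LieAlgebra ℂ L] (P : LieSubalgebra ℂ L)
  (S : Type) [AddCommGroup S] [Module ℂ S] [LieRingModule P S] [LieModule ℂ P S]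

/-- The map `U(p) → U(g)` induced by the inclusion. -/
def envIncl : UniversalEnvelopingAlgebra ℂ P →ₐ[ℂ] UniversalEnvelopingAlgebra ℂ L :=
  UniversalEnvelopingAlgebra.lift ℂ ((UniversalEnvelopingAlgebra.ι ℂ).comp P.incl)

/-- The action of `U(p)` on a `p`-module. -/
def envAct : UniversalEnvelopingAlgebra ℂ P →ₐ[ℂ] Module.End ℂ S :=
  UniversalEnvelopingAlgebra.lift ℂ (LieModule.toEnd ℂ P S)

/-- The relations `u a ⊗ s = u ⊗ a s`, for `a` in `U(p)`. -/
def vermaRel : Submodule (UniversalEnvelopingAlgebra ℂ L)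
    (UniversalEnvelopingAlgebra ℂ L ⊗[ℂ] S) :=
  Submodule.span _ {z | ∃ (u : UniversalEnvelopingAlgebra ℂ L)
    (a : UniversalEnvelopingAlgebra ℂ P) (s : S),
      z = (u * envIncl P a) ⊗ₜ[ℂ] s - u ⊗ₜ[ℂ] (envAct P S a s)}

/-- The induced module `M_p(S) = U(g) ⊗_{U(p)} S`. -/
abbrev GenVerma := (UniversalEnvelopingAlgebra ℂ L ⊗[ℂ] S) ⧸ vermaRel P S

instance genVermaRing : LieRingModule L (GenVerma P S) where
  bracket x m := UniversalEnvelopingAlgebra.ι ℂ x • m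
  add_lie x y m := by
    change UniversalEnvelopingAlgebra.ι ℂ (x + y) • m = _
    rw [map_add, add_smul]
  lie_add x m n := smul_add _ _ _
  leibniz_lie x y m := by
    change UniversalEnvelopingAlgebra.ι ℂ x • UniversalEnvelopingAlgebra.ι ℂ y • m =
      UniversalEnvelopingAlgebra.ι ℂ ⁅x, y⁆ • m +
        UniversalEnvelopingAlgebra.ι ℂ y • UniversalEnvelopingAlgebra.ι ℂ x • m
    rw [LieHom.map_lie, LieRing.of_associative_ring_bracket, sub_smul, mul_smul, mul_smul,
      sub_add_cancel]

instance genVermaModule : LieModule ℂ L (GenVerma P S) where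
  smul_lie c x m := by
    change UniversalEnvelopingAlgebra.ι ℂ (c • x) • m = c • UniversalEnvelopingAlgebra.ι ℂ x • m
    rw [map_smul, smul_assoc]
  lie_smul c x m := by
    change UniversalEnvelopingAlgebra.ι ℂ x • c • m = c • UniversalEnvelopingAlgebra.ι ℂ x • m
    rw [smul_comm]

end Verma

/-- `M` is `p(≺)`-aligned: it is a simple weight module which is a quotient of `M_p(S)`, for some
simple weight module `S` over the reductive component, on which `u(≺)` acts by zero. -/
def IsAligned (r : ℤ → ℤ → Prop) (M : Type) [AddCommGroup M] [Module ℂ M]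
    [LieRingModule spInf M] [LieModule ℂ spInf M] : Prop :=
  LieModule.IsIrreducible ℂ spInf M ∧ IsWeightModule spInf M cartan ∧
  ∃ (S : Type) (_ : AddCommGroup S) (_ : Module ℂ S) (_ : LieRingModule (parabolic r) S)
    (_ : LieModule ℂ (parabolic r) S),
    (∀ y : parabolic r, (y : spInf) ∈ nilPart r → ∀ m : S, ⁅y, m⁆ = 0) ∧
    IsWeightModule (parabolic r) S (cartan.comap (parabolic r).toSubmodule.subtype) ∧
    (Nontrivial S ∧ ∀ N : Submodule ℂ S,
      (∀ y : parabolic r, (y : spInf) ∈ leviPart r → ∀ m ∈ N, ⁅y, m⁆ ∈ N) → N = ⊥ ∨ N = ⊤) ∧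
    ∃ f : GenVerma (parabolic r) S →ₗ⁅ℂ, spInf⁆ M, Function.Surjective f

/-- The fixed points `M ^ u(≺)`. -/
def fixedPts (r : ℤ → ℤ → Prop) (M : Type) [AddCommGroup M] [Module ℂ M]
    [LieRingModule spInf M] [LieModule ℂ spInf M] : Submodule ℂ M where
  carrier := {m | ∀ y ∈ nilPart r, ⁅y, m⁆ = 0}
  zero_mem' := by intro y _; simp
  add_mem' := by
    intro a b ha hb y hy
    rw [lie_add, ha y hy, hb y hy, add_zero]
  smul_mem' := by
    intro c a ha y hy
    rw [lie_smul, ha y hy, smul_zero]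

/-! ### The components of the semisimple part of the reductive component -/

/-- `[0] ∩ ℤ_{>0}`. -/
def zeroSet (r : ℤ → ℤ → Prop) : Set ℕ+ := {i | (i : ℤ) ∈ cls r 0}

/-- The class `[p]`, as a set of indices of basis vectors. -/
def clsIdx (r : ℤ → ℤ → Prop) (p : ℤ) : Set Idx := {s | toZ s ∈ cls r p}

section Embeddings

variable {ι : Type}

theorem map_val_injective (Z : Set ι) :
    Function.Injective (Sum.map (Subtype.val : Z → ι) (Subtype.val : Z → ι)) :=
  Subtype.val_injective.sumMap Subtype.val_injective

/-- Extension by zero `V_Z → V`. -/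
def extV (Z : Set ι) : SpV Z →ₗ[ℂ] SpV ι :=
  Finsupp.lmapDomain ℂ ℂ (Sum.map Subtype.val Subtype.val)

/-- The restriction `V → V_Z` of coordinates. -/
def resV (Z : Set ι) : SpV ι →ₗ[ℂ] SpV Z :=
  Finsupp.lcomapDomain (Sum.map Subtype.val Subtype.val) (map_val_injective Z)

theorem resV_extV (Z : Set ι) (v : SpV Z) : resV Z (extV Z v) = v :=
  Finsupp.leftInverse_lcomapDomain_mapDomain _ (map_val_injective Z) v

theorem resV_apply (Z : Set ι) (v : SpV ι) (s : Z ⊕ Z) :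
    resV Z v s = v (Sum.map Subtype.val Subtype.val s) := rfl

theorem omega_extV (Z : Set ι) (u : SpV Z) (v : SpV ι) :
    omega ι (extV Z u) v = omega Z u (resV Z v) := by
  induction u using Finsupp.induction_linear with
  | zero => simp
  | add f g hf hg => simp [hf, hg]
  | single s c =>
    simp only [extV, Finsupp.lmapDomain_apply, Finsupp.mapDomain_single, omega,
      Finsupp.linearCombination_single, LinearMap.smul_apply, Finsupp.lapply_apply, resV_apply]
    rcases s with s | s <;> simp [sgn]

/-- The embedding of `sp Z` into `sp ι`, for a subset `Z` of `ι`: endomorphisms of `V_Z` act by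
zero on the basis vectors `e_i`, `e_{-i}` with `i` not in `Z`. -/
def spIncl (Z : Set ι) : sp Z →ₗ⁅ℂ⁆ sp ι where
  toFun A := ⟨extV Z ∘ₗ A.1 ∘ₗ resV Z, by
    refine ⟨?_, fun u v => ?_⟩
    · classical
      obtain ⟨K, hK⟩ := A.2.1.exists_finset
      refine isFinitary_of_finset (K.image (Sum.map Subtype.val Subtype.val)) fun j hj => ?_
      have : A.1 (resV Z (bv j)) = 0 := by
        rw [apply_eq_sum A.1 K hK]
        refine Finset.sum_eq_zero fun s hs => ?_
        rw [resV_apply, Finsupp.single_eq_of_ne, zero_smul]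
        rintro rfl
        exact hj (Finset.mem_image_of_mem _ hs)
      simp [this]
    · have h := A.2.2 (resV Z u) (resV Z v)
      simp only [LinearMap.comp_apply]
      rw [omega_swap u, omega_extV, omega_extV, ← omega_swap]
      exact h⟩
  map_add' A B := by
    ext : 1
    simp [LinearMap.comp_add, LinearMap.add_comp]
  map_smul' c A := by
    ext : 1
    simp [LinearMap.comp_smul, LinearMap.smul_comp]
  map_lie' {A B} := by
    refine Subtype.ext (LinearMap.ext fun v => ?_)
    simp [LieRing.of_associative_ring_bracket, resV_extV]

/-- The element `u ↦ -(Ω(v, u) w + Ω(w, u) v)` of `sp ι`. -/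
def symOp (v w : SpV ι) : sp ι :=
  ⟨-((omega ι v).smulRight w + (omega ι w).smulRight v), by
    classical
    refine ⟨isFinitary_of_finset (v.support.image Sum.swap ∪ w.support.image Sum.swap)
      fun j hj => ?_, fun a b => ?_⟩
    · have key : ∀ x : SpV ι, j ∉ x.support.image Sum.swap → omega ι x (bv j) = 0 := fun x hx => by
        rw [omega_swap, omega_bv_left]
        have : x j.swap = 0 := by
          by_contra h
          exact hx (Finset.mem_image.2 ⟨j.swap, by simpa using h, by simp⟩)
        simp [this]
      rw [Finset.mem_union, not_or] at hj
      simp [key v hj.1, key w hj.2]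
    · simp only [LinearMap.neg_apply, LinearMap.add_apply, LinearMap.smulRight_apply, map_neg,
        map_add, map_smul, LinearMap.smul_apply, smul_eq_mul]
      rw [omega_swap a w, omega_swap a v]
      ring⟩

/-- The embedding `sl J → sp ι` for a set `J` of indices of basis vectors which does not contain
both `s` and `-s` for any `s`: the image of `A` acts as `A` on the span of the `e_s` with `s` in
`J`, it kills `e_s` if neither `s` nor `-s` is in `J`, and these properties determine its action
on the vectors `e_{-s}` with `s` in `J`. -/
def slIncl (J : Set (ι ⊕ ι)) (A : sl J) : sp ι :=
  ∑ᶠ j : J, symOp (Finsupp.mapDomain Subtype.val (A.1 (Finsupp.single j 1))) (dualBv j.1)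

end Embeddings

/-! ### The possible forms of the module of fixed points -/

section Forms

variable (r : ℤ → ℤ → Prop) (mu : ℕ+ → ℂ)

/-- The set `R_μ(≺)`. -/
def RSet : Set (ℕ+ → ℂ) :=
  {om | (∀ i : ℕ+, r i 0 → om i = -1) ∧ (∀ i : ℕ+, r 0 i → om i = 0) ∧ SimSp om mu}

open Classical in
/-- The sequence `ω(+)`. -/
def omPlus : ℕ+ → ℂ := fun i => if r i 0 then -1 else 0

open Classical in
/-- The sequence `ω(-)`. -/
def omMinus : ℕ+ → ℂ := fun i => if r 0 i then 0 else -1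

/-- `[p]` is the maximal element of `{[i] ≺ [0]}`. -/
def IsMaxBelow (p : ℤ) : Prop := r p 0 ∧ ∀ j, r j 0 → ¬ r p j

/-- `[p]` is the minimal element of `{[i] ≻ [0]}`. -/
def IsMinAbove (p : ℤ) : Prop := r 0 p ∧ ∀ j, r 0 j → ¬ r j p

/-- `X_sp(μ) ^ u(≺) ≅ X_sp(ω_[0]) ⊠ ℂ` as modules over `sp([0]) ⊕ ⨁ sl([p])`: `sp([0])` acts
as on `X_sp(ω_[0])`, all `sl([p])` act by zero. -/
def FormSp (om : ℕ+ → ℂ) : Prop :=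
  ∃ psi : Xsp (fun i : zeroSet r => om i) ≃ₗ[ℂ] fixedPts r (Xsp mu),
    (∀ (A : sp (zeroSet r)) m,
      (psi ⁅A, m⁆ : Xsp mu) = ⁅spIncl (zeroSet r) A, (psi m : Xsp mu)⁆) ∧
    (∀ p : ℤ, p ∉ cls r 0 → ∀ (B : sl (clsIdx r p)), ∀ m ∈ fixedPts r (Xsp mu),
      ⁅slIncl (clsIdx r p) B, m⁆ = 0)

/-- `X_sp(μ) ^ u(≺) ≅ ℂ ⊠ X_sl(η) ⊠ ℂ` as modules over `sp([0]) ⊕ sl([q]) ⊕ ⨁ sl([p])`: `sl([q])`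
acts as on `X_sl(η)`, while `sp([0])` and all other `sl([p])` act by zero. (The subalgebras
`sl([p])` and `sl([-p])` coincide.) -/
def FormSl (q : ℤ) (eta : clsIdx r q → ℂ) : Prop :=
  ∃ psi : Xsl eta ≃ₗ[ℂ] fixedPts r (Xsp mu),
    (∀ (B : sl (clsIdx r q)) m,
      (psi ⁅B, m⁆ : Xsp mu) = ⁅slIncl (clsIdx r q) B, (psi m : Xsp mu)⁆) ∧
    (∀ (A : sp (zeroSet r)), ∀ m ∈ fixedPts r (Xsp mu), ⁅spIncl (zeroSet r) A, m⁆ = 0) ∧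
    (∀ p : ℤ, p ∉ cls r 0 → p ∉ cls r q → p ∉ cls r (-q) → ∀ (B : sl (clsIdx r p)),
      ∀ m ∈ fixedPts r (Xsp mu), ⁅slIncl (clsIdx r p) B, m⁆ = 0)

/-- `X_sp(μ) ^ u(≺)` is the trivial one-dimensional module over `sp([0]) ⊕ ⨁ sl([p])`. -/
def FormTriv : Prop :=
  Module.finrank ℂ (fixedPts r (Xsp mu)) = 1 ∧
    (∀ (A : sp (zeroSet r)), ∀ m ∈ fixedPts r (Xsp mu), ⁅spIncl (zeroSet r) A, m⁆ = 0) ∧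
    (∀ p : ℤ, p ∉ cls r 0 → ∀ (B : sl (clsIdx r p)), ∀ m ∈ fixedPts r (Xsp mu),
      ⁅slIncl (clsIdx r p) B, m⁆ = 0)

open Classical in
/-- The sequence `-1 - ε_{i₀}` over the class `[i₀]`. -/
def etaMinus (i₀ : ℕ+) : clsIdx r i₀ → ℂ := fun s => if s.1 = Sum.inl i₀ then -2 else -1

open Classical in
/-- The sequence `ε_{i₀}` over the class `[i₀]`. -/
def etaPlus (i₀ : ℕ+) : clsIdx r i₀ → ℂ := fun s => if s.1 = Sum.inl i₀ then 1 else 0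

end Forms

end WeightModules

end

open WeightModules

/-! Write x_s for s = ±i, with x_{-i} = ∂_i. Under these operators Int⁺ of a monomial changes only
when x_i raises an exponent -1 to 0. Hence X_sp(μ) has as basis the x^λ with λ ∼ μ, and the root
vector of ε_s - ε_t acts by a multiple of x_s x_{-t}, with x_i now killing every monomial whose
exponent at i is -1 (`exists_model_sp`, `tSp_symOp`). This truncated action on all monomials still
satisfies the Weyl relations (`tWeyl_comm`).

Each x_s sends monomials to multiples of monomials, with distinct exponents staying distinct. So the
fixed points are spanned by the x^λ, λ ∼ μ, killed by x_s x_{-t} for all s ≺ t (`mem_fixedPts_iff`),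
and the problem concerns a single exponent λ. Call λ a vacuum if x_s kills x^λ for all s ≺ 0; the
vacua λ ∼ μ form R_μ. A vacuum is fixed, since s ≺ t forces s ≺ 0 or 0 ≺ t. Conversely, let x^λ be
fixed but x_s x^λ ≠ 0 with s ≺ 0. No monomial is killed by both x_u and x_{-u}; this forces [0] =
{0} (`IsFixed.isVacuum`), forces [s] to be maximal below [0], and makes λ + wt s a vacuum
(`IsFixed.exists_defect`). When [0] = {0} the only vacuum is ω = ω(+) = ω(-), and the parity of the
exponent sum separates ω from the ω - wt s.

If R_μ is nonempty, the fixed monomials vary only over [0], where they form X_sp(ω_[0]). With a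
defect they are the x^{ω - wt t}, t in the maximal class below [0], and match the monomial basis of
X_sl(-1-ε) or X_sl(ε). An element of sl(J) acts by a sum of products of two operators whose order is
immaterial because the trace is zero (`slIncl_action`); applying a vanishing factor first shows that
the remaining components act trivially.

Alignment enters through a nonzero fixed vector in the image of 1 ⊗ S (`IsAligned.exists_ne_zero`).
The fourth alternative is not needed for the disjunction: when [0] = {0}, the class of ω is covered
by the first, and triviality is proved for the final clause. -/

noncomputable section

namespace WeightModules

/-! ### The truncated action of the Weyl algebra -/

section Truncated

variable {ι : Type}

/-- The position of an index of a basis vector of the natural module. -/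
def pos (s : ι ⊕ ι) : ι := Sum.elim id id s

/-- The weight of a basis vector of the natural module. -/
def wt (s : ι ⊕ ι) : ι → ℂ := Sum.elim eps (fun i => -eps i) s

open Classical in
/-- The coefficient of `x_i` (for `Sum.inl i`) resp. `∂_i` (for `Sum.inr i`) on a monomial, where
`x_i` is considered to kill the monomials with exponent `-1` at `i`. -/
def coef (s : ι ⊕ ι) (lam : ι → ℂ) : ℂ :=
  Sum.elim (fun i => if lam i = -1 then 0 else 1) (fun i => lam i) s

@[simp] theorem pos_swap (s : ι ⊕ ι) : pos s.swap = pos s := by cases s <;> rfl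

@[simp] theorem wt_swap (s : ι ⊕ ι) : wt s.swap = -wt s := by cases s <;> simp [wt]

@[simp] theorem eps_self (i : ι) : eps i i = 1 := by simp [eps]

theorem eps_ne {i j : ι} (h : j ≠ i) : eps i j = 0 := by simp [eps, h]

theorem wt_ne {s : ι ⊕ ι} {j : ι} (h : j ≠ pos s) : wt s j = 0 := by
  cases s <;> simpa [wt, pos] using eps_ne h

theorem wt_pos_ne_zero (s : ι ⊕ ι) : wt s (pos s) ≠ 0 := by
  cases s <;> simp [wt, pos]

theorem wt_injective : Function.Injective (wt : ι ⊕ ι → ι → ℂ) := by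
  intro s t h
  have hp : pos s = pos t := by
    by_contra hne
    exact wt_pos_ne_zero s (by rw [h, wt_ne hne])
  have h1 := congrFun h (pos s)
  rcases s with i | i <;> rcases t with j | j <;> simp [pos] at hp <;> subst hp <;>
    first
    | rfl
    | (exfalso
       simp [wt, pos] at h1
       norm_num [eq_neg_iff_add_eq_zero, neg_eq_iff_add_eq_zero] at h1)

theorem eq_or_eq_swap_of_pos {s t : ι ⊕ ι} (h : pos s = pos t) : s = t ∨ s = t.swap := by
  rcases s with i | i <;> rcases t with j | j <;> simp [pos] at h <;> subst h <;> simp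

theorem coef_congr (s : ι ⊕ ι) {lam lam' : ι → ℂ} (h : lam (pos s) = lam' (pos s)) :
    coef s lam = coef s lam' := by
  cases s <;> simp [coef, pos] at h ⊢ <;> simp [h]

theorem coef_add_wt {s t : ι ⊕ ι} (h : pos s ≠ pos t) (lam : ι → ℂ) :
    coef s (lam + wt t) = coef s lam :=
  coef_congr s (by simp [wt_ne h])

/-- The truncated action of a basis vector. -/
def tGen (s : ι ⊕ ι) : Module.End ℂ (Mono ι) :=
  (monoBasis ι).constr ℂ (fun lam => coef s lam • mono (lam + wt s))

@[simp] theorem tGen_mono (s : ι ⊕ ι) (lam : ι → ℂ) :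
    tGen s (mono lam) = coef s lam • mono (lam + wt s) :=
  (monoBasis ι).constr_basis ℂ _ _

theorem tGen_comm_of_pos_ne {s t : ι ⊕ ι} (h : pos s ≠ pos t) :
    tGen s * tGen t = tGen t * tGen s :=
  end_ext fun lam => by
    simp only [Module.End.mul_apply, tGen_mono, map_smul, smul_smul, coef_add_wt h,
      coef_add_wt h.symm, add_right_comm lam (wt t) (wt s), mul_comm]

/-- The truncation does not destroy the Weyl relation: at exponent -1 the left side vanishes, and
x_i ∂_i contributes the factor -1, which cancels the identity. -/
theorem tGen_inr_inl (i : ι) :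
    tGen (Sum.inr i) * tGen (Sum.inl i) = tGen (Sum.inl i) * tGen (Sum.inr i) + 1 :=
  end_ext fun lam => by
    simp only [Module.End.mul_apply, tGen_mono, map_smul, smul_smul, LinearMap.add_apply,
      Module.End.one_apply]
    have e1 : lam + wt (Sum.inl i) + wt (Sum.inr i) = lam := by simp [wt]
    have e2 : lam + wt (Sum.inr i) + wt (Sum.inl i) = lam := by simp [wt]
    rw [e1, e2]
    nth_rw 3 [← one_smul ℂ (mono lam)]
    rw [← add_smul]
    congr 1
    by_cases h1 : lam i = -1 <;> by_cases h0 : lam i = 0 <;>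
      simp [coef, wt, h1, h0]

/-- The truncated action of the Weyl algebra. -/
def tWeyl : SpV ι →ₗ[ℂ] Module.End ℂ (Mono ι) := Finsupp.linearCombination ℂ tGen

@[simp] theorem tWeyl_bv (s : ι ⊕ ι) : tWeyl (bv s) = tGen s := by simp [tWeyl]

theorem tWeyl_dualBv (s : ι ⊕ ι) : tWeyl (dualBv s) = sgn s • tGen s.swap := by
  rw [dualBv, map_smul, tWeyl_bv]

/-- The same relation as for `weyl`, so factors may be reordered in the quotient as in the Weyl
algebra. -/
theorem tWeyl_comm (u v : SpV ι) :
    tWeyl u * tWeyl v = tWeyl v * tWeyl u - omega ι u v • 1 := by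
  classical
  induction u using Finsupp.induction_linear with
  | zero => simp
  | add f g hf hg =>
    simp only [map_add, add_mul, mul_add, hf, hg, LinearMap.add_apply, add_smul]; abel
  | single i c =>
    induction v using Finsupp.induction_linear with
    | zero => simp
    | add f g hf hg =>
      simp only [map_add, add_mul, mul_add, hf, hg, add_smul]; abel
    | single j d =>
      have key : tGen i * tGen j = tGen j * tGen i -
            (sgn i * bv j i.swap) • (1 : Module.End ℂ (Mono ι)) := by
        by_cases h : pos i = pos j
        · rcases eq_or_eq_swap_of_pos h with rfl | rfl
          · have : bv i i.swap = 0 := Finsupp.single_eq_of_ne (by cases i <;> simp)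
            rw [this]; simp
          · rcases j with j | j <;> simp [sgn, tGen_inr_inl]
        · have : bv j i.swap = 0 := Finsupp.single_eq_of_ne (by rintro rfl; simp at h)
          rw [tGen_comm_of_pos_ne h, this]; simp
      have h1 : (tWeyl (Finsupp.single i c) : Module.End ℂ (Mono ι)) = c • tGen i := by
        simp [tWeyl]
      have h2 : (tWeyl (Finsupp.single j d) : Module.End ℂ (Mono ι)) = d • tGen j := by
        simp [tWeyl]
      have h3 : omega ι (Finsupp.single i c) (Finsupp.single j d) =
          c * d * (sgn i * bv j i.swap) := by
        simp only [omega, Finsupp.linearCombination_single, LinearMap.smul_apply,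
          Finsupp.lapply_apply, Finsupp.single_apply, smul_eq_mul]
        split_ifs <;> ring
      rw [h1, h2, h3]
      simp only [smul_mul_assoc, mul_smul_comm, key, smul_sub, smul_smul]
      rw [mul_left_comm d c, ← mul_assoc c d, mul_comm d c]

/-- The truncated version of `spOp`. -/
def tSp (A : Module.End ℂ (SpV ι)) : Module.End ℂ (Mono ι) :=
  (1 / 2 : ℂ) • ∑ᶠ s, tWeyl (A (bv s)) * tWeyl (dualBv s)

theorem tSp_eq_sum {A : Module.End ℂ (SpV ι)} (K : Finset (ι ⊕ ι))
    (h : ∀ j, j ∉ K → A (bv j) = 0) :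
    tSp A = (1 / 2 : ℂ) • ∑ s ∈ K, tWeyl (A (bv s)) * tWeyl (dualBv s) := by
  unfold tSp
  congr 1
  apply finsum_eq_sum_of_support_subset
  intro j hj
  by_contra hK
  exact hj (by simp [h j (by simpa using hK)])

/-- The embedding `e_j ↦ e_j` of the natural module of `sl ι` into that of `sp ι`. -/
def inlV : (ι →₀ ℂ) →ₗ[ℂ] SpV ι := Finsupp.lmapDomain ℂ ℂ Sum.inl

/-- The truncated version of `slOp`. -/
def tSl (A : Module.End ℂ (ι →₀ ℂ)) : Module.End ℂ (Mono ι) :=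
  ∑ᶠ j, tWeyl (inlV (A (Finsupp.single j 1))) * tGen (Sum.inr j)

theorem tSl_eq_sum {A : Module.End ℂ (ι →₀ ℂ)} (K : Finset ι)
    (h : ∀ j, j ∉ K → A (Finsupp.single j 1) = 0) :
    tSl A = ∑ j ∈ K, tWeyl (inlV (A (Finsupp.single j 1))) * tGen (Sum.inr j) := by
  apply finsum_eq_sum_of_support_subset
  intro j hj
  by_contra hK
  exact hj (by simp [h j (by simpa using hK)])

theorem linX_eq_weyl (v : ι →₀ ℂ) : linX v = weyl (inlV v) := by
  induction v using Finsupp.induction_linear with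
  | zero => simp
  | add f g hf hg => simp [hf, hg]
  | single i c => simp [linX, weyl, inlV]

theorem derX_eq_weyl (i : ι) : derX i = weyl (bv (Sum.inr i)) := by simp [weyl]

end Truncated

/-! ### A model of the quotients -/

section Model

variable {ι : Type}

open Classical in
/-- The projection to the span of the monomials `x ^ lam` with `Int⁺(lam) = I`. -/
def proj (I : Set ι) : Module.End ℂ (Mono ι) :=
  (monoBasis ι).constr ℂ (fun lam => if IntPlus lam = I then mono lam else 0)

open Classical in
theorem proj_mono (I : Set ι) (lam : ι → ℂ) :
    proj I (mono lam) = if IntPlus lam = I then mono lam else 0 :=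
  (monoBasis ι).constr_basis ℂ _ _

theorem mem_monoSpan {S : Set (ι → ℂ)} {m : Mono ι} :
    m ∈ monoSpan S ↔ ∀ lam, (monoBasis ι).repr m lam ≠ 0 → lam ∈ S := by
  have h : m ∈ monoSpan S ↔ _ := (monoBasis ι).mem_span_image (m := m) (s := S)
  rw [h]
  constructor
  · intro h lam hl
    exact h (by simpa using hl)
  · intro h lam hl
    exact h lam (by simpa using hl)

theorem mono_mem_monoSpan {S : Set (ι → ℂ)} {lam : ι → ℂ} (h : lam ∈ S) :
    mono lam ∈ monoSpan S :=
  Submodule.subset_span ⟨lam, h, rfl⟩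

theorem repr_mono (lam : ι → ℂ) :
    (monoBasis ι).repr (mono lam) = Finsupp.single lam 1 :=
  (monoBasis ι).repr_self lam

theorem mono_ne_zero (lam : ι → ℂ) : mono lam ≠ 0 := (monoBasis ι).ne_zero lam

theorem mono_mem_iff {S : Set (ι → ℂ)} {lam : ι → ℂ} : mono lam ∈ monoSpan S ↔ lam ∈ S := by
  classical
  constructor
  · intro h
    exact mem_monoSpan.1 h lam (by simp [repr_mono])
  · exact mono_mem_monoSpan

theorem eq_on_monoSpan {S : Set (ι → ℂ)} {M : Type} [AddCommGroup M] [Module ℂ M]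
    {f g : Mono ι →ₗ[ℂ] M} (h : ∀ lam ∈ S, f (mono lam) = g (mono lam)) {m : Mono ι}
    (hm : m ∈ monoSpan S) : f m = g m := by
  have : Set.EqOn f g (mono '' S) := by
    rintro _ ⟨lam, hl, rfl⟩
    exact h lam hl
  exact LinearMap.eqOn_span this hm

/-- The monomials in which the exponents at all `i` in `I` are nonnegative integers. -/
def upperExp (I : Set ι) : Set (ι → ℂ) := {lam | I ⊆ IntPlus lam}

/-- Subtracting 1 takes an entry out of ℤ_{≥0} only at 0, where the coefficient of ∂_i vanishes;
dually, adding 1 enlarges Int⁺ only at -1. -/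
theorem intPlus_sub_eq (lam : ι → ℂ) (i : ι) (h0 : lam i ≠ 0) :
    IntPlus (lam - eps i) = IntPlus lam := by
  refine Set.Subset.antisymm ?_ (intPlus_sub lam i h0)
  have := intPlus_add (lam - eps i) i
  rwa [sub_add_cancel] at this

theorem intPlus_add_eq (lam : ι → ℂ) (i : ι) (h0 : lam i ≠ -1) :
    IntPlus (lam + eps i) = IntPlus lam := by
  have := intPlus_sub_eq (lam + eps i) i (by
    simpa using fun h => h0 (eq_neg_of_add_eq_zero_left h))
  rw [← this, add_sub_cancel_right]

theorem weyl_bv_mono (s : ι ⊕ ι) (lam : ι → ℂ) :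
    weyl (bv s) (mono lam) =
      Sum.elim (fun _ => (1 : ℂ)) (fun i => lam i) s • mono (lam + wt s) := by
  cases s <;> simp [weyl, wt, sub_eq_add_neg]

theorem weyl_mem_upper (I : Set ι) (v : SpV ι) {m : Mono ι} (hm : m ∈ monoSpan (upperExp I)) :
    weyl v m ∈ monoSpan (upperExp I) := by
  induction v using Finsupp.induction_linear with
  | zero => simp
  | add f g hf hg => simpa using Submodule.add_mem _ hf hg
  | single s c =>
    have : (Finsupp.single s c : SpV ι) = c • bv s := by simp
    rw [this, map_smul, LinearMap.smul_apply]
    refine Submodule.smul_mem _ _ (monoSpan_map _ (fun lam hl => ?_) hm)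
    rcases s with i | i
    · rw [weyl_bv_mono]
      exact Submodule.smul_mem _ _ (mono_mem_monoSpan (hl.trans (intPlus_add lam i)))
    · by_cases h0 : lam i = 0
      · simp [weyl_bv_mono, h0]
      · rw [weyl_bv_mono]
        refine Submodule.smul_mem _ _ (mono_mem_monoSpan ?_)
        have := hl.trans (intPlus_sub lam i h0)
        simpa [upperExp, wt, ← sub_eq_add_neg] using this

/-- The source of the truncation. On exponents with I ⊆ Int⁺ no operator can shrink Int⁺, so what
the projection discards never returns, and a step from -1 to 0 always leaves the level Int⁺ = I. -/
theorem proj_weyl (I : Set ι) (v : SpV ι) {m : Mono ι} (hm : m ∈ monoSpan (upperExp I)) :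
    proj I (weyl v m) = tWeyl v (proj I m) := by
  classical
  induction v using Finsupp.induction_linear with
  | zero => simp
  | add f g hf hg => simp [hf, hg]
  | single s c =>
    have : (Finsupp.single s c : SpV ι) = c • bv s := by simp
    rw [this, map_smul, map_smul, LinearMap.smul_apply, LinearMap.smul_apply, map_smul]
    congr 1
    refine eq_on_monoSpan (f := proj I ∘ₗ weyl (bv s)) (g := tWeyl (bv s) ∘ₗ proj I)
      (fun lam hl => ?_) hm
    simp only [LinearMap.comp_apply, weyl_bv_mono, map_smul, proj_mono, tWeyl_bv]
    rcases s with i | i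
    · by_cases h1 : lam i = -1
      · have hi : i ∈ IntPlus (lam + eps i) := ⟨0, by simp [h1]⟩
        have hi' : i ∉ IntPlus lam := by
          rintro ⟨n, hn⟩
          rw [h1] at hn
          have h3 : ((-1 : ℤ) : ℂ) = ((n : ℤ) : ℂ) := by push_cast; exact hn
          have := Int.cast_injective h3
          omega
        have : IntPlus (lam + wt (Sum.inl i)) ≠ I := by
          rintro rfl
          exact hi' (hl hi)
        rw [if_neg this]
        split_ifs <;> simp [coef, h1]
      · have : IntPlus (lam + wt (Sum.inl i)) = IntPlus lam := intPlus_add_eq lam i h1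
        rw [this]
        split_ifs <;> simp [coef, h1]
    · by_cases h0 : lam i = 0
      · simp only [Sum.elim_inr, h0, zero_smul]
        split_ifs <;> simp [coef, h0]
      · have : IntPlus (lam + wt (Sum.inr i)) = IntPlus lam := by
          simpa [wt, ← sub_eq_add_neg] using intPlus_sub_eq lam i h0
        rw [this]
        split_ifs <;> simp [coef]

theorem proj_spOp (I : Set ι) {A : Module.End ℂ (SpV ι)} (hA : IsFinitary A) {m : Mono ι}
    (hm : m ∈ monoSpan (upperExp I)) : proj I (spOp A m) = tSp A (proj I m) := by
  obtain ⟨K, hK⟩ := hA.exists_finset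
  rw [spOp_eq_sum K hK, tSp_eq_sum K hK]
  simp only [LinearMap.smul_apply, LinearMap.sum_apply, map_smul, map_sum, Module.End.mul_apply]
  congr 1
  refine Finset.sum_congr rfl fun s _ => ?_
  rw [proj_weyl I _ (weyl_mem_upper I _ hm), proj_weyl I _ hm]

theorem proj_slOp (I : Set ι) {A : Module.End ℂ (ι →₀ ℂ)} (hA : IsFinitary A) {m : Mono ι}
    (hm : m ∈ monoSpan (upperExp I)) : proj I (slOp A m) = tSl A (proj I m) := by
  obtain ⟨K, hK⟩ := hA.exists_finset
  rw [slOp_eq_sum K hK, tSl_eq_sum K hK]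
  simp only [LinearMap.sum_apply, map_sum, Module.End.mul_apply]
  refine Finset.sum_congr rfl fun s _ => ?_
  rw [linX_eq_weyl, derX_eq_weyl, proj_weyl I _ (weyl_mem_upper I _ hm), proj_weyl I _ hm,
    tWeyl_bv]

/-- The two conditions on N say that N ∩ V is the kernel of `proj I` on V, so the projection embeds
V/(N ∩ V) onto the span of the surviving monomials. -/
theorem exists_model {L : Type} [LieRing L] [LieAlgebra ℂ L] [LieRingModule L (Mono ι)]
    [LieModule ℂ L (Mono ι)] (V N : LieSubmodule ℂ L (Mono ι)) (S : Set (ι → ℂ)) (I : Set ι)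
    (hV : V.toSubmodule = monoSpan S) (hN : ∀ m ∈ N, proj I m = 0)
    (hS : ∀ lam ∈ S, IntPlus lam ≠ I → mono lam ∈ N) :
    ∃ Phi : (V ⧸ N.comap V.incl) →ₗ[ℂ] Mono ι, Function.Injective Phi ∧
      LinearMap.range Phi = monoSpan {lam | lam ∈ S ∧ IntPlus lam = I} ∧
      ∀ m : V, Phi (LieSubmodule.Quotient.mk m) = proj I m := by
  classical
  have hk : ∀ m ∈ V, proj I m = 0 → m ∈ N := by
    intro m hm h0
    have h1 : m ∈ monoSpan S := by rw [← hV]; exact hm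
    -- The difference consists of monomials with Int⁺ ≠ I, which all lie in N.
    have h2 : m - proj I m ∈ N := by
      have : monoSpan S ≤ N.toSubmodule.comap (LinearMap.id - proj I) := by
        rw [monoSpan, Submodule.span_le]
        rintro _ ⟨lam, hl, rfl⟩
        simp only [SetLike.mem_coe, Submodule.mem_comap, LinearMap.sub_apply, LinearMap.id_apply,
          proj_mono, LieSubmodule.mem_toSubmodule]
        split_ifs with h
        · simp
        · simpa using hS lam hl h
      exact this h1
    simpa [h0] using h2
  let f : V →ₗ[ℂ] Mono ι := proj I ∘ₗ V.toSubmodule.subtype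
  have hf : (N.comap V.incl).toSubmodule = LinearMap.ker f := by
    ext m
    exact ⟨fun h => hN _ h, fun h => hk _ m.2 h⟩
  refine ⟨Submodule.liftQ (N.comap V.incl).toSubmodule f hf.le, ?_, ?_, fun m => rfl⟩
  · exact LinearMap.ker_eq_bot.1 (Submodule.ker_liftQ_eq_bot _ _ _ hf.ge)
  · refine (Submodule.range_liftQ _ _ _).trans ?_
    have : LinearMap.range f = (monoSpan S).map (proj I) := by
      rw [← hV, LinearMap.range_comp, Submodule.range_subtype]
    rw [this, monoSpan, Submodule.map_span]
    apply le_antisymm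
    · rw [Submodule.span_le]
      rintro _ ⟨_, ⟨lam, hl, rfl⟩, rfl⟩
      rw [proj_mono]
      split_ifs with h
      · exact mono_mem_monoSpan ⟨hl, h⟩
      · exact Submodule.zero_mem _
    · rw [monoSpan, Submodule.span_le]
      rintro _ ⟨lam, ⟨hl, h⟩, rfl⟩
      exact Submodule.subset_span ⟨mono lam, ⟨lam, hl, rfl⟩, by rw [proj_mono, if_pos h]⟩

end Model

end WeightModules

end

noncomputable section

namespace WeightModules

/-! ### Root lattices and inclusions among the modules V(μ). -/

section Lattices

variable {ι : Type}

theorem rootLatticeSp_zero : (0 : ι → ℂ) ∈ rootLatticeSp ι := ⟨0, by simp, by simp⟩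

theorem rootLatticeSp_neg {a : ι → ℂ} (ha : a ∈ rootLatticeSp ι) : -a ∈ rootLatticeSp ι := by
  classical
  obtain ⟨f, hf, hs⟩ := ha
  refine ⟨-f, fun i => by simp [hf i], ?_⟩
  rw [Finsupp.sum_neg_index (by simp)]
  simpa [Finsupp.sum] using hs

theorem rootLatticeSp_add {a b : ι → ℂ} (ha : a ∈ rootLatticeSp ι) (hb : b ∈ rootLatticeSp ι) :
    a + b ∈ rootLatticeSp ι := by
  classical
  obtain ⟨f, hf, hs⟩ := ha
  obtain ⟨g, hg, ht⟩ := hb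
  refine ⟨f + g, fun i => by simp [hf i, hg i], ?_⟩
  rw [Finsupp.sum_add_index' (by simp) (by simp)]
  exact hs.add ht

theorem rootLatticeSl_zero : (0 : ι → ℂ) ∈ rootLatticeSl ι := ⟨0, by simp, by simp⟩

theorem rootLatticeSl_neg {a : ι → ℂ} (ha : a ∈ rootLatticeSl ι) : -a ∈ rootLatticeSl ι := by
  classical
  obtain ⟨f, hf, hs⟩ := ha
  refine ⟨-f, fun i => by simp [hf i], ?_⟩
  rw [Finsupp.sum_neg_index (by simp)]
  simpa [Finsupp.sum] using hs

theorem rootLatticeSl_add {a b : ι → ℂ} (ha : a ∈ rootLatticeSl ι) (hb : b ∈ rootLatticeSl ι) :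
    a + b ∈ rootLatticeSl ι := by
  classical
  obtain ⟨f, hf, hs⟩ := ha
  obtain ⟨g, hg, ht⟩ := hb
  refine ⟨f + g, fun i => by simp [hf i, hg i], ?_⟩
  rw [Finsupp.sum_add_index' (by simp) (by simp), hs, ht, add_zero]

theorem SimSp.symm {lam mu : ι → ℂ} (h : SimSp lam mu) : SimSp mu lam :=
  ⟨by simpa using rootLatticeSp_neg h.1, h.2.symm⟩

theorem SimSp.trans {lam mu nu : ι → ℂ} (h : SimSp lam mu) (h' : SimSp mu nu) : SimSp lam nu :=
  ⟨by simpa using rootLatticeSp_add h.1 h'.1, h'.2.trans h.2⟩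

theorem spExp_subset {lam mu : ι → ℂ} (h : lam ∈ spExp mu) : spExp lam ⊆ spExp mu := by
  intro nu hn
  exact ⟨by simpa using rootLatticeSp_add hn.1 h.1, h.2.trans hn.2⟩

theorem slExp_subset {lam mu : ι → ℂ} (h : lam ∈ slExp mu) : slExp lam ⊆ slExp mu := by
  intro nu hn
  exact ⟨by simpa using rootLatticeSl_add hn.1 h.1, h.2.trans hn.2⟩

theorem self_mem_spExp (mu : ι → ℂ) : mu ∈ spExp mu :=
  ⟨by simpa using rootLatticeSp_zero, subset_rfl⟩

theorem self_mem_slExp (mu : ι → ℂ) : mu ∈ slExp mu :=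
  ⟨by simpa using rootLatticeSl_zero, subset_rfl⟩

theorem monoSpan_mono {S T : Set (ι → ℂ)} (h : S ⊆ T) : monoSpan S ≤ monoSpan T :=
  Submodule.span_mono (Set.image_mono h)

theorem Vsp_le_iff {lam mu : ι → ℂ} : Vsp lam ≤ Vsp mu ↔ lam ∈ spExp mu := by
  constructor
  · intro h
    have h1 : mono lam ∈ Vsp lam := mono_mem_monoSpan (self_mem_spExp lam)
    exact mono_mem_iff.1 (h h1)
  · intro h
    exact monoSpan_mono (spExp_subset h)

theorem Vsl_le_iff {lam mu : ι → ℂ} : Vsl lam ≤ Vsl mu ↔ lam ∈ slExp mu := by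
  constructor
  · intro h
    have h1 : mono lam ∈ Vsl lam := mono_mem_monoSpan (self_mem_slExp lam)
    exact mono_mem_iff.1 (h h1)
  · intro h
    exact monoSpan_mono (slExp_subset h)

/-- Within one coset of the root lattice, inclusion of the modules is reverse inclusion of Int⁺, so
it is strict exactly when the two sets differ. -/
theorem Vsp_lt_iff {lam mu : ι → ℂ} :
    Vsp lam < Vsp mu ↔ lam ∈ spExp mu ∧ IntPlus lam ≠ IntPlus mu := by
  rw [lt_iff_le_not_ge, Vsp_le_iff, Vsp_le_iff]
  refine and_congr_right fun h => not_congr ⟨fun h' => h'.2.antisymm h.2, fun h' => ⟨?_, h'.le⟩⟩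
  simpa using rootLatticeSp_neg h.1

theorem Vsl_lt_iff {lam mu : ι → ℂ} :
    Vsl lam < Vsl mu ↔ lam ∈ slExp mu ∧ IntPlus lam ≠ IntPlus mu := by
  rw [lt_iff_le_not_ge, Vsl_le_iff, Vsl_le_iff]
  refine and_congr_right fun h => not_congr ⟨fun h' => h'.2.antisymm h.2, fun h' => ⟨?_, h'.le⟩⟩
  simpa using rootLatticeSl_neg h.1

theorem proj_eq_zero_of_mem {I : Set ι} {S : Set (ι → ℂ)} (h : ∀ lam ∈ S, IntPlus lam ≠ I)
    {m : Mono ι} (hm : m ∈ monoSpan S) : proj I m = 0 := by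
  classical
  refine eq_on_monoSpan (f := proj I) (g := 0) (fun lam hl => ?_) hm
  rw [proj_mono, if_neg (h lam hl), LinearMap.zero_apply]

end Lattices

/-! ### Monomial models of X_sp(μ) and X_sl(η). -/

section Models

variable {ι : Type}

/-- V⁺ contains every monomial of V with larger Int⁺, and only those, because the generating
submodules V(μ') have Int⁺(μ') strictly larger. Projection to Int⁺ = Int⁺(μ) therefore identifies
the quotient with the span of the x^λ, λ ∼ μ. -/
theorem exists_model_sp (mu : ι → ℂ) : ∃ Phi : Xsp mu →ₗ[ℂ] Mono ι,
    Function.Injective Phi ∧ LinearMap.range Phi = monoSpan {lam | SimSp lam mu} ∧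
      ∀ (A : sp ι) m, Phi ⁅A, m⁆ = tSp A.1 (Phi m) := by
  obtain ⟨Phi, h1, h2, h3⟩ := exists_model (Vsp mu) (VspPlus mu) (spExp mu) (IntPlus mu) rfl
    (fun m hm => by
      have hm' : m ∈ (VspPlus mu).toSubmodule := hm
      have hle : (VspPlus mu).toSubmodule ≤ LinearMap.ker (proj (IntPlus mu)) := by
        rw [VspPlus, LieSubmodule.iSup_toSubmodule]
        refine iSup_le fun mu' => ?_
        rw [LieSubmodule.iSup_toSubmodule]
        refine iSup_le fun h m hm => ?_
        obtain ⟨ha, hb⟩ := Vsp_lt_iff.1 h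
        refine proj_eq_zero_of_mem (S := spExp mu') (fun lam hl he => hb ?_) hm
        exact (hl.2.trans he.le).antisymm ha.2
      exact hle hm')
    (fun lam hl hne => by
      have h1 : Vsp lam < Vsp mu := Vsp_lt_iff.2 ⟨hl, hne⟩
      have h2 : Vsp lam ≤ VspPlus mu := le_iSup₂_of_le lam h1 le_rfl
      exact h2 (mono_mem_monoSpan (self_mem_spExp lam)))
  refine ⟨Phi, h1, h2.trans ?_, fun A m => ?_⟩
  · congr 1
    ext lam
    exact ⟨fun h => ⟨h.1.1, h.2.symm⟩, fun h => ⟨⟨h.1, h.2.le⟩, h.2.symm⟩⟩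
  · obtain ⟨x, rfl⟩ := LieSubmodule.Quotient.surjective_mk' _ m
    have e : (⁅A, LieSubmodule.Quotient.mk' _ x⁆ : Xsp mu) =
      LieSubmodule.Quotient.mk ⁅A, x⁆ := rfl
    rw [e, h3]
    have := h3 x
    refine Eq.trans ?_ (congrArg _ this.symm)
    exact proj_spOp _ A.2.1 (monoSpan_mono (fun lam hl => hl.2) x.2)

theorem exists_model_sl (mu : ι → ℂ) : ∃ Phi : Xsl mu →ₗ[ℂ] Mono ι,
    Function.Injective Phi ∧ LinearMap.range Phi =
      monoSpan {lam | lam - mu ∈ rootLatticeSl ι ∧ IntPlus lam = IntPlus mu} ∧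
      ∀ (A : sl ι) m, Phi ⁅A, m⁆ = tSl A.1 (Phi m) := by
  obtain ⟨Phi, h1, h2, h3⟩ := exists_model (Vsl mu) (VslPlus mu) (slExp mu) (IntPlus mu) rfl
    (fun m hm => by
      have hm' : m ∈ (VslPlus mu).toSubmodule := hm
      have hle : (VslPlus mu).toSubmodule ≤ LinearMap.ker (proj (IntPlus mu)) := by
        rw [VslPlus, LieSubmodule.iSup_toSubmodule]
        refine iSup_le fun mu' => ?_
        rw [LieSubmodule.iSup_toSubmodule]
        refine iSup_le fun h m hm => ?_
        obtain ⟨ha, hb⟩ := Vsl_lt_iff.1 h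
        refine proj_eq_zero_of_mem (S := slExp mu') (fun lam hl he => hb ?_) hm
        exact (hl.2.trans he.le).antisymm ha.2
      exact hle hm')
    (fun lam hl hne => by
      have h1 : Vsl lam < Vsl mu := Vsl_lt_iff.2 ⟨hl, hne⟩
      have h2 : Vsl lam ≤ VslPlus mu := le_iSup₂_of_le lam h1 le_rfl
      exact h2 (mono_mem_monoSpan (self_mem_slExp lam)))
  refine ⟨Phi, h1, h2.trans ?_, fun A m => ?_⟩
  · congr 1
    ext lam
    exact ⟨fun h => ⟨h.1.1, h.2⟩, fun h => ⟨⟨h.1, h.2.ge⟩, h.2⟩⟩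
  · obtain ⟨x, rfl⟩ := LieSubmodule.Quotient.surjective_mk' _ m
    have e : (⁅A, LieSubmodule.Quotient.mk' _ x⁆ : Xsl mu) =
      LieSubmodule.Quotient.mk ⁅A, x⁆ := rfl
    rw [e, h3]
    have := h3 x
    refine Eq.trans ?_ (congrArg _ this.symm)
    exact proj_slOp _ A.2.1 (monoSpan_mono (fun lam hl => hl.2) x.2)

end Models

/-! ### The action of the root vectors and of the components of the semisimple part -/

section Operators

variable {ι : Type}

theorem sum_swap_smul (K : Finset (ι ⊕ ι)) (v : SpV ι) (h : ∀ s, s ∉ K → v s.swap = 0) :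
    ∑ s ∈ K, v s.swap • bv s.swap = v := by
  classical
  ext t
  rw [Finsupp.finsetSum_apply]
  simp only [Finsupp.smul_apply, Finsupp.single_apply, smul_eq_mul, mul_ite, mul_one, mul_zero]
  rw [Finset.sum_eq_single t.swap]
  · simp
  · intro s _ hs
    rw [if_neg]
    rintro rfl
    exact hs (by simp)
  · intro ht
    simpa using h _ ht

theorem sum_omega_dualBv (K : Finset (ι ⊕ ι)) (v : SpV ι) (h : ∀ s, s ∉ K → v s.swap = 0) :
    ∑ s ∈ K, omega ι v (bv s) • dualBv s = -v := by
  -- The expansion is wanted on the right only; the copies it creates inside `omega` are folded back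
  -- by the next rewrite.
  rw [← sum_swap_smul K v h, ← Finset.sum_neg_distrib]
  rw [sum_swap_smul K v h]
  refine Finset.sum_congr rfl fun s _ => ?_
  rw [omega_swap, omega_bv_left, dualBv, smul_smul, neg_mul, mul_right_comm, sgn_mul_self,
    one_mul, neg_smul]

/-- The elements `symOp v w` correspond to symmetrised products in the Weyl algebra; root vectors
and the images of sl(J) are built from them. -/
theorem tSp_symOp (v w : SpV ι) :
    tSp (symOp v w).1 = (1 / 2 : ℂ) • (tWeyl v * tWeyl w + tWeyl w * tWeyl v) := by
  classical
  let K : Finset (ι ⊕ ι) := v.support.image Sum.swap ∪ w.support.image Sum.swap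
  have hv : ∀ s, s ∉ K → v s.swap = 0 := fun s hs => by
    by_contra h
    exact hs (Finset.mem_union_left _ (Finset.mem_image.2 ⟨s.swap, by simpa using h, by simp⟩))
  have hw : ∀ s, s ∉ K → w s.swap = 0 := fun s hs => by
    by_contra h
    exact hs (Finset.mem_union_right _ (Finset.mem_image.2 ⟨s.swap, by simpa using h, by simp⟩))
  have e : ∀ u, (symOp v w).1 u = -(omega ι v u • w + omega ι w u • v) := fun u => rfl
  have z : ∀ x : SpV ι, ∀ s, x s.swap = 0 → omega ι x (bv s) = 0 := fun x s h => by
    rw [omega_swap, omega_bv_left, h]; simp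
  rw [tSp_eq_sum K (fun s hs => by rw [e, z v s (hv s hs), z w s (hw s hs)]; simp)]
  congr 1
  have e1 : ∀ s, tWeyl ((symOp v w).1 (bv s)) * tWeyl (dualBv s) =
      -(tWeyl w * tWeyl (omega ι v (bv s) • dualBv s)) -
        tWeyl v * tWeyl (omega ι w (bv s) • dualBv s) := fun s => by
    rw [e]
    simp only [map_neg, map_add, map_smul, add_mul, neg_mul, smul_mul_assoc, mul_smul_comm]
    abel
  rw [Finset.sum_congr rfl fun s _ => e1 s, Finset.sum_sub_distrib, Finset.sum_neg_distrib,
    ← Finset.mul_sum, ← Finset.mul_sum, ← map_sum, ← map_sum, sum_omega_dualBv K v hv,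
    sum_omega_dualBv K w hw]
  simp only [map_neg, mul_neg, neg_neg, sub_neg_eq_add]
  abel

/-- The image of a vector of the natural module of `sl J` in that of `sp ι`. -/
abbrev incV (J : Set (ι ⊕ ι)) (v : J →₀ ℂ) : SpV ι := Finsupp.mapDomain Subtype.val v

/-- Exchanging the two factors of the j-th product costs the scalar B_{jj}, and these scalars add up
to tr B = 0. So the symmetrised sum equals the sum in either order, and the order can be chosen to
let a vanishing factor act first. -/
theorem slIncl_action {J : Set (ι ⊕ ι)} {M : Type} [AddCommGroup M] [Module ℂ M]
    [LieRingModule (sp ι) M] [LieModule ℂ (sp ι) M] (Phi : M →ₗ[ℂ] Mono ι)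
    (hPhi : ∀ (A : sp ι) m, Phi ⁅A, m⁆ = tSp A.1 (Phi m)) (B : sl J) (K : Finset J)
    (hK : ∀ j, j ∉ K → B.1 (Finsupp.single j 1) = 0) (m : M) :
    Phi ⁅slIncl J B, m⁆ = ∑ j ∈ K,
      tWeyl (dualBv j.1) (tWeyl (incV J (B.1 (Finsupp.single j 1))) (Phi m)) ∧
    Phi ⁅slIncl J B, m⁆ = ∑ j ∈ K,
      tWeyl (incV J (B.1 (Finsupp.single j 1))) (tWeyl (dualBv j.1) (Phi m)) := by
  classical
  have e0 : slIncl J B = ∑ j ∈ K, symOp (incV J (B.1 (Finsupp.single j 1))) (dualBv j.1) := by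
    apply finsum_eq_sum_of_support_subset
    intro j hj
    by_contra hn
    refine hj ?_
    beta_reduce
    rw [hK j (by simpa using hn)]
    ext
    simp [symOp]
  have e1 : Phi ⁅slIncl J B, m⁆ = ∑ j ∈ K,
      tSp (symOp (incV J (B.1 (Finsupp.single j 1))) (dualBv j.1)).1 (Phi m) := by
    rw [e0, sum_lie, map_sum]
    exact Finset.sum_congr rfl fun j _ => hPhi _ _
  have e2 : ∀ j : J, tWeyl (incV J (B.1 (Finsupp.single j 1))) * tWeyl (dualBv j.1) =
      tWeyl (dualBv j.1) * tWeyl (incV J (B.1 (Finsupp.single j 1))) -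
        B.1 (Finsupp.single j 1) j • 1 := fun j => by
    rw [tWeyl_comm, omega_swap, dualBv_expand, neg_neg,
      Finsupp.mapDomain_apply Subtype.val_injective]
  have tr0 : ∑ j ∈ K, B.1 (Finsupp.single j 1) j = 0 := by
    rw [← tr_eq_sum K hK]; exact B.2.2
  have hsum : ∑ j ∈ K, tWeyl (incV J (B.1 (Finsupp.single j 1))) (tWeyl (dualBv j.1) (Phi m)) =
      ∑ j ∈ K, tWeyl (dualBv j.1) (tWeyl (incV J (B.1 (Finsupp.single j 1))) (Phi m)) := by
    simp only [← Module.End.mul_apply, e2, LinearMap.sub_apply, Finset.sum_sub_distrib,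
      LinearMap.smul_apply, ← Finset.sum_smul, tr0, zero_smul, sub_zero]
  have hm : Phi ⁅slIncl J B, m⁆ = ∑ j ∈ K,
      tWeyl (dualBv j.1) (tWeyl (incV J (B.1 (Finsupp.single j 1))) (Phi m)) := by
    rw [e1]
    simp only [tSp_symOp, LinearMap.smul_apply, LinearMap.add_apply, Module.End.mul_apply]
    rw [← Finset.smul_sum, Finset.sum_add_distrib, hsum, ← two_smul ℂ, smul_smul]
    norm_num
  exact ⟨hm, hm.trans hsum.symm⟩

end Operators

end WeightModules

end

noncomputable section

namespace WeightModules

/-! ### Root spaces -/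

section RootSpaces

theorem wt_eq_or (a v : Idx) : a = v ∨ a = v.swap ∨ wt a (pos v) = 0 := by
  by_cases h : pos a = pos v
  · rcases eq_or_eq_swap_of_pos h with h | h
    · exact Or.inl h
    · exact Or.inr (Or.inl h)
  · exact Or.inr (Or.inr (wt_ne (Ne.symm h)))

/-- A nonzero sum of two of the ±ε_i determines its summands; `hst` excludes the sum zero. -/
theorem wt_add_eq {v u s t : Idx} (h : wt v + wt u = wt s + wt t) (hst : s ≠ t.swap) :
    v = s ∧ u = t ∨ v = t ∧ u = s := by
  by_cases h1 : v = s
  · subst h1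
    exact Or.inl ⟨rfl, wt_injective (add_left_cancel h)⟩
  by_cases h2 : v = t
  · subst h2
    rw [add_comm (wt s)] at h
    exact Or.inr ⟨rfl, wt_injective (add_left_cancel h)⟩
  exfalso
  have hp := congrFun h (pos v)
  have hc := wt_pos_ne_zero v
  simp only [Pi.add_apply] at hp
  have key : ∀ a : Idx, a ≠ v → wt a (pos v) = -wt v (pos v) ∨ wt a (pos v) = 0 := by
    intro a ha
    rcases wt_eq_or a v with h | h | h
    · exact absurd h ha
    · left; rw [h, wt_swap, Pi.neg_apply]
    · exact Or.inr h
  have hu : u ≠ v.swap := by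
    rintro rfl
    rw [wt_swap, add_neg_cancel] at h
    apply hst
    apply wt_injective
    rw [wt_swap]
    exact eq_neg_of_add_eq_zero_left h.symm
  have hu' : wt u (pos v) = wt v (pos v) ∨ wt u (pos v) = 0 := by
    rcases wt_eq_or u v with h | h | h
    · left; rw [h]
    · exact absurd h hu
    · exact Or.inr h
  apply hc
  -- At the place `pos v`, with c the entry of `wt v`, the left side is c or 2c and the right side
  -- is 0, -c or -2c. So k c = 0 with k between 1 and 4.
  rcases hu' with e | e <;> rcases key s (Ne.symm h1) with e' | e' <;>
    rcases key t (Ne.symm h2) with e'' | e'' <;> rw [e, e', e''] at hp <;>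
    first
    | linear_combination hp
    | linear_combination (1 / 2 : ℂ) * hp
    | linear_combination (1 / 3 : ℂ) * hp
    | linear_combination (1 / 4 : ℂ) * hp

theorem symOp_apply {ι : Type} (v w u : SpV ι) :
    (symOp v w).1 u = -(omega ι v u • w + omega ι w u • v) := rfl

theorem cartan_apply {H : spInf} (hH : H ∈ cartan) (s : Idx) :
    H.1 (bv s) = epsH s H • bv s := by
  obtain ⟨c, hc⟩ := hH s
  rw [epsH, hc]
  simp

theorem cartan_apply_coord {H : spInf} (hH : H ∈ cartan) (v : SpV ℕ+) (s : Idx) :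
    (H.1 v) s = epsH s H * v s := by
  classical
  induction v using Finsupp.induction_linear with
  | zero => simp
  | add f g hf hg => simp [hf, hg, mul_add]
  | single t c =>
    have : (Finsupp.single t c : SpV ℕ+) = c • bv t := by simp
    rw [this, map_smul, cartan_apply hH]
    by_cases h : s = t
    · subst h; simp [mul_comm]
    · simp [Finsupp.single_eq_of_ne h]

theorem epsH_swap (s : Idx) (H : spInf) : epsH s.swap H = -epsH s H := by
  have h := H.2.2 (bv s) (bv s.swap)
  rw [omega_swap (H.1 (bv s)), omega_bv_left, omega_bv_left, Sum.swap_swap, sgn_swap] at h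
  have h2 : sgn s * (epsH s.swap H + epsH s H) = 0 := by
    unfold epsH
    linear_combination h
  have h3 : sgn s ≠ 0 := by
    intro h
    have := sgn_mul_self s
    simp [h] at this
  exact eq_neg_of_add_eq_zero_left ((mul_eq_zero.1 h2).resolve_left h3)

theorem lie_symOp {ι : Type} (A : sp ι) (v w : SpV ι) :
    ⁅A, symOp v w⁆ = symOp (A.1 v) w + symOp v (A.1 w) := by
  refine Subtype.ext (LinearMap.ext fun u => ?_)
  have h1 := A.2.2 v u
  have h2 := A.2.2 w u
  have e1 : omega ι v (A.1 u) = -omega ι (A.1 v) u := by linear_combination h1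
  have e2 : omega ι w (A.1 u) = -omega ι (A.1 w) u := by linear_combination h2
  change A.1 ((symOp v w).1 u) - (symOp v w).1 (A.1 u) =
    (symOp (A.1 v) w).1 u + (symOp v (A.1 w)).1 u
  simp only [symOp_apply, map_neg, map_add, map_smul, e1, e2, neg_smul]
  abel

theorem symOp_smul_left {ι : Type} (c : ℂ) (v w : SpV ι) : symOp (c • v) w = c • symOp v w := by
  refine Subtype.ext (LinearMap.ext fun u => ?_)
  change (symOp (c • v) w).1 u = c • (symOp v w).1 u
  simp [symOp_apply, smul_smul, mul_comm]

theorem symOp_smul_right {ι : Type} (c : ℂ) (v w : SpV ι) : symOp v (c • w) = c • symOp v w := by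
  refine Subtype.ext (LinearMap.ext fun u => ?_)
  change (symOp v (c • w)).1 u = c • (symOp v w).1 u
  simp [symOp_apply, smul_smul, mul_comm]

theorem symOp_mem_rootSpace (s t : Idx) : symOp (bv s) (bv t.swap) ∈ rootSpace s t := by
  intro H hH
  rw [lie_symOp, cartan_apply hH, cartan_apply hH, symOp_smul_left, symOp_smul_right, epsH_swap,
    ← add_smul, sub_eq_add_neg]

theorem symOp_cartan_apply (i : ℕ+) (s : Idx) :
    (symOp (bv (Sum.inl i)) (bv (Sum.inr i))).1 (bv s) = wt s i • bv s := by
  rw [symOp_apply, omega_bv_left, omega_bv_left]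
  rcases s with j | j <;> by_cases h : j = i
  all_goals first
    | (subst h; simp [sgn, wt])
    | simp [sgn, wt, eps_ne (Ne.symm h), Ne.symm h]

theorem symOp_mem_cartan (i : ℕ+) : symOp (bv (Sum.inl i)) (bv (Sum.inr i)) ∈ cartan :=
  fun s => ⟨wt s i, symOp_cartan_apply i s⟩

theorem epsH_symOp (i : ℕ+) (s : Idx) :
    epsH s (symOp (bv (Sum.inl i)) (bv (Sum.inr i))) = wt s i := by
  rw [epsH, symOp_cartan_apply]
  simp

/-- The only possibly nonzero matrix entries of the elements of a root space. -/
theorem rootSpace_entry {s t : Idx} (hst : s ≠ t) {A : spInf} (hA : A ∈ rootSpace s t)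
    {u v : Idx} (h : (A.1 (bv u)) v ≠ 0) : v = s ∧ u = t ∨ v = t.swap ∧ u = s.swap := by
  have key : wt v - wt u = wt s - wt t := by
    funext i
    -- The diagonal element used here has entry `wt a i` at each a, so its bracket with A, read at
    -- the matrix entry (v, u), gives the i-th coordinate of the identity.
    have h1 := hA _ (symOp_mem_cartan i)
    set H := symOp (bv (Sum.inl i)) (bv (Sum.inr i)) with hH
    have h2 : H.1 (A.1 (bv u)) - A.1 (H.1 (bv u)) = (epsH s H - epsH t H) • A.1 (bv u) :=
      LinearMap.congr_fun (congrArg Subtype.val h1) (bv u)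
    rw [symOp_cartan_apply, map_smul] at h2
    have h3 := DFunLike.congr_fun h2 v
    rw [Finsupp.sub_apply, Finsupp.smul_apply, Finsupp.smul_apply, smul_eq_mul, smul_eq_mul,
      cartan_apply_coord (symOp_mem_cartan i), hH, epsH_symOp, epsH_symOp, epsH_symOp] at h3
    have h4 : (wt v i - wt u i) * (A.1 (bv u)) v = (wt s i - wt t i) * (A.1 (bv u)) v := by
      linear_combination h3
    exact mul_right_cancel₀ h h4
  -- Since `wt u.swap = -wt u`, the equality of roots becomes one of sums, and s ≠ t becomes the
  -- nondegeneracy required by `wt_add_eq`.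
  have key2 : wt v + wt u.swap = wt s + wt t.swap := by
    simpa [sub_eq_add_neg] using key
  rcases wt_add_eq key2 (by simpa using hst) with ⟨h1, h2⟩ | ⟨h1, h2⟩
  · exact Or.inl ⟨h1, Sum.swap_leftInverse.injective h2⟩
  · exact Or.inr ⟨h1, by rw [← h2, Sum.swap_swap]⟩

end RootSpaces

/-! ### Fixed points -/

section FixedPoints

variable {ι : Type}

theorem tWeyl_apply_eq_sum (v : SpV ι) (m : Mono ι) :
    tWeyl v m = v.sum fun s c => c • tGen s m := by
  rw [tWeyl, Finsupp.linearCombination_apply, Finsupp.sum, LinearMap.sum_apply]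
  rfl

/-- All exponents are shifted by the same weight, so distinct monomials cannot cancel; coefficients
can be read off one at a time. -/
theorem repr_tGen (s : ι ⊕ ι) (m : Mono ι) (lam : ι → ℂ) :
    (monoBasis ι).repr (tGen s m) (lam + wt s) = coef s lam * (monoBasis ι).repr m lam := by
  classical
  have : Finsupp.lapply (lam + wt s) ∘ₗ (monoBasis ι).repr.toLinearMap ∘ₗ tGen s =
      coef s lam • (Finsupp.lapply lam ∘ₗ (monoBasis ι).repr.toLinearMap) := by
    refine (monoBasis ι).ext fun nu => ?_
    change (monoBasis ι).repr (tGen s (mono nu)) (lam + wt s) =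
      coef s lam * (monoBasis ι).repr (mono nu) lam
    rw [tGen_mono, map_smul, repr_mono, repr_mono, Finsupp.smul_apply, smul_eq_mul]
    by_cases h : nu = lam
    · subst h; simp
    · rw [Finsupp.single_eq_of_ne (by simpa using Ne.symm h),
        Finsupp.single_eq_of_ne (Ne.symm h), mul_zero, mul_zero]
  exact LinearMap.congr_fun this m

variable (r : ℤ → ℤ → Prop)

/-- The exponents of the monomials which are killed by the root spaces of all positive roots. -/
def IsFixed (lam : ℕ+ → ℂ) : Prop :=
  ∀ s t : Idx, r (toZ s) (toZ t) → tGen s (tGen t.swap (mono lam)) = 0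

variable {r}

theorem toZ_swap (s : Idx) : toZ s.swap = -toZ s := by cases s <;> simp [toZ]

/-- A positive root vector acts by a multiple of x_s x_{-t}, which shifts all exponents by one
weight. A combination of monomials is therefore killed exactly when each monomial occurring in it
is. -/
theorem mem_fixedPts_iff (hr : IsAdmissibleZ2 r) {mu : ℕ+ → ℂ} (Phi : Xsp mu →ₗ[ℂ] Mono ℕ+)
    (hinj : Function.Injective Phi)
    (hrange : LinearMap.range Phi = monoSpan {lam | SimSp lam mu})
    (hPhi : ∀ (A : spInf) m, Phi ⁅A, m⁆ = tSp A.1 (Phi m)) (m : Xsp mu) :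
    m ∈ fixedPts r (Xsp mu) ↔ Phi m ∈ monoSpan {lam | SimSp lam mu ∧ IsFixed r lam} := by
  classical
  constructor
  · intro hm
    rw [mem_monoSpan]
    intro lam hl
    have h1 : Phi m ∈ monoSpan {lam | SimSp lam mu} := hrange ▸ LinearMap.mem_range_self Phi m
    refine ⟨mem_monoSpan.1 h1 lam hl, fun s t hst => ?_⟩
    have hne : s ≠ t := by
      rintro rfl
      exact hr.irrefl _ hst
    have h2 : symOp (bv s) (bv t.swap) ∈ nilPart r :=
      Submodule.mem_iSup_of_mem s (Submodule.mem_iSup_of_mem t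
        (Submodule.mem_iSup_of_mem hst (symOp_mem_rootSpace s t)))
    have h3 := hPhi (symOp (bv s) (bv t.swap)) m
    -- As s ≠ t, the operators x_s and x_{-t} commute, and the symmetrised product is x_s x_{-t}
    -- itself.
    have hom : omega ℕ+ (bv t.swap) (bv s) = 0 := by
      rw [omega_bv_left, Sum.swap_swap, Finsupp.single_eq_of_ne (Ne.symm hne), mul_zero]
    rw [hm _ h2, map_zero, tSp_symOp, tWeyl_comm (bv t.swap), hom, zero_smul, sub_zero,
      ← two_smul ℂ, smul_smul, tWeyl_bv, tWeyl_bv] at h3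
    have h4 : tGen s (tGen t.swap (Phi m)) = 0 := by
      have : (1 / 2 * 2 : ℂ) = 1 := by norm_num
      rw [this, one_smul] at h3
      exact h3.symm
    have h5 := repr_tGen s (tGen t.swap (Phi m)) (lam + wt t.swap)
    rw [h4, map_zero, Finsupp.zero_apply, repr_tGen] at h5
    have h6 : coef t.swap lam * coef s (lam + wt t.swap) = 0 := by
      have h7 : coef t.swap lam * coef s (lam + wt t.swap) *
          (monoBasis ℕ+).repr (Phi m) lam = 0 := by linear_combination -h5
      exact (mul_eq_zero.1 h7).resolve_right hl
    rw [tGen_mono, map_smul, tGen_mono, smul_smul, h6, zero_smul]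
  · intro hm y hy
    have hle : nilPart r ≤ LinearMap.ker ((LieModule.toEnd ℂ spInf (Xsp mu) :
        spInf →ₗ[ℂ] Module.End ℂ (Xsp mu)).flip m) := by
      refine iSup_le fun s => iSup_le fun t => iSup_le fun hst A hA => ?_
      change ⁅A, m⁆ = 0
      apply hinj
      rw [hPhi, map_zero]
      have hne : s ≠ t := by
        rintro rfl
        exact hr.irrefl _ hst
      refine eq_on_monoSpan (f := tSp A.1) (g := 0) (fun lam hl => ?_) hm
      obtain ⟨K, hK⟩ := A.2.1.exists_finset
      rw [tSp_eq_sum K hK, LinearMap.smul_apply, LinearMap.sum_apply, LinearMap.zero_apply]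
      refine smul_eq_zero_of_right _ (Finset.sum_eq_zero fun u _ => ?_)
      rw [Module.End.mul_apply, tWeyl_apply_eq_sum]
      refine Finset.sum_eq_zero fun v hv => ?_
      beta_reduce
      rw [tWeyl_dualBv, LinearMap.smul_apply, map_smul]
      refine smul_eq_zero_of_right _ (smul_eq_zero_of_right _ ?_)
      -- The two possible matrix entries give x_s x_{-t} and x_{-t} x_s; the latter belongs to the
      -- relation -t ≺ -s.
      rcases rootSpace_entry hne hA (Finsupp.mem_support_iff.1 hv) with ⟨rfl, rfl⟩ | ⟨rfl, rfl⟩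
      · exact hl.2 _ _ hst
      · refine hl.2 _ _ ?_
        rw [toZ_swap, toZ_swap]
        exact hr.neg _ _ hst
    exact hle hy

/-! ### A nonzero fixed vector from alignment. -/

theorem rootSpace_le_parabolic (hr : IsAdmissibleZ2 r) {y : spInf} (hy : y ∈ nilPart r) :
    y ∈ parabolic r := by
  have : nilPart r ≤ (parabolic r).toSubmodule := by
    refine iSup_le fun s => iSup_le fun t => iSup_le fun hst A hA => ?_
    refine LieSubalgebra.subset_lieSpan (Or.inr ⟨s, t, ?_, Or.inl hst, hA⟩)
    rintro rfl
    exact hr.irrefl _ hst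
  exact this hy

/-- The elements of U(L) preserving N form a subalgebra containing L, hence everything. -/
theorem env_smul_mem {L : Type} [LieRing L] [LieAlgebra ℂ L] {M : Type} [AddCommGroup M]
    [Module ℂ M] [Module (UniversalEnvelopingAlgebra ℂ L) M]
    [IsScalarTower ℂ (UniversalEnvelopingAlgebra ℂ L) M] (N : Submodule ℂ M)
    (hN : ∀ x : L, ∀ m ∈ N, UniversalEnvelopingAlgebra.ι ℂ x • m ∈ N)
    (u : UniversalEnvelopingAlgebra ℂ L) {m : M} (hm : m ∈ N) : u • m ∈ N := by
  let Sa : Subalgebra ℂ (UniversalEnvelopingAlgebra ℂ L) :=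
    { carrier := {u | ∀ m ∈ N, u • m ∈ N}
      mul_mem' := fun {a b} ha hb m hm => by rw [mul_smul]; exact ha _ (hb _ hm)
      add_mem' := fun {a b} ha hb m hm => by rw [add_smul]; exact N.add_mem (ha _ hm) (hb _ hm)
      algebraMap_mem' := fun c m hm => by
        rw [algebraMap_smul]
        exact N.smul_mem c hm }
  let g : L →ₗ⁅ℂ⁆ Sa :=
    { toFun := fun x => ⟨UniversalEnvelopingAlgebra.ι ℂ x, hN x⟩
      map_add' := fun x y => Subtype.ext (by simp)
      map_smul' := fun c x => Subtype.ext (by simp)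
      map_lie' := fun {x y} => Subtype.ext (by
        simp [LieRing.of_associative_ring_bracket]) }
  -- By the universal property, U(L) → `Sa` → U(L) is the identity because it is so on L; thus every
  -- u lies in `Sa`.
  have h : Sa.val.comp (UniversalEnvelopingAlgebra.lift ℂ g) =
      AlgHom.id ℂ (UniversalEnvelopingAlgebra ℂ L) := by
    apply UniversalEnvelopingAlgebra.hom_ext
    ext x
    simp [g]
  have h2 : u ∈ Sa := by
    have := congrArg (fun F : UniversalEnvelopingAlgebra ℂ L →ₐ[ℂ]
      UniversalEnvelopingAlgebra ℂ L => F u) h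
    simp only [AlgHom.comp_apply, AlgHom.id_apply] at this
    rw [← this]
    exact (UniversalEnvelopingAlgebra.lift ℂ g u).2
  exact h2 m hm

/-- The vectors 1 ⊗ s are killed by u(≺) and generate the induced module, so the surjection onto M ≠
0 cannot kill all of them. -/
theorem IsAligned.exists_ne_zero (hr : IsAdmissibleZ2 r) {M : Type} [AddCommGroup M] [Module ℂ M]
    [LieRingModule spInf M] [LieModule ℂ spInf M] (h : IsAligned r M) :
    ∃ m ∈ fixedPts r M, m ≠ 0 := by
  obtain ⟨hirr, -, S, _, _, _, _, hS, -, -, f, hf⟩ := h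
  by_contra! hcon
  let q : UniversalEnvelopingAlgebra ℂ spInf ⊗[ℂ] S → GenVerma (parabolic r) S :=
    Submodule.Quotient.mk
  have h1 : ∀ s : S, f (q (1 ⊗ₜ s)) = 0 := by
    intro s
    apply hcon
    intro y hy
    rw [← LieModuleHom.map_lie]
    have e : ⁅y, q (1 ⊗ₜ s)⁆ = 0 := by
      have hyp := rootSpace_le_parabolic hr hy
      have e1 : ⁅y, q (1 ⊗ₜ s)⁆ = q (UniversalEnvelopingAlgebra.ι ℂ y • (1 ⊗ₜ s)) := rfl
      have e2 := hS ⟨y, hyp⟩ hy s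
      rw [e1]
      refine (Submodule.Quotient.mk_eq_zero _).2 (Submodule.subset_span
        ⟨1, UniversalEnvelopingAlgebra.ι ℂ ⟨y, hyp⟩, s, ?_⟩)
      rw [envIncl, envAct, UniversalEnvelopingAlgebra.lift_ι_apply,
        UniversalEnvelopingAlgebra.lift_ι_apply, LieModule.toEnd_apply_apply, e2,
        TensorProduct.tmul_zero, sub_zero, one_mul, TensorProduct.smul_tmul', smul_eq_mul, mul_one]
      rfl
    rw [e, map_zero]
  have h2 : ∀ z, f (q z) = 0 := by
    intro z
    induction z using TensorProduct.induction_on with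
    | zero => exact map_zero f
    | add a b ha hb =>
      have : q (a + b) = q a + q b := rfl
      rw [this, map_add, ha, hb, add_zero]
    | tmul u s =>
      have e : q (u ⊗ₜ s) = u • q (1 ⊗ₜ s) := by
        have : u • q (1 ⊗ₜ s) = q (u • (1 ⊗ₜ s)) := rfl
        rw [this, TensorProduct.smul_tmul', smul_eq_mul, mul_one]
      have : q (u ⊗ₜ s) ∈ LinearMap.ker (f : GenVerma (parabolic r) S →ₗ[ℂ] M) := by
        rw [e]
        refine env_smul_mem _ (fun x m hm => ?_) u (h1 s)
        have e3 : f ⁅x, m⁆ = ⁅x, f m⁆ := LieModuleHom.map_lie f x m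
        have hm' : f m = 0 := hm
        rw [hm', lie_zero] at e3
        exact e3
      exact this
  have hnt : Nontrivial M := LieModule.nontrivial_of_isIrreducible ℂ spInf M
  obtain ⟨m, hm⟩ := exists_ne (0 : M)
  obtain ⟨z, rfl⟩ := hf m
  obtain ⟨w, rfl⟩ := Submodule.Quotient.mk_surjective _ z
  exact hm (h2 w)

end FixedPoints

end WeightModules

end

noncomputable section

namespace WeightModules

/-! ### The monomials killed by the positive root vectors -/

/-! ### The order on the classes and its symmetry under negation. -/

section Order

variable {r : ℤ → ℤ → Prop}

theorem self_mem_cls (r : ℤ → ℤ → Prop) (a : ℤ) : a ∈ cls r a := Or.inl rfl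

theorem IsAdmissibleZ2.mem_cls_iff (hr : IsAdmissibleZ2 r) {a b : ℤ} :
    b ∈ cls r a ↔ ¬ r a b ∧ ¬ r b a := by
  constructor
  · rintro (h | h)
    · rw [Set.mem_singleton_iff.1 h]
      exact ⟨hr.irrefl a, hr.irrefl a⟩
    · exact h
  · exact Or.inr

theorem IsAdmissibleZ2.cls_eq (hr : IsAdmissibleZ2 r) {a b c : ℤ} (ha : c ∈ cls r a)
    (hb : c ∈ cls r b) : cls r a = cls r b := by
  by_contra h
  exact Set.disjoint_left.1 (hr.admissible a b h) ha hb

/-- If both relations failed, transitivity would put c in [a] and in [b], so [a] = [b] by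
admissibility, against a ≺ b. This is the form in which the linear order of the classes is used. -/
theorem IsAdmissibleZ2.or_of_rel (hr : IsAdmissibleZ2 r) {a b : ℤ} (h : r a b) (c : ℤ) :
    r a c ∨ r c b := by
  by_contra! hc
  have h1 : c ∈ cls r a := hr.mem_cls_iff.2 ⟨hc.1, fun h' => hc.2 (hr.trans _ _ _ h' h)⟩
  have h2 : c ∈ cls r b := hr.mem_cls_iff.2 ⟨fun h' => hc.1 (hr.trans _ _ _ h h'), hc.2⟩
  have h3 := self_mem_cls r b
  rw [← hr.cls_eq h1 h2] at h3
  exact (hr.mem_cls_iff.1 h3).1 h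

theorem IsAdmissibleZ2.neg_iff (hr : IsAdmissibleZ2 r) {a b : ℤ} : r (-a) (-b) ↔ r b a :=
  ⟨fun h => by simpa using hr.neg _ _ h, hr.neg _ _⟩

theorem IsAdmissibleZ2.neg_mem_cls_iff (hr : IsAdmissibleZ2 r) {a b : ℤ} :
    -b ∈ cls r (-a) ↔ b ∈ cls r a := by
  rw [hr.mem_cls_iff, hr.mem_cls_iff, hr.neg_iff, hr.neg_iff, and_comm]

theorem IsAdmissibleZ2.neg_rel_zero (hr : IsAdmissibleZ2 r) {a : ℤ} : r (-a) 0 ↔ r 0 a := by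
  simpa using hr.neg_iff (a := a) (b := 0)

theorem IsAdmissibleZ2.zero_rel_neg (hr : IsAdmissibleZ2 r) {a : ℤ} : r 0 (-a) ↔ r a 0 := by
  simpa using hr.neg_iff (a := 0) (b := a)

theorem IsAdmissibleZ2.asymm (hr : IsAdmissibleZ2 r) {a b : ℤ} (h : r a b) : ¬ r b a :=
  fun h' => hr.irrefl _ (hr.trans _ _ _ h h')

theorem IsAdmissibleZ2.swap_rel_zero (hr : IsAdmissibleZ2 r) {s : Idx} :
    r (toZ s.swap) 0 ↔ r 0 (toZ s) := by
  rw [toZ_swap, hr.neg_rel_zero]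

theorem IsAdmissibleZ2.rel_zero_of_mem_cls (hr : IsAdmissibleZ2 r) {a b : ℤ} (ha : r a 0)
    (hb : b ∈ cls r a) : r b 0 :=
  (hr.or_of_rel ha b).resolve_left (hr.mem_cls_iff.1 hb).1

theorem IsAdmissibleZ2.zero_rel_of_mem_cls (hr : IsAdmissibleZ2 r) {a b : ℤ} (ha : r 0 a)
    (hb : b ∈ cls r a) : r 0 b :=
  (hr.or_of_rel ha b).resolve_right (hr.mem_cls_iff.1 hb).2

theorem IsMaxBelow.of_mem_cls (hr : IsAdmissibleZ2 r) {a b : ℤ} (ha : IsMaxBelow r a)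
    (hb : b ∈ cls r a) : IsMaxBelow r b :=
  ⟨hr.rel_zero_of_mem_cls ha.1 hb, fun j hj hbj =>
    (hr.or_of_rel hbj a).elim (hr.mem_cls_iff.1 hb).2 (ha.2 j hj)⟩

theorem IsMaxBelow.mem_cls (hr : IsAdmissibleZ2 r) {a b : ℤ} (ha : IsMaxBelow r a)
    (hb : IsMaxBelow r b) : b ∈ cls r a :=
  hr.mem_cls_iff.2 ⟨ha.2 b hb.1, hb.2 a ha.1⟩

/-- With this, classes above and below [0] are treated together through signed indices s ≺ 0. -/
theorem isMinAbove_iff (hr : IsAdmissibleZ2 r) {a : ℤ} : IsMinAbove r a ↔ IsMaxBelow r (-a) := by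
  constructor
  · rintro ⟨h1, h2⟩
    refine ⟨hr.neg_rel_zero.2 h1, fun j hj h => h2 (-j) (hr.zero_rel_neg.2 hj) ?_⟩
    simpa using hr.neg _ _ h
  · rintro ⟨h1, h2⟩
    refine ⟨hr.neg_rel_zero.1 h1, fun j hj h => h2 (-j) (hr.neg_rel_zero.2 hj) ?_⟩
    exact hr.neg _ _ h

theorem toZ_ne_zero (s : Idx) : toZ s ≠ 0 := by
  cases s <;> simp [toZ]

theorem exists_toZ {a : ℤ} (ha : a ≠ 0) : ∃ s : Idx, toZ s = a := by
  rcases lt_or_gt_of_ne ha with h | h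
  · exact ⟨Sum.inr ⟨(-a).toNat, by omega⟩, by change -(((-a).toNat : ℕ) : ℤ) = a; omega⟩
  · exact ⟨Sum.inl ⟨a.toNat, by omega⟩, Int.toNat_of_nonneg h.le⟩

theorem rel_or_rel_of_cls_eq (h0 : cls r 0 = {0}) {a : ℤ} (ha : a ≠ 0) : r a 0 ∨ r 0 a := by
  by_contra! h
  have : a ∈ cls r 0 := Or.inr ⟨h.2, h.1⟩
  rw [h0] at this
  exact ha this

end Order

/-! ### Vacuum monomials and monomials with one defect. -/

section Fixed

variable {r : ℤ → ℤ → Prop}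

theorem tGen_tGen_eq_zero_iff {ι : Type} {s t : ι ⊕ ι} {lam : ι → ℂ} :
    tGen s (tGen t (mono lam)) = 0 ↔ coef t lam = 0 ∨ coef s (lam + wt t) = 0 := by
  rw [tGen_mono, map_smul, tGen_mono, smul_smul, smul_eq_zero_iff_left (mono_ne_zero _),
    mul_eq_zero]

theorem tGen_mono_eq_zero {ι : Type} {s : ι ⊕ ι} {lam : ι → ℂ} (h : coef s lam = 0) :
    tGen s (mono lam) = 0 := by
  rw [tGen_mono, h, zero_smul]

/-- Unless t = -s the operators commute, so the one that kills the monomial may act first. -/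
theorem tGen_tGen_eq_zero_of_coef {ι : Type} {s t : ι ⊕ ι} (hst : t ≠ s.swap) {lam : ι → ℂ}
    (h : coef s lam = 0) : tGen s (tGen t (mono lam)) = 0 := by
  have hc : tGen s * tGen t = tGen t * tGen s := by
    by_cases hp : pos t = pos s
    · rcases eq_or_eq_swap_of_pos hp with h | h
      · rw [h]
      · exact absurd h hst
    · exact tGen_comm_of_pos_ne (Ne.symm hp)
  rw [← Module.End.mul_apply, hc, Module.End.mul_apply, tGen_mono_eq_zero h, map_zero]

/-- The monomial `x ^ lam` is killed by all `x_s` with `s ≺ 0`, where `x_{-i} = ∂_i`. -/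
def IsVacuum (r : ℤ → ℤ → Prop) (lam : ℕ+ → ℂ) : Prop :=
  ∀ s : Idx, r (toZ s) 0 → coef s lam = 0

theorem coef_inl_eq_zero {ι : Type} {i : ι} {lam : ι → ℂ} :
    coef (Sum.inl i) lam = 0 ↔ lam i = -1 := by
  simp [coef]

theorem coef_inr {ι : Type} {i : ι} {lam : ι → ℂ} : coef (Sum.inr i) lam = lam i := rfl

theorem isVacuum_iff (hr : IsAdmissibleZ2 r) {lam : ℕ+ → ℂ} :
    IsVacuum r lam ↔ (∀ i : ℕ+, r i 0 → lam i = -1) ∧ (∀ i : ℕ+, r 0 i → lam i = 0) := by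
  constructor
  · intro h
    exact ⟨fun i hi => coef_inl_eq_zero.1 (h (Sum.inl i) hi),
      fun i hi => h (Sum.inr i) (hr.neg_rel_zero.2 hi)⟩
  · rintro ⟨h1, h2⟩ (i | i) hs
    · exact coef_inl_eq_zero.2 (h1 i hs)
    · exact h2 i (hr.neg_rel_zero.1 hs)

theorem mem_RSet_iff (hr : IsAdmissibleZ2 r) {mu lam : ℕ+ → ℂ} :
    lam ∈ RSet r mu ↔ SimSp lam mu ∧ IsVacuum r lam := by
  rw [isVacuum_iff hr]
  exact ⟨fun h => ⟨h.2.2, h.1, h.2.1⟩, fun h => ⟨h.2.1, h.2.2, h.1⟩⟩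

/-- If s ≺ t, then s ≺ 0 or -t ≺ 0, so one factor of x_s x_{-t} kills the monomial. -/
theorem IsVacuum.isFixed (hr : IsAdmissibleZ2 r) {lam : ℕ+ → ℂ} (h : IsVacuum r lam) :
    IsFixed r lam := by
  intro s t hst
  rcases hr.or_of_rel hst 0 with h0 | h0
  · refine tGen_tGen_eq_zero_of_coef (fun he => ?_) (h s h0)
    rw [Sum.swap_leftInverse.injective he] at hst
    exact hr.irrefl _ hst
  · exact tGen_tGen_eq_zero_iff.2 (Or.inl (h _ (hr.swap_rel_zero.2 h0)))

theorem pos_ne_of_rel_zero (hr : IsAdmissibleZ2 r) {s t : Idx} (hs : r (toZ s) 0)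
    (ht : r (toZ t) 0) (hst : s ≠ t) : pos s ≠ pos t := by
  intro h
  rcases eq_or_eq_swap_of_pos h with h | h
  · exact hst h
  · rw [h, hr.swap_rel_zero] at hs
    exact hr.asymm hs ht

/-- For s, t ≺ 0 one has s ≺ -t, so x_s x_t kills x^λ. If s ≠ t, the two factors act at different
places, and one of them must kill it alone. -/
theorem IsFixed.eq_of_coef_ne_zero (hr : IsAdmissibleZ2 r) {lam : ℕ+ → ℂ} (h : IsFixed r lam)
    {s t : Idx} (hs : r (toZ s) 0) (hs' : coef s lam ≠ 0) (ht : r (toZ t) 0)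
    (ht' : coef t lam ≠ 0) : s = t := by
  by_contra hst
  have h1 : r (toZ s) (toZ t.swap) := by
    rw [toZ_swap]
    exact hr.trans _ _ _ hs (hr.zero_rel_neg.2 ht)
  have h2 := h s t.swap h1
  rw [Sum.swap_swap, tGen_tGen_eq_zero_iff, coef_add_wt (pos_ne_of_rel_zero hr hs ht hst)] at h2
  exact h2.elim ht' hs'

/-- Take u ≠ 0 in [0]; then -u is in [0] too. If s ≺ 0, then s ≺ ±u, so x_s x_{-u} and x_s x_u kill
x^λ. Were x_s not to kill it, both x_u and x_{-u} would. -/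
theorem IsFixed.isVacuum (hr : IsAdmissibleZ2 r) {lam : ℕ+ → ℂ} (h : IsFixed r lam)
    (h0 : cls r 0 ≠ {0}) : IsVacuum r lam := by
  obtain ⟨a, ha, ha0⟩ : ∃ a ∈ cls r 0, a ≠ 0 := by
    by_contra! hc
    exact h0 (Set.eq_singleton_iff_unique_mem.2 ⟨self_mem_cls r 0, hc⟩)
  obtain ⟨u, rfl⟩ := exists_toZ ha0
  have hu' : toZ u.swap ∈ cls r 0 := by
    have := hr.neg_mem_cls_iff.2 ha
    rwa [neg_zero, ← toZ_swap] at this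
  intro s hs
  by_contra hc
  have key : ∀ v : Idx, toZ v ∈ cls r 0 → coef v.swap lam = 0 := by
    intro v hv
    have hsv : r (toZ s) (toZ v) :=
      (hr.or_of_rel hs (toZ v)).resolve_right (hr.mem_cls_iff.1 hv).2
    have hp : pos s ≠ pos v.swap := by
      intro hp
      have hv' : toZ v.swap ∈ cls r 0 := by
        have := hr.neg_mem_cls_iff.2 hv
        rwa [neg_zero, ← toZ_swap] at this
      rcases eq_or_eq_swap_of_pos hp with rfl | rfl
      · exact (hr.mem_cls_iff.1 hv').2 hs
      · rw [Sum.swap_swap] at hs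
        exact (hr.mem_cls_iff.1 hv).2 hs
    have h2 := h s v hsv
    rw [tGen_tGen_eq_zero_iff, coef_add_wt hp] at h2
    exact h2.resolve_right hc
  have k1 := key u ha
  have k2 := key u.swap hu'
  rw [Sum.swap_swap] at k2
  -- Being killed by x_i means exponent -1, by ∂_i exponent 0; these exclude each other.
  rcases u with i | i
  · rw [coef_inl_eq_zero] at k2
    rw [Sum.swap_inl, coef_inr, k2] at k1
    norm_num at k1
  · rw [Sum.swap_inr, coef_inl_eq_zero] at k1
    rw [coef_inr, k1] at k2
    norm_num at k2

/-- Let s ≺ 0 with x_s x^λ ≠ 0. If s ≺ a ≺ 0, then x_s x_{-a} kills x^λ, hence x_{-a} does, hence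
x_a does not, contradicting the uniqueness of s. So [s] is maximal. Moreover s ≺ -s gives x_s² x^λ =
0, so x_s x^λ is a multiple of a vacuum. -/
theorem IsFixed.exists_defect (hr : IsAdmissibleZ2 r) {lam : ℕ+ → ℂ} (h : IsFixed r lam)
    (hv : ¬ IsVacuum r lam) : ∃ s : Idx, IsMaxBelow r (toZ s) ∧ IsVacuum r (lam + wt s) := by
  unfold IsVacuum at hv
  push Not at hv
  obtain ⟨s, hs, hc⟩ := hv
  refine ⟨s, ⟨hs, fun a ha hsa => ?_⟩, fun t ht => ?_⟩
  · have ha0 : a ≠ 0 := by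
      rintro rfl
      exact hr.irrefl _ ha
    obtain ⟨u, rfl⟩ := exists_toZ ha0
    have hsu : s ≠ u := by
      rintro rfl
      exact hr.irrefl _ hsa
    have hp := pos_ne_of_rel_zero hr hs ha hsu
    have h1 := h s u hsa
    rw [tGen_tGen_eq_zero_iff, coef_add_wt (by simpa using hp)] at h1
    have h2 := h1.resolve_right hc
    by_cases h3 : coef u lam = 0
    · rcases u with i | i
      · rw [coef_inl_eq_zero] at h3
        rw [Sum.swap_inl, coef_inr, h3] at h2
        norm_num at h2
      · rw [coef_inr] at h3
        rw [Sum.swap_inr, coef_inl_eq_zero, h3] at h2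
        norm_num at h2
    · exact hsu (h.eq_of_coef_ne_zero hr hs hc ha h3)
  · by_cases hst : t = s
    · subst hst
      have h1 : r (toZ t) (toZ t.swap) := by
        rw [toZ_swap]
        exact hr.trans _ _ _ hs (hr.zero_rel_neg.2 hs)
      have h2 := h t t.swap h1
      rw [Sum.swap_swap, tGen_tGen_eq_zero_iff] at h2
      exact h2.resolve_left hc
    · rw [coef_add_wt (pos_ne_of_rel_zero hr ht hs hst)]
      by_contra h3
      exact hst (h.eq_of_coef_ne_zero hr ht h3 hs hc)

/-! #### The case `[0] = {0}` -/

theorem omPlus_isVacuum (hr : IsAdmissibleZ2 r) : IsVacuum r (omPlus r) := by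
  refine (isVacuum_iff hr).2 ⟨fun i hi => ?_, fun i hi => ?_⟩
  · simp [omPlus, hi]
  · simp [omPlus, hr.asymm hi]

/-- Every i > 0 now lies strictly below or above 0, so the vacuum condition prescribes all entries.
-/
theorem IsVacuum.eq_omPlus (hr : IsAdmissibleZ2 r) (h0 : cls r 0 = {0}) {lam : ℕ+ → ℂ}
    (h : IsVacuum r lam) : lam = omPlus r := by
  have h1 := (isVacuum_iff hr).1 h
  have h2 := (isVacuum_iff hr).1 (omPlus_isVacuum hr)
  funext i
  rcases rel_or_rel_of_cls_eq h0 (toZ_ne_zero (Sum.inl i)) with hi | hi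
  · rw [h1.1 i hi, h2.1 i hi]
  · rw [h1.2 i hi, h2.2 i hi]

theorem omMinus_eq_omPlus (hr : IsAdmissibleZ2 r) (h0 : cls r 0 = {0}) :
    omMinus r = omPlus r := by
  refine IsVacuum.eq_omPlus hr h0 ((isVacuum_iff hr).2 ⟨fun i hi => ?_, fun i hi => ?_⟩)
  · simp [omMinus, hr.asymm hi]
  · simp [omMinus, hi]

theorem coef_omPlus_sub (hr : IsAdmissibleZ2 r) {s t : Idx} (hs : r (toZ s) 0)
    (ht : r (toZ t) 0) (hst : t ≠ s) : coef t (omPlus r - wt s) = 0 := by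
  rw [sub_eq_add_neg, ← wt_swap, coef_add_wt (by simpa using pos_ne_of_rel_zero hr ht hs hst)]
  exact omPlus_isVacuum hr t ht

theorem coef_omPlus_sub_self (hr : IsAdmissibleZ2 r) {s : Idx} (hs : r (toZ s) 0) :
    coef s (omPlus r - wt s) = 1 := by
  have h := omPlus_isVacuum hr s hs
  rcases s with i | i
  · rw [coef_inl_eq_zero] at h
    simp [coef, wt, h]
  · rw [coef_inr] at h
    simp [coef, wt, h]

theorem coef_swap_omPlus (hr : IsAdmissibleZ2 r) {s : Idx} (hs : r (toZ s) 0) :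
    coef s.swap (omPlus r) = -sgn s := by
  have h := omPlus_isVacuum hr s hs
  rcases s with i | i
  · rw [coef_inl_eq_zero] at h
    simp [coef, sgn, h]
  · rw [coef_inr] at h
    simp [coef, sgn, h]

/-- Among the indices below 0 only s fails to kill this monomial, and x_s turns it into the vacuum.
Maximality of [s] ensures that in each x_p x_{-q} with p ≺ q either a killing factor occurs or the
product is x_s². -/
theorem isFixed_omPlus_sub (hr : IsAdmissibleZ2 r) (h0 : cls r 0 = {0}) {s : Idx}
    (hs : IsMaxBelow r (toZ s)) : IsFixed r (omPlus r - wt s) := by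
  intro p q hpq
  have hne : q.swap ≠ p.swap := fun he => by
    rw [Sum.swap_leftInverse.injective he] at hpq
    exact hr.irrefl _ hpq
  by_cases hp : r (toZ p) 0
  · by_cases hps : p = s
    · subst hps
      have hq : r 0 (toZ q) :=
        (rel_or_rel_of_cls_eq h0 (toZ_ne_zero q)).resolve_left fun hq => hs.2 _ hq hpq
      rw [tGen_tGen_eq_zero_iff]
      by_cases hqp : q.swap = p
      · right
        rw [hqp, sub_add_cancel]
        exact omPlus_isVacuum hr p hp
      · exact Or.inl (coef_omPlus_sub hr hp (hr.swap_rel_zero.2 hq) hqp)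
    · exact tGen_tGen_eq_zero_of_coef hne (coef_omPlus_sub hr hs.1 hp hps)
  · have hp' := (rel_or_rel_of_cls_eq h0 (toZ_ne_zero p)).resolve_left hp
    have hq := hr.trans _ _ _ hp' hpq
    refine tGen_tGen_eq_zero_iff.2 (Or.inl (coef_omPlus_sub hr hs.1 (hr.swap_rel_zero.2 hq) ?_))
    -- Here 0 ≺ p ≺ q; if s were -q, then s ≺ -p ≺ 0 would contradict maximality.
    rintro rfl
    refine hs.2 _ (hr.swap_rel_zero.2 hp') ?_
    rw [toZ_swap, toZ_swap]
    exact hr.neg _ _ hpq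

theorem wt_eq_single {ι : Type} (s : ι ⊕ ι) :
    ∃ e : ℤ, (e = 1 ∨ e = -1) ∧ ∀ i, wt s i = (Finsupp.single (pos s) e : ι →₀ ℤ) i := by
  classical
  rcases s with j | j
  · refine ⟨1, Or.inl rfl, fun i => ?_⟩
    by_cases h : i = j
    · subst h; simp [wt, pos]
    · simp [wt, pos, eps_ne h, Finsupp.single_eq_of_ne h]
  · refine ⟨-1, Or.inr rfl, fun i => ?_⟩
    by_cases h : i = j
    · subst h; simp [wt, pos]
    · simp [wt, pos, eps_ne h, Finsupp.single_eq_of_ne h]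

theorem wt_not_mem_rootLatticeSp {ι : Type} (s : ι ⊕ ι) : wt s ∉ rootLatticeSp ι := by
  rintro ⟨f, hf, he⟩
  obtain ⟨e, h1, h2⟩ := wt_eq_single s
  have : f = Finsupp.single (pos s) e := by
    ext i
    exact Int.cast_injective ((hf i).symm.trans (h2 i))
  rw [this, Finsupp.sum_single_index rfl] at he
  rcases h1 with rfl | rfl <;> revert he <;> decide

theorem wt_add_wt_mem_rootLatticeSp {ι : Type} (s t : ι ⊕ ι) : wt s + wt t ∈ rootLatticeSp ι := by
  classical
  obtain ⟨e, h1, h2⟩ := wt_eq_single s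
  obtain ⟨e', h1', h2'⟩ := wt_eq_single t
  refine ⟨Finsupp.single (pos s) e + Finsupp.single (pos t) e', fun i => by
    rw [Pi.add_apply, h2, h2', Finsupp.add_apply, Int.cast_add], ?_⟩
  rw [Finsupp.sum_add_index' (by simp) (by simp), Finsupp.sum_single_index rfl,
    Finsupp.sum_single_index rfl]
  rcases h1 with rfl | rfl <;> rcases h1' with rfl | rfl <;> decide

theorem intPlus_omPlus_sub (hr : IsAdmissibleZ2 r) {s : Idx} (hs : r (toZ s) 0) :
    IntPlus (omPlus r - wt s) = IntPlus (omPlus r) := by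
  have h := omPlus_isVacuum hr s hs
  rcases s with i | i
  · rw [coef_inl_eq_zero] at h
    exact intPlus_sub_eq _ _ (by rw [h]; norm_num)
  · rw [coef_inr] at h
    have := intPlus_add_eq (omPlus r) i (by rw [h]; norm_num)
    simpa [wt] using this

theorem simSp_omPlus_sub (hr : IsAdmissibleZ2 r) {s t : Idx} (hs : r (toZ s) 0)
    (ht : r (toZ t) 0) : SimSp (omPlus r - wt s) (omPlus r - wt t) := by
  refine ⟨?_, by rw [intPlus_omPlus_sub hr hs, intPlus_omPlus_sub hr ht]⟩
  have := wt_add_wt_mem_rootLatticeSp s.swap t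
  rw [wt_swap] at this
  convert this using 1
  abel

/-- The difference has odd sum; this parity keeps vacua and defects in different classes. -/
theorem not_simSp_omPlus_sub {s : Idx} : ¬ SimSp (omPlus r - wt s) (omPlus r) := by
  intro h
  have h1 := h.1
  rw [show omPlus r - wt s - omPlus r = wt s.swap by rw [wt_swap]; abel] at h1
  exact wt_not_mem_rootLatticeSp _ h1

theorem IsFixed.eq_or (hr : IsAdmissibleZ2 r) (h0 : cls r 0 = {0}) {lam : ℕ+ → ℂ}
    (h : IsFixed r lam) :
    lam = omPlus r ∨ ∃ s : Idx, IsMaxBelow r (toZ s) ∧ lam = omPlus r - wt s := by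
  by_cases hv : IsVacuum r lam
  · exact Or.inl (hv.eq_omPlus hr h0)
  · obtain ⟨s, hs, hs'⟩ := h.exists_defect hr hv
    exact Or.inr ⟨s, hs, eq_sub_of_add_eq (hs'.eq_omPlus hr h0)⟩

/-- One vacuum in the class of μ excludes defects: for [0] ≠ {0} there are none at all, and for [0]
= {0} they have the wrong parity. -/
theorem fixed_eq_of_mem_RSet (hr : IsAdmissibleZ2 r) {mu om : ℕ+ → ℂ} (hom : om ∈ RSet r mu) :
    {lam | SimSp lam mu ∧ IsFixed r lam} = {lam | SimSp lam mu ∧ IsVacuum r lam} := by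
  ext lam
  refine and_congr_right fun hl => ⟨fun h => ?_, fun h => h.isFixed hr⟩
  by_cases h0 : cls r 0 = {0}
  · rcases h.eq_or hr h0 with rfl | ⟨s, hs, rfl⟩
    · exact omPlus_isVacuum hr
    · obtain ⟨h1, h2⟩ := (mem_RSet_iff hr).1 hom
      rw [h2.eq_omPlus hr h0] at h1
      exact absurd (hl.trans h1.symm) not_simSp_omPlus_sub
  · exact h.isVacuum hr h0

theorem fixed_eq_of_simSp_omPlus (hr : IsAdmissibleZ2 r) (h0 : cls r 0 = {0}) {mu : ℕ+ → ℂ}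
    (hmu : SimSp mu (omPlus r)) : {lam | SimSp lam mu ∧ IsFixed r lam} = {omPlus r} := by
  rw [fixed_eq_of_mem_RSet hr ((mem_RSet_iff hr).2 ⟨hmu.symm, omPlus_isVacuum hr⟩)]
  ext lam
  refine ⟨fun h => h.2.eq_omPlus hr h0, fun h => ?_⟩
  rw [Set.mem_singleton_iff.1 h]
  exact ⟨hmu.symm, omPlus_isVacuum hr⟩

theorem fixed_eq_of_simSp_omPlus_sub (hr : IsAdmissibleZ2 r) (h0 : cls r 0 = {0})
    {mu : ℕ+ → ℂ} {s : Idx} (hs : IsMaxBelow r (toZ s)) (hmu : SimSp mu (omPlus r - wt s)) :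
    {lam | SimSp lam mu ∧ IsFixed r lam} = (fun t => omPlus r - wt t) '' clsIdx r (toZ s) := by
  ext lam
  constructor
  · rintro ⟨h1, h2⟩
    rcases h2.eq_or hr h0 with rfl | ⟨t, ht, rfl⟩
    · exact absurd (h1.trans hmu).symm not_simSp_omPlus_sub
    · exact ⟨t, hs.mem_cls hr ht, rfl⟩
  · rintro ⟨t, ht, rfl⟩
    have ht' := hs.of_mem_cls hr ht
    exact ⟨(simSp_omPlus_sub hr ht'.1 hs.1).trans hmu.symm, isFixed_omPlus_sub hr h0 ht'⟩

end Fixed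

end WeightModules

end

noncomputable section

namespace WeightModules

/-! ### Transfer between spaces of monomials -/

section Transfer

/-- A rescaled matching of two families of monomials; the inverse matching `T'` shows that it is
injective on their span. The scalars c leave room for the signs of the symplectic form. -/
theorem exists_transfer {κ ι₁ ι₂ : Type} {eta : κ → ι₁ → ℂ} {theta : κ → ι₂ → ℂ} {c : κ → ℂ}
    (heta : Function.Injective eta) (htheta : Function.Injective theta) (hc : ∀ k, c k ≠ 0) :
    ∃ T : Mono ι₁ →ₗ[ℂ] Mono ι₂, (∀ k, T (mono (eta k)) = c k • mono (theta k)) ∧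
      (∀ S : Set κ, (monoSpan (eta '' S)).map T = monoSpan (theta '' S)) ∧
      ∀ x ∈ monoSpan (Set.range eta), T x = 0 → x = 0 := by
  classical
  let T : Mono ι₁ →ₗ[ℂ] Mono ι₂ := (monoBasis ι₁).constr ℂ
    (Function.extend eta (fun k => c k • mono (theta k)) 0)
  let T' : Mono ι₂ →ₗ[ℂ] Mono ι₁ := (monoBasis ι₂).constr ℂ
    (Function.extend theta (fun k => (c k)⁻¹ • mono (eta k)) 0)
  have hT : ∀ k, T (mono (eta k)) = c k • mono (theta k) := fun k =>
    ((monoBasis ι₁).constr_basis ℂ _ _).trans (heta.extend_apply _ _ _)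
  have hT' : ∀ k, T' (mono (theta k)) = (c k)⁻¹ • mono (eta k) := fun k =>
    ((monoBasis ι₂).constr_basis ℂ _ _).trans (htheta.extend_apply _ _ _)
  refine ⟨T, hT, fun S => ?_, fun x hx h0 => ?_⟩
  · rw [monoSpan, Submodule.map_span]
    apply le_antisymm
    · rw [Submodule.span_le]
      rintro _ ⟨_, ⟨_, ⟨k, hk, rfl⟩, rfl⟩, rfl⟩
      rw [hT]
      exact Submodule.smul_mem _ _ (mono_mem_monoSpan ⟨k, hk, rfl⟩)
    · rw [monoSpan, Submodule.span_le]
      rintro _ ⟨_, ⟨k, hk, rfl⟩, rfl⟩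
      have h1 : T (mono (eta k)) ∈ Submodule.span ℂ (T '' (mono '' (eta '' S))) :=
        Submodule.subset_span ⟨_, ⟨_, ⟨k, hk, rfl⟩, rfl⟩, rfl⟩
      have h2 := Submodule.smul_mem _ (c k)⁻¹ h1
      rwa [hT, smul_smul, inv_mul_cancel₀ (hc k), one_smul] at h2
  · have h1 : (T' ∘ₗ T) x = LinearMap.id (R := ℂ) x := by
      refine eq_on_monoSpan (fun lam hl => ?_) hx
      obtain ⟨k, rfl⟩ := hl
      rw [LinearMap.comp_apply, hT, map_smul, hT', smul_smul, mul_inv_cancel₀ (hc k), one_smul,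
        LinearMap.id_apply]
    rw [LinearMap.comp_apply, h0, map_zero] at h1
    exact h1.symm

theorem exists_equiv_of_transfer {X₁ X₂ A B : Type} [AddCommGroup X₁] [Module ℂ X₁]
    [AddCommGroup X₂] [Module ℂ X₂] [AddCommGroup A] [Module ℂ A] [AddCommGroup B] [Module ℂ B]
    (Phi₁ : X₁ →ₗ[ℂ] A) (h₁ : Function.Injective Phi₁) (Phi₂ : X₂ →ₗ[ℂ] B)
    (h₂ : Function.Injective Phi₂) (T : A →ₗ[ℂ] B)
    (hT : ∀ x ∈ LinearMap.range Phi₁, T x = 0 → x = 0)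
    (hrange : (LinearMap.range Phi₁).map T = LinearMap.range Phi₂) :
    ∃ psi : X₁ ≃ₗ[ℂ] X₂, ∀ x, Phi₂ (psi x) = T (Phi₁ x) := by
  have hinj : Function.Injective (T ∘ₗ Phi₁) := by
    rw [← LinearMap.ker_eq_bot, LinearMap.ker_eq_bot']
    intro x hx
    exact h₁ (by rw [hT _ ⟨x, rfl⟩ hx, map_zero])
  have hr : LinearMap.range (T ∘ₗ Phi₁) = LinearMap.range Phi₂ := by
    rw [LinearMap.range_comp, hrange]
  let e₁ := LinearEquiv.ofInjective (T ∘ₗ Phi₁) hinj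
  let e₂ := LinearEquiv.ofInjective Phi₂ h₂
  refine ⟨e₁.trans ((LinearEquiv.ofEq _ _ hr).trans e₂.symm), fun x => ?_⟩
  have h3 : e₂ (e₂.symm (LinearEquiv.ofEq _ _ hr (e₁ x))) = LinearEquiv.ofEq _ _ hr (e₁ x) :=
    e₂.apply_symm_apply _
  exact congrArg Subtype.val h3

theorem range_comp_subtype_fixedPts {r : ℤ → ℤ → Prop} (hr : IsAdmissibleZ2 r) {mu : ℕ+ → ℂ}
    (Phi : Xsp mu →ₗ[ℂ] Mono ℕ+) (hinj : Function.Injective Phi)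
    (hrange : LinearMap.range Phi = monoSpan {lam | SimSp lam mu})
    (hPhi : ∀ (A : spInf) m, Phi ⁅A, m⁆ = tSp A.1 (Phi m)) :
    LinearMap.range (Phi ∘ₗ (fixedPts r (Xsp mu)).subtype) =
      monoSpan {lam | SimSp lam mu ∧ IsFixed r lam} := by
  apply le_antisymm
  · rintro _ ⟨x, rfl⟩
    exact (mem_fixedPts_iff hr Phi hinj hrange hPhi x.1).1 x.2
  · intro y hy
    have h1 : y ∈ LinearMap.range Phi := by
      rw [hrange]
      exact monoSpan_mono (fun lam hl => hl.1) hy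
    obtain ⟨x, rfl⟩ := h1
    exact ⟨⟨x, (mem_fixedPts_iff hr Phi hinj hrange hPhi x).2 hy⟩, rfl⟩

theorem tWeyl_incV {ι : Type} {J : Set (ι ⊕ ι)} (v : J →₀ ℂ) (m : Mono ι) :
    tWeyl (incV J v) m = v.sum fun l c => c • tGen l.1 m := by
  classical
  rw [tWeyl_apply_eq_sum]
  exact Finsupp.sum_mapDomain_index (h := fun s c => c • tGen s m) (fun _ => zero_smul _ _)
    (fun _ _ _ => add_smul _ _ _)

/-- Each term of the action has one factor x_s and one factor x_{-s'} with s, s' in J. By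
`slIncl_action` the factor known to vanish can be applied first. -/
theorem slIncl_eq_zero {ι : Type} {J : Set (ι ⊕ ι)} {M : Type} [AddCommGroup M] [Module ℂ M]
    [LieRingModule (sp ι) M] [LieModule ℂ (sp ι) M] (Phi : M →ₗ[ℂ] Mono ι)
    (hinj : Function.Injective Phi) (hPhi : ∀ (A : sp ι) m, Phi ⁅A, m⁆ = tSp A.1 (Phi m))
    (B : sl J) {E : Set (ι → ℂ)} {m : M} (hm : Phi m ∈ monoSpan E)
    (h : (∀ s ∈ J, ∀ lam ∈ E, coef s lam = 0) ∨ (∀ s ∈ J, ∀ lam ∈ E, coef s.swap lam = 0)) :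
    ⁅slIncl J B, m⁆ = 0 := by
  classical
  obtain ⟨K, hK⟩ := B.2.1.exists_finset
  obtain ⟨h1, h2⟩ := slIncl_action Phi hPhi B K hK m
  apply hinj
  rw [map_zero]
  rcases h with h | h
  · rw [h1]
    refine Finset.sum_eq_zero fun j _ => ?_
    rw [tWeyl_incV, Finsupp.sum, Finset.sum_eq_zero, map_zero]
    intro l _
    have : tGen l.1 (Phi m) = 0 :=
      eq_on_monoSpan (f := tGen l.1) (g := 0) (fun lam hl => tGen_mono_eq_zero (h _ l.2 lam hl)) hm
    rw [this, smul_zero]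
  · rw [h2]
    refine Finset.sum_eq_zero fun j _ => ?_
    have : tGen j.1.swap (Phi m) = 0 :=
      eq_on_monoSpan (f := tGen j.1.swap) (g := 0)
        (fun lam hl => tGen_mono_eq_zero (h _ j.2 lam hl)) hm
    rw [tWeyl_dualBv, LinearMap.smul_apply, this, smul_zero, map_zero]

end Transfer

/-! ### The component `sp([0])` -/

section Extension

variable {ι : Type} (Z : Set ι)

open Classical in
/-- The extension of a sequence over `Z` by the entries of `om`. -/
def extSeq (om : ι → ℂ) (eta : Z → ℂ) : ι → ℂ :=
  fun i => if h : i ∈ Z then eta ⟨i, h⟩ else om i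

theorem extSeq_val (om : ι → ℂ) (eta : Z → ℂ) (i : Z) : extSeq Z om eta i = eta i := by
  simp [extSeq]

theorem extSeq_of_notMem (om : ι → ℂ) (eta : Z → ℂ) {i : ι} (h : i ∉ Z) :
    extSeq Z om eta i = om i := by
  simp [extSeq, h]

theorem extSeq_injective (om : ι → ℂ) : Function.Injective (extSeq Z om) := by
  intro a b h
  funext i
  rw [← extSeq_val Z om a, h, extSeq_val]

/-- The embedding of indices. -/
abbrev embIdx : Z ⊕ Z → ι ⊕ ι := Sum.map Subtype.val Subtype.val

theorem extSeq_add_wt (om : ι → ℂ) (eta : Z → ℂ) (s : Z ⊕ Z) :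
    extSeq Z om (eta + wt s) = extSeq Z om eta + wt (embIdx Z s) := by
  funext i
  rw [Pi.add_apply]
  by_cases h : i ∈ Z
  · have e1 := extSeq_val Z om (eta + wt s) ⟨i, h⟩
    have e2 := extSeq_val Z om eta ⟨i, h⟩
    simp only at e1 e2
    rw [e1, e2, Pi.add_apply]
    congr 1
    rcases s with j | j <;> by_cases hj : (⟨i, h⟩ : Z) = j
    all_goals first
      | (subst hj; simp [wt])
      | (have hj' : i ≠ j := fun he => hj (Subtype.ext he)
         simp [wt, eps_ne hj, eps_ne hj'])
  · rw [extSeq_of_notMem Z _ _ h, extSeq_of_notMem Z _ _ h]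
    have : wt (embIdx Z s) i = 0 := by
      apply wt_ne
      rintro rfl
      rcases s with j | j <;> exact h j.2
    rw [this, add_zero]

theorem coef_extSeq (om : ι → ℂ) (eta : Z → ℂ) (s : Z ⊕ Z) :
    coef (embIdx Z s) (extSeq Z om eta) = coef s eta := by
  rcases s with j | j
  · have := extSeq_val Z om eta j
    simp [coef, this]
  · exact extSeq_val Z om eta j

theorem extV_bv (s : Z ⊕ Z) : extV Z (bv s) = bv (embIdx Z s) := by
  simp [extV]

theorem extV_dualBv (s : Z ⊕ Z) : extV Z (dualBv s) = dualBv (embIdx Z s) := by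
  rw [dualBv, dualBv, map_smul, extV_bv]
  rcases s with j | j <;> rfl

/-- Operators at places in Z see only the entries there, so freezing the other exponents at those of
ω commutes with them. -/
theorem transfer_tSp {om : ι → ℂ} (T : Mono Z →ₗ[ℂ] Mono ι)
    (hT : ∀ eta, T (mono eta) = mono (extSeq Z om eta)) (A : sp Z) (m : Mono Z) :
    T (tSp A.1 m) = tSp (spIncl Z A).1 (T m) := by
  classical
  have hW : ∀ (v : SpV Z) (m : Mono Z), T (tWeyl v m) = tWeyl (extV Z v) (T m) := by
    intro v m
    induction v using Finsupp.induction_linear with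
    | zero => simp
    | add f g hf hg => simp [hf, hg]
    | single s c =>
      have : (Finsupp.single s c : SpV Z) = c • bv s := by simp
      rw [this]
      simp only [map_smul, LinearMap.smul_apply, extV_bv, tWeyl_bv]
      congr 1
      have : T ∘ₗ tGen s = tGen (embIdx Z s) ∘ₗ T := by
        refine (monoBasis Z).ext fun eta => ?_
        change T (tGen s (mono eta)) = tGen (embIdx Z s) (T (mono eta))
        rw [tGen_mono, map_smul, hT, hT, tGen_mono, coef_extSeq, extSeq_add_wt]
      exact LinearMap.congr_fun this m
  obtain ⟨K, hK⟩ := A.2.1.exists_finset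
  have hb : ∀ s : Z ⊕ Z, (spIncl Z A).1 (bv (embIdx Z s)) = extV Z (A.1 (bv s)) := fun s => by
    change extV Z (A.1 (resV Z (bv (embIdx Z s)))) = _
    rw [← extV_bv, resV_extV]
  have hK' : ∀ j, j ∉ K.image (embIdx Z) → (spIncl Z A).1 (bv j) = 0 := by
    intro j hj
    have : A.1 (resV Z (bv j)) = 0 := by
      rw [apply_eq_sum A.1 K hK]
      refine Finset.sum_eq_zero fun s hs => ?_
      rw [resV_apply, Finsupp.single_eq_of_ne, zero_smul]
      rintro rfl
      exact hj (Finset.mem_image_of_mem _ hs)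
    change extV Z (A.1 (resV Z (bv j))) = 0
    rw [this, map_zero]
  rw [tSp_eq_sum K hK, tSp_eq_sum _ hK', Finset.sum_image ((map_val_injective Z).injOn)]
  simp only [LinearMap.smul_apply, LinearMap.sum_apply, map_smul, map_sum, Module.End.mul_apply,
    hW, hb, extV_dualBv]

/-- After replacing μ by ω, the difference is supported in Z and keeps its sum under restriction,
and Int⁺ can differ only in Z. -/
theorem simSp_extSeq_iff {om mu : ι → ℂ} (hom : SimSp om mu) (eta : Z → ℂ) :
    SimSp (extSeq Z om eta) mu ↔ SimSp eta (fun i : Z => om i) := by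
  classical
  have hI : SimSp (extSeq Z om eta) mu ↔ SimSp (extSeq Z om eta) om :=
    ⟨fun h => h.trans hom.symm, fun h => h.trans hom⟩
  rw [hI]
  refine and_congr ⟨?_, ?_⟩ ⟨fun h => ?_, fun h => ?_⟩
  · rintro ⟨f, hf, he⟩
    have hs : ∀ i, i ∉ Set.range (Subtype.val : Z → ι) → f i = 0 := by
      intro i hi
      have hi' : i ∉ Z := by simpa using hi
      have := hf i
      rw [Pi.sub_apply, extSeq_of_notMem Z _ _ hi', sub_self] at this
      exact_mod_cast this.symm
    refine ⟨f.comapDomain Subtype.val Subtype.val_injective.injOn, fun i => ?_, ?_⟩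
    · rw [Finsupp.comapDomain_apply, ← hf, Pi.sub_apply, Pi.sub_apply, extSeq_val]
    · have : Finsupp.mapDomain Subtype.val
          (f.comapDomain (Subtype.val : Z → ι) Subtype.val_injective.injOn) = f := by
        refine Finsupp.mapDomain_comapDomain _ Subtype.val_injective _ fun i hi => ?_
        by_contra h
        exact (Finsupp.mem_support_iff.1 hi) (hs i h)
      rw [← this, Finsupp.sum_mapDomain_index (by simp) (by simp)] at he
      exact he
  · rintro ⟨f, hf, he⟩
    refine ⟨Finsupp.mapDomain Subtype.val f, fun i => ?_, ?_⟩
    · by_cases h : i ∈ Z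
      · have e1 := extSeq_val Z om eta ⟨i, h⟩
        have e2 := Finsupp.mapDomain_apply Subtype.val_injective f (⟨i, h⟩ : Z)
        have e3 := hf ⟨i, h⟩
        simp only [Pi.sub_apply] at e1 e2 e3
        rw [Pi.sub_apply, e1, e2, e3]
      · rw [Pi.sub_apply, extSeq_of_notMem Z _ _ h, sub_self,
          Finsupp.mapDomain_of_notMem_range _ _ (by simpa using h), Int.cast_zero]
    · rwa [Finsupp.sum_mapDomain_index (by simp) (by simp)]
  · ext i
    have := Set.ext_iff.1 h i
    simp only [IntPlus, Set.mem_ofPred_eq, extSeq_val] at this ⊢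
    exact this
  · ext i
    by_cases hi : i ∈ Z
    · have := Set.ext_iff.1 h ⟨i, hi⟩
      have e1 := extSeq_val Z om eta ⟨i, hi⟩
      simp only [IntPlus, Set.mem_ofPred_eq] at this e1 ⊢
      rw [e1]
      exact this
    · simp only [IntPlus, Set.mem_ofPred_eq, extSeq_of_notMem Z _ _ hi]

end Extension

/-! ### Fixed points spanned by vacua. -/

section FormOne

variable {r : ℤ → ℤ → Prop}

theorem image_extSeq (hr : IsAdmissibleZ2 r) {mu om : ℕ+ → ℂ} (hom : om ∈ RSet r mu) :
    extSeq (zeroSet r) om '' {eta | SimSp eta (fun i : zeroSet r => om i)} =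
      {lam | SimSp lam mu ∧ IsVacuum r lam} := by
  have h := (mem_RSet_iff hr).1 hom
  have hv := (isVacuum_iff hr).1 h.2
  have hz : ∀ i : ℕ+, i ∈ zeroSet r ↔ ¬ r 0 i ∧ ¬ r i 0 := fun i => hr.mem_cls_iff
  ext lam
  constructor
  · rintro ⟨eta, heta, rfl⟩
    refine ⟨(simSp_extSeq_iff _ h.1 eta).2 heta, (isVacuum_iff hr).2 ⟨fun i hi => ?_,
      fun i hi => ?_⟩⟩
    · rw [extSeq_of_notMem _ _ _ fun hc => ((hz i).1 hc).2 hi, hv.1 i hi]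
    · rw [extSeq_of_notMem _ _ _ fun hc => ((hz i).1 hc).1 hi, hv.2 i hi]
  · rintro ⟨h1, h2⟩
    have h2' := (isVacuum_iff hr).1 h2
    have e : extSeq (zeroSet r) om (fun i => lam i) = lam := by
      funext i
      by_cases hi : i ∈ zeroSet r
      · exact extSeq_val (zeroSet r) om (fun i => lam i) ⟨i, hi⟩
      · rw [extSeq_of_notMem _ _ _ hi]
        by_cases h0 : r 0 i
        · rw [hv.2 i h0, h2'.2 i h0]
        · have h3 : r i 0 := by
            by_contra h4
            exact hi ((hz i).2 ⟨h0, h4⟩)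
          rw [hv.1 i h3, h2'.1 i h3]
    refine ⟨fun i => lam i, (simSp_extSeq_iff _ h.1 _).1 ?_, e⟩
    rwa [e]

/-- A class other than [0] lies wholly below or wholly above 0, so on vacua either all x_s or all
x_{-s} with s in it vanish. -/
theorem vacuum_coef_cases (hr : IsAdmissibleZ2 r) {p : ℤ} (hp : p ∉ cls r 0) {E : Set (ℕ+ → ℂ)}
    (hE : ∀ lam ∈ E, IsVacuum r lam) :
    (∀ s ∈ clsIdx r p, ∀ lam ∈ E, coef s lam = 0) ∨
      (∀ s ∈ clsIdx r p, ∀ lam ∈ E, coef s.swap lam = 0) := by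
  by_cases h : r p 0
  · exact Or.inl fun s hs lam hl => hE lam hl s (hr.rel_zero_of_mem_cls h hs)
  · have h' : r 0 p := by
      by_contra h''
      exact hp (hr.mem_cls_iff.2 ⟨h'', h⟩)
    exact Or.inr fun s hs lam hl =>
      hE lam hl _ (hr.swap_rel_zero.2 (hr.zero_rel_of_mem_cls h' hs))

theorem formSp_of_mem_RSet (hr : IsAdmissibleZ2 r) {mu om : ℕ+ → ℂ} (hom : om ∈ RSet r mu) :
    FormSp r mu om := by
  obtain ⟨Phi, hinj, hrange, hPhi⟩ := exists_model_sp mu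
  obtain ⟨Phi₁, hinj₁, hrange₁, hPhi₁⟩ := exists_model_sp (fun i : zeroSet r => om i)
  obtain ⟨T, hT, hTmap, hTinj⟩ := exists_transfer (eta := (id : (zeroSet r → ℂ) → _))
    (theta := extSeq (zeroSet r) om) (c := fun _ => 1) Function.injective_id
    (extSeq_injective _ _) (fun _ => one_ne_zero)
  have hfix := range_comp_subtype_fixedPts hr Phi hinj hrange hPhi
  rw [fixed_eq_of_mem_RSet hr hom] at hfix
  obtain ⟨psi, hpsi⟩ := exists_equiv_of_transfer Phi₁ hinj₁
    (Phi ∘ₗ (fixedPts r (Xsp mu)).subtype) (hinj.comp Subtype.val_injective) T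
    (fun x _ => hTinj x (by
      rw [mem_monoSpan]
      intro lam _
      exact ⟨lam, rfl⟩))
    (by rw [hrange₁, hfix, ← image_extSeq hr hom, ← hTmap, Set.image_id])
  have hpsi' : ∀ x, Phi (psi x : Xsp mu) = T (Phi₁ x) := hpsi
  refine ⟨psi, fun A m => ?_, fun p hp B m hm => ?_⟩
  · apply hinj
    rw [hpsi', hPhi₁, hPhi, hpsi']
    exact transfer_tSp _ T (fun eta => by simpa using hT eta) A _
  · have h1 : Phi m ∈ monoSpan {lam | SimSp lam mu ∧ IsVacuum r lam} := by
      rw [← hfix]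
      exact ⟨⟨m, hm⟩, rfl⟩
    exact slIncl_eq_zero Phi hinj hPhi B h1 (vacuum_coef_cases hr hp fun lam hl => hl.2)

theorem spIncl_eq_zero (h0 : cls r 0 = {0}) (A : sp (zeroSet r)) :
    spIncl (zeroSet r) A = 0 := by
  have hZ : IsEmpty (zeroSet r) := ⟨fun i => by
    have h : (i.1 : ℤ) ∈ cls r 0 := i.2
    rw [h0] at h
    exact i.1.ne_zero (by exact_mod_cast Set.mem_singleton_iff.1 h)⟩
  have : A = 0 := Subtype.ext (LinearMap.ext fun v => Subsingleton.elim _ _)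
  rw [this, map_zero]

theorem formTriv_of_simSp (hr : IsAdmissibleZ2 r) (h0 : cls r 0 = {0}) {mu : ℕ+ → ℂ}
    (hmu : SimSp mu (omPlus r)) : FormTriv r mu := by
  obtain ⟨Phi, hinj, hrange, hPhi⟩ := exists_model_sp mu
  have hfix := range_comp_subtype_fixedPts hr Phi hinj hrange hPhi
  rw [fixed_eq_of_simSp_omPlus hr h0 hmu] at hfix
  refine ⟨?_, fun A m _ => ?_, fun p hp B m hm => ?_⟩
  -- The fixed points are the line through the monomial of the unique vacuum.
  · rw [← LinearMap.finrank_range_of_inj (f := Phi ∘ₗ (fixedPts r (Xsp mu)).subtype)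
      (hinj.comp Subtype.val_injective), hfix, monoSpan, Set.image_singleton]
    exact finrank_span_singleton (mono_ne_zero _)
  · rw [spIncl_eq_zero h0, zero_lie]
  · have h1 : Phi m ∈ monoSpan {omPlus r} := by
      rw [← hfix]
      exact ⟨⟨m, hm⟩, rfl⟩
    refine slIncl_eq_zero Phi hinj hPhi B h1 (vacuum_coef_cases hr hp fun lam hl => ?_)
    rw [Set.mem_singleton_iff.1 hl]
    exact omPlus_isVacuum hr

end FormOne

end WeightModules

end

noncomputable section

namespace WeightModules

/-! ### The components `sl([i])` -/

section SlModules

variable {J : Type}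

theorem exists_single_of_sum_eq_one (g : J →₀ ℤ) (h : ∀ j, 0 ≤ g j)
    (hs : (g.sum fun _ a => a) = 1) : ∃ j, g = Finsupp.single j 1 := by
  classical
  have hne : g ≠ 0 := by
    rintro rfl
    simp at hs
  obtain ⟨j, hj⟩ := Finsupp.ne_iff.1 hne
  have hj1 : 1 ≤ g j := by
    have := h j
    rw [Finsupp.zero_apply] at hj
    omega
  have hjs : j ∈ g.support := Finsupp.mem_support_iff.2 hj
  have e := Finset.add_sum_erase g.support g hjs
  have e' : ∑ i ∈ g.support, g i = 1 := hs
  have hnn : 0 ≤ ∑ i ∈ g.support.erase j, g i := Finset.sum_nonneg fun i _ => h i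
  have h0 : ∑ i ∈ g.support.erase j, g i = 0 := by omega
  refine ⟨j, Finsupp.ext fun i => ?_⟩
  by_cases hi : i = j
  · subst hi
    rw [Finsupp.single_eq_same]
    omega
  · rw [Finsupp.single_eq_of_ne hi]
    by_contra hg
    exact hg ((Finset.sum_eq_zero_iff_of_nonneg fun i _ => h i).1 h0 i
      (Finset.mem_erase.2 ⟨hi, Finsupp.mem_support_iff.2 hg⟩))

theorem eps_eq_single (j i : J) : eps j i = ((Finsupp.single j 1 : J →₀ ℤ) i : ℂ) := by
  classical
  by_cases h : i = j
  · subst h; simp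
  · simp [eps_ne h, Finsupp.single_eq_of_ne h]

theorem eps_sub_eps_mem (j k : J) : eps j - eps k ∈ rootLatticeSl J := by
  classical
  refine ⟨Finsupp.single j 1 - Finsupp.single k 1, fun i => ?_, ?_⟩
  · rw [Pi.sub_apply, eps_eq_single, eps_eq_single, Finsupp.sub_apply, Int.cast_sub]
  · rw [Finsupp.sum_sub_index (by simp)]
    simp

theorem intPlus_eps (j : J) : IntPlus (eps j) = Set.univ := by
  classical
  refine Set.eq_univ_of_forall fun i => ?_
  by_cases h : i = j
  · subst h; exact ⟨1, by simp⟩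
  · exact ⟨0, by simp [eps_ne h]⟩

theorem intPlus_neg_one_sub_eps (j : J) : IntPlus (-1 - eps j) = ∅ := by
  classical
  refine Set.eq_empty_of_forall_notMem fun i => ?_
  rintro ⟨n, hn⟩
  rw [Pi.sub_apply, eps_eq_single, Pi.neg_apply, Pi.one_apply] at hn
  have h1 : ((-1 - (Finsupp.single j 1 : J →₀ ℤ) i : ℤ) : ℂ) = ((n : ℤ) : ℂ) := by
    push_cast
    exact hn
  have h2 := Int.cast_injective h1
  have h3 : 0 ≤ (Finsupp.single j 1 : J →₀ ℤ) i := by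
    rw [Finsupp.single_apply]
    split_ifs <;> norm_num
  omega

/-- Entries in ℤ_{≥0} with sum 1 leave only the ε_k: X_sl(ε_j) is spanned by the variables. -/
theorem slClass_eps (j : J) :
    {lam : J → ℂ | lam - eps j ∈ rootLatticeSl J ∧ IntPlus lam = IntPlus (eps j)} =
      Set.range eps := by
  classical
  ext lam
  constructor
  · rintro ⟨⟨f, hf, hs⟩, hI⟩
    rw [intPlus_eps] at hI
    have hg : ∀ i, lam i = ((f + Finsupp.single j 1 : J →₀ ℤ) i : ℂ) := by
      intro i
      have := hf i
      rw [Pi.sub_apply, eps_eq_single] at this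
      rw [Finsupp.add_apply, Int.cast_add]
      linear_combination this
    obtain ⟨k, hk⟩ := exists_single_of_sum_eq_one (f + Finsupp.single j 1) (fun i => by
        obtain ⟨n, hn⟩ : i ∈ IntPlus lam := by rw [hI]; trivial
        have h1 : (((f + Finsupp.single j 1 : J →₀ ℤ) i : ℤ) : ℂ) = ((n : ℤ) : ℂ) := by
          rw [← hg, hn, Int.cast_natCast]
        rw [Int.cast_injective h1]
        exact Int.natCast_nonneg n) (by
        rw [Finsupp.sum_add_index' (by simp) (by simp), hs]; simp)
    refine ⟨k, funext fun i => ?_⟩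
    rw [hg, hk, eps_eq_single]
  · rintro ⟨k, rfl⟩
    exact ⟨eps_sub_eps_mem k j, by rw [intPlus_eps, intPlus_eps]⟩

/-- Here all entries of λ are negative integers, so -1 - λ has nonnegative entries, with sum 1, and
is some ε_k. -/
theorem slClass_neg_one_sub_eps (j : J) :
    {lam : J → ℂ | lam - (-1 - eps j) ∈ rootLatticeSl J ∧
      IntPlus lam = IntPlus (-1 - eps j)} = Set.range fun k => -1 - eps k := by
  classical
  ext lam
  constructor
  · rintro ⟨⟨f, hf, hs⟩, hI⟩
    rw [intPlus_neg_one_sub_eps] at hI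
    have hg : ∀ i, lam i = -1 - ((Finsupp.single j 1 - f : J →₀ ℤ) i : ℂ) := by
      intro i
      have := hf i
      rw [Pi.sub_apply, Pi.sub_apply, eps_eq_single, Pi.neg_apply, Pi.one_apply] at this
      rw [Finsupp.sub_apply, Int.cast_sub]
      linear_combination this
    obtain ⟨k, hk⟩ := exists_single_of_sum_eq_one (Finsupp.single j 1 - f) (fun i => by
        by_contra hneg
        have h1 : i ∈ IntPlus lam := by
          refine ⟨(-1 - (Finsupp.single j 1 - f : J →₀ ℤ) i).toNat, ?_⟩
          rw [hg]
          have h2 := Int.toNat_of_nonneg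
            (a := -1 - (Finsupp.single j 1 - f : J →₀ ℤ) i) (by omega)
          have h3 := congrArg (Int.cast : ℤ → ℂ) h2
          rw [Int.cast_natCast] at h3
          rw [h3]
          push_cast
          ring
        rw [hI] at h1
        exact h1) (by
        rw [Finsupp.sum_sub_index (by simp), hs]; simp)
    refine ⟨k, funext fun i => ?_⟩
    beta_reduce
    rw [hg, hk, Pi.sub_apply, eps_eq_single, Pi.neg_apply, Pi.one_apply]
  · rintro ⟨k, rfl⟩
    refine ⟨?_, by rw [intPlus_neg_one_sub_eps, intPlus_neg_one_sub_eps]⟩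
    rw [sub_sub_sub_cancel_left]
    exact eps_sub_eps_mem j k

theorem eps_injective : Function.Injective (eps : J → J → ℂ) := by
  intro j k h
  by_contra hne
  have := congrFun h j
  rw [eps_self, eps_ne hne] at this
  exact one_ne_zero this

theorem tWeyl_inlV (v : J →₀ ℂ) (m : Mono J) :
    tWeyl (inlV v) m = v.sum fun l c => c • tGen (Sum.inl l) m := by
  classical
  rw [tWeyl_apply_eq_sum]
  exact Finsupp.sum_mapDomain_index (h := fun s c => c • tGen s m) (fun _ => zero_smul _ _)
    (fun _ _ _ => add_smul _ _ _)

theorem tSl_mono_eps (B : sl J) (k : J) :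
    tSl B.1 (mono (eps k)) =
      (B.1 (Finsupp.single k 1)).sum fun l c => c • mono (eps l) := by
  classical
  obtain ⟨K, hK⟩ := B.2.1.exists_finset
  rw [tSl_eq_sum K hK, LinearMap.sum_apply, Finset.sum_eq_single k]
  · have e : tGen (Sum.inr k) (mono (eps k)) = mono (0 : J → ℂ) := by
      rw [tGen_mono, coef_inr, eps_self, one_smul]
      simp [wt]
    rw [Module.End.mul_apply, e, tWeyl_inlV]
    refine Finsupp.sum_congr fun l _ => ?_
    rw [tGen_mono]
    simp [coef, wt]
  · intro j _ hj
    rw [Module.End.mul_apply, tGen_mono_eq_zero (by rw [coef_inr, eps_ne hj]), map_zero]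
  · intro h
    rw [hK k h]
    simp

/-- With tr B = 0 the multiplications may act before the derivatives. Only x_k does not kill this
monomial, since all other exponents are -1; then ∂_j contributes -1. The result is the dual of the
natural action. -/
theorem tSl_mono_neg_one_sub_eps (B : sl J) (K : Finset J)
    (hK : ∀ j, j ∉ K → B.1 (Finsupp.single j 1) = 0) (k : J) :
    tSl B.1 (mono (-1 - eps k)) =
      ∑ j ∈ K, -(B.1 (Finsupp.single j 1) k) • mono (-1 - eps j) := by
  classical
  have tr0 : ∑ j ∈ K, B.1 (Finsupp.single j 1) j = 0 := by
    rw [← tr_eq_sum K hK]; exact B.2.2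
  have hcomm : ∀ j, tWeyl (inlV (B.1 (Finsupp.single j 1))) * tGen (Sum.inr j) =
      tGen (Sum.inr j) * tWeyl (inlV (B.1 (Finsupp.single j 1))) -
        B.1 (Finsupp.single j 1) j • 1 := by
    intro j
    rw [← tWeyl_bv, tWeyl_comm, omega_swap, omega_bv_left, Sum.swap_inr, inlV,
      Finsupp.lmapDomain_apply, Finsupp.mapDomain_apply Sum.inl_injective]
    simp [sgn]
  have hW : ∀ v : J →₀ ℂ, tWeyl (inlV v) (mono (-1 - eps k)) = v k • mono (-1) := by
    intro v
    rw [tWeyl_inlV, Finsupp.sum, Finset.sum_eq_single k]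
    · rw [tGen_mono]
      simp [coef, wt]
    · intro l _ hl
      rw [tGen_mono_eq_zero (coef_inl_eq_zero.2 (by simp [eps_ne hl])), smul_zero]
    · intro h
      rw [Finsupp.notMem_support_iff.1 h, zero_smul]
  rw [tSl_eq_sum K hK, Finset.sum_congr rfl fun j _ => hcomm j, Finset.sum_sub_distrib,
    ← Finset.sum_smul, tr0, zero_smul, sub_zero, LinearMap.sum_apply]
  refine Finset.sum_congr rfl fun j _ => ?_
  rw [Module.End.mul_apply, hW, map_smul, tGen_mono, coef_inr, Pi.neg_apply, Pi.one_apply,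
    neg_smul, neg_smul, one_smul, smul_neg]
  rfl

end SlModules

/-! ### Fixed points with one defect. -/

section FormTwo

variable {r : ℤ → ℤ → Prop}

/-- Defects sit in [s], so for p outside [0] and ±[s] all indices of [p], or all their negatives,
lie below 0 and kill every fixed monomial. -/
theorem formSl_trivial_part (hr : IsAdmissibleZ2 r) {mu : ℕ+ → ℂ}
    {s : Idx} (hs : IsMaxBelow r (toZ s)) (Phi : Xsp mu →ₗ[ℂ] Mono ℕ+)
    (hinj : Function.Injective Phi) (hPhi : ∀ (A : spInf) m, Phi ⁅A, m⁆ = tSp A.1 (Phi m))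
    {m : Xsp mu} (hm : Phi m ∈ monoSpan ((fun t => omPlus r - wt t) '' clsIdx r (toZ s)))
    {p : ℤ} (hp0 : p ∉ cls r 0) (hp1 : p ∉ cls r (toZ s)) (hp2 : -p ∉ cls r (toZ s))
    (B : sl (clsIdx r p)) : ⁅slIncl (clsIdx r p) B, m⁆ = 0 := by
  refine slIncl_eq_zero Phi hinj hPhi B hm ?_
  have key : ∀ q : ℤ, q ∉ cls r (toZ s) → ∀ u ∈ clsIdx r q, ∀ t ∈ clsIdx r (toZ s), u ≠ t := by
    rintro q hq u hu t ht rfl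
    apply hq
    rw [hr.cls_eq ht hu]
    exact self_mem_cls r q
  by_cases h : r p 0
  · left
    rintro u hu _ ⟨t, ht, rfl⟩
    exact coef_omPlus_sub hr (hr.rel_zero_of_mem_cls hs.1 ht) (hr.rel_zero_of_mem_cls h hu)
      (key p hp1 u hu t ht)
  · have h' : r 0 p := by
      by_contra h''
      exact hp0 (hr.mem_cls_iff.2 ⟨h'', h⟩)
    right
    rintro u hu _ ⟨t, ht, rfl⟩
    have hu' : u.swap ∈ clsIdx r (-p) := by
      change toZ u.swap ∈ cls r (-p)
      rw [toZ_swap]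
      exact hr.neg_mem_cls_iff.2 hu
    exact coef_omPlus_sub hr (hr.rel_zero_of_mem_cls hs.1 ht)
      (hr.swap_rel_zero.2 (hr.zero_rel_of_mem_cls h' hu)) (key _ hp2 _ hu' t ht)

theorem formSl_etaMinus (hr : IsAdmissibleZ2 r) (h0 : cls r 0 = {0}) {mu : ℕ+ → ℂ} {i₀ : ℕ+}
    (hi : IsMaxBelow r i₀) (hmu : SimSp mu (omPlus r - eps i₀)) :
    FormSl r mu i₀ (etaMinus r i₀) := by
  classical
  have hs : IsMaxBelow r (toZ (Sum.inl i₀)) := hi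
  have hneg : ∀ t : clsIdx r i₀, r (toZ t.1) 0 := fun t => hr.rel_zero_of_mem_cls hi.1 t.2
  obtain ⟨Phi, hinj, hrange, hPhi⟩ := exists_model_sp mu
  obtain ⟨Phi₁, hinj₁, hrange₁, hPhi₁⟩ := exists_model_sl (etaMinus r i₀)
  have heta : etaMinus r i₀ = -1 - eps ⟨Sum.inl i₀, self_mem_cls r i₀⟩ := by
    funext t
    by_cases h : t.1 = Sum.inl i₀
    · have : t = ⟨Sum.inl i₀, self_mem_cls r i₀⟩ := Subtype.ext h
      subst this
      simp [etaMinus]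
      norm_num
    · rw [etaMinus, if_neg h, Pi.sub_apply, eps_ne fun he => h (congrArg Subtype.val he)]
      simp
  obtain ⟨T, hT, hTmap, hTinj⟩ := exists_transfer
    (eta := fun k : clsIdx r i₀ => (-1 - eps k : clsIdx r i₀ → ℂ))
    (theta := fun k => omPlus r - wt k.1) (c := fun _ => 1)
    (fun a b h => eps_injective (sub_right_injective h))
    (fun a b h => Subtype.ext (wt_injective (sub_right_injective h))) (fun _ => one_ne_zero)
  simp only [one_smul] at hT
  have hfix := range_comp_subtype_fixedPts hr Phi hinj hrange hPhi
  rw [fixed_eq_of_simSp_omPlus_sub hr h0 hs hmu] at hfix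
  have hclass : {lam | lam - etaMinus r i₀ ∈ rootLatticeSl (clsIdx r i₀) ∧
      IntPlus lam = IntPlus (etaMinus r i₀)} = Set.range fun k => -1 - eps k := by
    rw [heta]
    exact slClass_neg_one_sub_eps _
  rw [hclass] at hrange₁
  obtain ⟨psi, hpsi⟩ := exists_equiv_of_transfer Phi₁ hinj₁
    (Phi ∘ₗ (fixedPts r (Xsp mu)).subtype) (hinj.comp Subtype.val_injective) T
    (by rw [hrange₁]; exact hTinj) (by
      rw [hrange₁, hfix, ← Set.image_univ, hTmap]
      congr 1
      ext lam
      constructor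
      · rintro ⟨k, -, rfl⟩
        exact ⟨k.1, k.2, rfl⟩
      · rintro ⟨k, hk, rfl⟩
        exact ⟨⟨k, hk⟩, trivial, rfl⟩)
  have hpsi' : ∀ x, Phi (psi x : Xsp mu) = T (Phi₁ x) := hpsi
  have hmem : ∀ m ∈ fixedPts r (Xsp mu),
      Phi m ∈ monoSpan ((fun t => omPlus r - wt t) '' clsIdx r (toZ (Sum.inl i₀))) := by
    intro m hm
    rw [← hfix]
    exact ⟨⟨m, hm⟩, rfl⟩
  refine ⟨psi, fun B m => ?_, fun A m _ => ?_, fun p hp0 hp1 hp2 B m hm => ?_⟩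
  · apply hinj
    obtain ⟨K, hK⟩ := B.2.1.exists_finset
    rw [hpsi', hPhi₁, (slIncl_action Phi hPhi B K hK _).1, hpsi']
    have hx : Phi₁ m ∈ monoSpan (Set.range fun k : clsIdx r i₀ => (-1 - eps k : _ → ℂ)) := by
      rw [← hrange₁]
      exact ⟨m, rfl⟩
    have : (T ∘ₗ tSl B.1) (Phi₁ m) = ((∑ j ∈ K, (tWeyl (dualBv j.1) :
        Module.End ℂ (Mono ℕ+)) * tWeyl (incV _ (B.1 (Finsupp.single j 1)))) ∘ₗ T)
          (Phi₁ m) := by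
      refine eq_on_monoSpan (fun lam hl => ?_) hx
      obtain ⟨k, rfl⟩ := hl
      -- The indices of [i₀] lie below 0, so x_k repairs the defect at k and every other x_l kills.
      -- The dual factor then creates a defect at j with coefficient `sgn j * (-sgn j) = -1`.
      have hW : ∀ v : clsIdx r i₀ →₀ ℂ, tWeyl (incV _ v) (mono (omPlus r - wt k.1)) =
          v k • mono (omPlus r) := by
        intro v
        rw [tWeyl_incV, Finsupp.sum, Finset.sum_eq_single k]
        · rw [tGen_mono, coef_omPlus_sub_self hr (hneg k), one_smul, sub_add_cancel]
        · intro l _ hl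
          rw [tGen_mono_eq_zero (coef_omPlus_sub hr (hneg k) (hneg l)
            fun h => hl (Subtype.ext h)), smul_zero]
        · intro h
          rw [Finsupp.notMem_support_iff.1 h, zero_smul]
      simp only [LinearMap.comp_apply, LinearMap.sum_apply, Module.End.mul_apply]
      rw [tSl_mono_neg_one_sub_eps B K hK, map_sum, hT]
      refine Finset.sum_congr rfl fun j _ => ?_
      rw [map_smul, hT, hW, map_smul, tWeyl_dualBv, LinearMap.smul_apply, tGen_mono,
        coef_swap_omPlus hr (hneg j), smul_smul (sgn _), mul_neg, sgn_mul_self, wt_swap,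
        ← sub_eq_add_neg, smul_smul, mul_neg, mul_one]
    simpa only [LinearMap.comp_apply, LinearMap.sum_apply, Module.End.mul_apply] using this
  · rw [spIncl_eq_zero h0, zero_lie]
  · refine formSl_trivial_part hr hs Phi hinj hPhi (hmem m hm) hp0 hp1 (fun h => hp2 ?_) B
    have := hr.neg_mem_cls_iff.2 h
    rwa [neg_neg] at this

theorem formSl_etaPlus (hr : IsAdmissibleZ2 r) (h0 : cls r 0 = {0}) {mu : ℕ+ → ℂ} {i₀ : ℕ+}
    (hi : IsMinAbove r i₀) (hmu : SimSp mu (omMinus r + eps i₀)) :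
    FormSl r mu i₀ (etaPlus r i₀) := by
  classical
  have hs : IsMaxBelow r (toZ (Sum.inr i₀)) := (isMinAbove_iff hr).1 hi
  have hneg : ∀ t : clsIdx r i₀, r (toZ t.1.swap) 0 := fun t =>
    hr.swap_rel_zero.2 (hr.zero_rel_of_mem_cls hi.1 t.2)
  have hmu' : SimSp mu (omPlus r - wt (Sum.inr i₀)) := by
    rw [omMinus_eq_omPlus hr h0] at hmu
    simpa [wt] using hmu
  obtain ⟨Phi, hinj, hrange, hPhi⟩ := exists_model_sp mu
  obtain ⟨Phi₁, hinj₁, hrange₁, hPhi₁⟩ := exists_model_sl (etaPlus r i₀)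
  have heta : etaPlus r i₀ = eps ⟨Sum.inl i₀, self_mem_cls r i₀⟩ := by
    funext t
    by_cases h : t.1 = Sum.inl i₀
    · have : t = ⟨Sum.inl i₀, self_mem_cls r i₀⟩ := Subtype.ext h
      subst this
      simp [etaPlus]
    · rw [etaPlus, if_neg h, eps_ne fun he => h (congrArg Subtype.val he)]
  have hsgn : ∀ k : Idx, (sgn k : ℂ) ≠ 0 := fun k h => by
    have := sgn_mul_self k
    simp [h] at this
  -- The index -k is now below 0, so `dualBv k` repairs the defect with sign `sgn k`, and x_l
  -- applied to the vacuum has coefficient `sgn l`. Rescaling by `sgn k` absorbs both.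
  obtain ⟨T, hT, hTmap, hTinj⟩ := exists_transfer
    (eta := fun k : clsIdx r i₀ => (eps k : clsIdx r i₀ → ℂ))
    (theta := fun k => omPlus r - wt k.1.swap) (c := fun k => sgn k.1)
    eps_injective
    (fun a b h => Subtype.ext (Sum.swap_leftInverse.injective
      (wt_injective (sub_right_injective h)))) (fun k => hsgn k.1)
  have hfix := range_comp_subtype_fixedPts hr Phi hinj hrange hPhi
  rw [fixed_eq_of_simSp_omPlus_sub hr h0 hs hmu'] at hfix
  have hclass : {lam | lam - etaPlus r i₀ ∈ rootLatticeSl (clsIdx r i₀) ∧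
      IntPlus lam = IntPlus (etaPlus r i₀)} = Set.range eps := by
    rw [heta]
    exact slClass_eps _
  rw [hclass] at hrange₁
  obtain ⟨psi, hpsi⟩ := exists_equiv_of_transfer Phi₁ hinj₁
    (Phi ∘ₗ (fixedPts r (Xsp mu)).subtype) (hinj.comp Subtype.val_injective) T
    (by rw [hrange₁]; exact hTinj) (by
      rw [hrange₁, hfix, ← Set.image_univ, hTmap]
      congr 1
      have hcls : ∀ k : Idx, toZ k.swap ∈ cls r (toZ (Sum.inr i₀)) ↔ toZ k ∈ cls r i₀ := by
        intro k
        rw [toZ_swap]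
        exact hr.neg_mem_cls_iff
      ext lam
      constructor
      · rintro ⟨k, -, rfl⟩
        exact ⟨k.1.swap, (hcls k.1).2 k.2, rfl⟩
      · rintro ⟨k, hk, rfl⟩
        refine ⟨⟨k.swap, (hcls k.swap).1 ?_⟩, trivial, ?_⟩
        · rw [Sum.swap_swap]
          exact hk
        · simp)
  have hpsi' : ∀ x, Phi (psi x : Xsp mu) = T (Phi₁ x) := hpsi
  have hmem : ∀ m ∈ fixedPts r (Xsp mu),
      Phi m ∈ monoSpan ((fun t => omPlus r - wt t) '' clsIdx r (toZ (Sum.inr i₀))) := by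
    intro m hm
    rw [← hfix]
    exact ⟨⟨m, hm⟩, rfl⟩
  refine ⟨psi, fun B m => ?_, fun A m _ => ?_, fun p hp0 hp1 hp2 B m hm => ?_⟩
  · apply hinj
    obtain ⟨K, hK⟩ := B.2.1.exists_finset
    rw [hpsi', hPhi₁, (slIncl_action Phi hPhi B K hK _).2, hpsi']
    have hx : Phi₁ m ∈ monoSpan (Set.range fun k : clsIdx r i₀ => (eps k : _ → ℂ)) := by
      rw [← hrange₁]
      exact ⟨m, rfl⟩
    have : (T ∘ₗ tSl B.1) (Phi₁ m) = ((∑ j ∈ K,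
        (tWeyl (incV _ (B.1 (Finsupp.single j 1))) : Module.End ℂ (Mono ℕ+)) *
          tWeyl (dualBv j.1)) ∘ₗ T) (Phi₁ m) := by
      refine eq_on_monoSpan (fun lam hl => ?_) hx
      obtain ⟨k, rfl⟩ := hl
      simp only [LinearMap.comp_apply, LinearMap.sum_apply, Module.End.mul_apply]
      rw [tSl_mono_eps, hT, Finset.sum_eq_single k]
      · rw [tWeyl_dualBv, LinearMap.smul_apply, map_smul, map_smul, map_smul, smul_smul,
          sgn_mul_self, one_smul, tGen_mono, coef_omPlus_sub_self hr (hneg k), one_smul,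
          sub_add_cancel, tWeyl_incV, Finsupp.sum, Finsupp.sum, map_sum]
        refine Finset.sum_congr rfl fun l _ => ?_
        have h1 := coef_swap_omPlus hr (hneg l)
        rw [Sum.swap_swap, sgn_swap, neg_neg] at h1
        rw [map_smul, hT, tGen_mono, h1, wt_swap, sub_neg_eq_add]
      · intro j _ hj
        rw [tWeyl_dualBv, LinearMap.smul_apply, map_smul, map_smul, tGen_mono_eq_zero
          (coef_omPlus_sub hr (hneg k) (hneg j)
            fun h => hj (Subtype.ext (Sum.swap_leftInverse.injective h))),
          smul_zero, map_zero, smul_zero]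
      · intro h
        rw [hK k h]
        simp
    simpa only [LinearMap.comp_apply, LinearMap.sum_apply, Module.End.mul_apply] using this
  · rw [spIncl_eq_zero h0, zero_lie]
  · exact formSl_trivial_part hr hs Phi hinj hPhi (hmem m hm) hp0 hp2
      (fun h => hp1 (hr.neg_mem_cls_iff.1 h)) B

theorem exists_isFixed_of_isAligned (hr : IsAdmissibleZ2 r) {mu : ℕ+ → ℂ}
    (h : IsAligned r (Xsp mu)) : ∃ lam, SimSp lam mu ∧ IsFixed r lam := by
  obtain ⟨m, hm, hm0⟩ := h.exists_ne_zero hr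
  obtain ⟨Phi, hinj, hrange, hPhi⟩ := exists_model_sp mu
  have h1 := (mem_fixedPts_iff hr Phi hinj hrange hPhi m).1 hm
  by_contra! hcon
  have h2 : {lam | SimSp lam mu ∧ IsFixed r lam} = ∅ :=
    Set.eq_empty_of_forall_notMem fun lam hl => hcon lam hl.1 hl.2
  rw [h2, monoSpan, Set.image_empty, Submodule.span_empty, Submodule.mem_bot] at h1
  exact hm0 (hinj (by rw [h1, map_zero]))

end FormTwo

end WeightModules

end

/-! ### The theorem, by cases on [0] and on the form of one fixed monomial. -/

open WeightModules

theorem mainTheorem10 (r : ℤ → ℤ → Prop) (hr : IsAdmissibleZ2 r) (mu : ℕ+ → ℂ)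
    (hal : IsAligned r (Xsp mu)) :
    ((∃ om ∈ RSet r mu, FormSp r mu om) ∨
      (∃ i₀ : ℕ+, IsMaxBelow r i₀ ∧ SimSp mu (omPlus r - eps i₀) ∧
        FormSl r mu i₀ (etaMinus r i₀)) ∨
      (∃ i₀ : ℕ+, IsMinAbove r i₀ ∧ SimSp mu (omMinus r + eps i₀) ∧
        FormSl r mu i₀ (etaPlus r i₀)) ∨
      (((∃ p, IsMaxBelow r p) ∧ SimSp mu (omPlus r) ∨
        (∃ p, IsMinAbove r p) ∧ SimSp mu (omMinus r)) ∧ FormTriv r mu)) ∧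
    (∀ om ∈ RSet r mu, FormSp r mu om) ∧
    (cls r 0 ≠ {0} → (RSet r mu).Nonempty) ∧
    (cls r 0 = {0} →
      (∀ i₀ : ℕ+, IsMaxBelow r i₀ → SimSp mu (omPlus r - eps i₀) →
        FormSl r mu i₀ (etaMinus r i₀)) ∧
      (∀ i₀ : ℕ+, IsMinAbove r i₀ → SimSp mu (omMinus r + eps i₀) →
        FormSl r mu i₀ (etaPlus r i₀)) ∧
      (SimSp mu (omPlus r) ∨ SimSp mu (omMinus r) → FormTriv r mu)) := by
  obtain ⟨lam, hlam, hfix⟩ := exists_isFixed_of_isAligned hr hal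
  have hne : cls r 0 ≠ {0} → lam ∈ RSet r mu := fun h0 =>
    (mem_RSet_iff hr).2 ⟨hlam, hfix.isVacuum hr h0⟩
  refine ⟨?_, fun om hom => formSp_of_mem_RSet hr hom, fun h0 => ⟨lam, hne h0⟩,
    fun h0 => ⟨fun i₀ => formSl_etaMinus hr h0, fun i₀ => formSl_etaPlus hr h0, fun h => ?_⟩⟩
  · by_cases h0 : cls r 0 = {0}
    · rcases hfix.eq_or hr h0 with rfl | ⟨i | i, hs, rfl⟩
      -- The class of ω falls under the first alternative as well, so the fourth is never chosen.
      · have hR := (mem_RSet_iff hr).2 ⟨hlam, omPlus_isVacuum hr⟩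
        exact Or.inl ⟨_, hR, formSp_of_mem_RSet hr hR⟩
      · have hmu : SimSp mu (omPlus r - eps i) := hlam.symm
        exact Or.inr (Or.inl ⟨i, hs, hmu, formSl_etaMinus hr h0 hs hmu⟩)
      -- A defect at -i is the third alternative: ω - wt(-i) = ω(-) + ε_i, because ω(-) = ω(+) here.
      · have hmin : IsMinAbove r i := (isMinAbove_iff hr).2 hs
        have hmu : SimSp mu (omMinus r + eps i) := by
          rw [omMinus_eq_omPlus hr h0]
          simpa [wt] using hlam.symm
        exact Or.inr (Or.inr (Or.inl ⟨i, hmin, hmu, formSl_etaPlus hr h0 hmin hmu⟩))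
    · exact Or.inl ⟨lam, hne h0, formSp_of_mem_RSet hr (hne h0)⟩
  · rw [omMinus_eq_omPlus hr h0, or_self] at h
    exact formTriv_of_simSp hr h0 h
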